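/- **Setting.** Let $X$ be a finite set whose points are given to algorithms through a fixed injective encoding, let $Y=\{0,1\}$, and let $C\subseteq Y^X$ be a concept class. A distribution $D$ on $X\times Y$ is *realizable* if some $c\in C$ has $\mathrm{err}_D(c)=0$, where $\mathrm{err}_D(f)=\Pr_{(x,y)\sim D}[f(x)\neq y]$. A *statistical query* of tolerance $\tau>0$ is a function $\phi:\mathrm{supp}(D)\to[-1,1]$; the oracle answers it with an arbitrary (possibly adversarial) number $o$ such that $|o-\mathbb E_{z\sim D}[\phi(z)]|\le\tau$. An algorithm $\mathcal A$ $\alpha$-*learns* $C$ with $q$ such queries if for every realizable $D$, and for all admissible oracle answers (and all outcomes of its coins), it makes at most $q$ queries and outputs a hypothesis $h$ with $\mathrm{err}_D(h)\le\alpha$. Its running time is $\mathrm{TIME}(\mathcal A)\le T$ if then it halts within $T$ steps and every value $\phi(z)$, $z\in\mathrm{supp}(D)$, of every query it asks can be computed within $T$ steps. Hypotheses are represented by $b$ bits: there is a map from $\{0,1,\dots,2^b-1\}$ to $Y^X$, and algorithms output codes of hypotheses under this map. Algorithms are programs in a language in which numbers can be added, subtracted and (integer-)divided, trees of numbers can be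 built and inspected, fair coins can be flipped, and each instruction counts as one step; the length of a program is the number of its instructions, constants counted with their bit length. A *dataset* is a finite list of users, each of whom holds $m$ labelled examples; two datasets are neighboring if one arises from the other by removing one user. A randomized algorithm $M$ on datasets of any size is $(\varepsilon,\delta)$-*DP* if $\Pr[M(S)\in O]\le e^{\varepsilon}\Pr[M(S')\in O]+\delta$ for all neighboring $S,S'$ and all sets $O$ of outputs; $\varepsilon$-DP means $(\varepsilon,0)$-DP. It is an $(\alpha,\beta)$-*accurate learner for $C$ with $n$ users and $m$ samples per user* if for every realizable $D$, when all $nm$ samples are drawn independently from $D$, the output $h$ satisfies $\mathrm{err}_D(h)\le\alpha$ with probability at least $1-\beta$. In the *local model with public randomness*, a public random value $r$ is drawn independently of the data, every user applies one and the same randomizer to $r$ and her own samples and sends the resulting message, and an analyzer computes the output from $r$ and all messages; here $\varepsilon$-DP means that, for any number of users, replacing the data of one user changes the probability of any event concerning $r$ and the messages by a factor of at most $e^{\varepsilon}$. **Theorem.** There are absolute constants $K,k$ such that the following holds. Let $\alpha,\beta,\varepsilon\in(0,1)$ and $\tau>0$, let $C$ be a concept class on a finite set, and suppose that a program $\mathcal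 A$ of length $s$ $\alpha$-learns $C$ with $q$ statistical queries of tolerance $\tau$, in time $T$, with hypotheses represented by $b$ bits. Then there exist (i) for every $\delta\in(0,1)$, an $(\varepsilon,\delta)$-DP $(\alpha,\beta)$-accurate learner for $C$ with $n\le K\,\frac{\log(2/\delta)}{\varepsilon}$ users; (ii) an $\varepsilon$-DP $(\alpha,\beta)$-accurate learner for $C$ with $n\le K\,\frac{b+\log(1/\beta)}{\varepsilon}$ users; (iii) an $\varepsilon$-DP $(\alpha,\beta)$-accurate learner for $C$ in the (non-interactive) local model with public randomness, with $n\le K\,\frac{b+\log(1/\beta)}{\varepsilon^2}$ users; in each case every user has $m\le K\left(1+\frac{q}{\beta\tau}\right)^k$ samples. Moreover, on every dataset with $N$ users (in particular, $N=n$) each of these learners runs in time at most $K\left(1+T+\frac1\tau+\frac1\beta+n+N\right)^k$, that is, in time polynomial in $\mathrm{TIME}(\mathcal A)$, $1/\tau$, $1/\beta$ and the number of users, and its program has length at most $K\left(1+s+b+T+\frac1\tau+\frac1\beta+n\right)^k$. In (iii) the time bound holds for the program that draws $r$, for the randomizer of each user and for the analyzer. -/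

import Mathlib

/-! ## A small programming language with a step count

Programs act on finite binary trees whose leaves are natural numbers; trees are handled by reference,
as in Lisp.  One step is charged for every instruction that is executed.  The only arithmetic
instructions are addition, truncated subtraction and integer division, so in `t` steps the bit
length of the largest number grows by at most `t`; hence the step count is polynomially related to
the time of a Turing machine (in terms of steps, program length and input length). -/

namespace UserDP

open scoped ENNReal

/-- Data: binary trees with natural numbers at the leaves. -/
inductive Val : Type
  | num (n : ℕ) : Val
  | pair (a b : Val) : Val

namespace Val

/-- `num 0` is the truth value "false", everything else is "true". -/
def isTrue : Val → Bool
  | num 0 => false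
  | _ => true

def ofBool (b : Bool) : Val := num b.toNat

def fst : Val → Val
  | pair a _ => a
  | num _ => num 0

def snd : Val → Val
  | pair _ b => b
  | num _ => num 0

def isPair : Val → Val
  | pair _ _ => num 1
  | num _ => num 0

/-- Apply a binary operation to a pair of numbers (any other input gives `0`). -/
def arith (f : ℕ → ℕ → ℕ) : Val → Val
  | pair (num a) (num b) => num (f a b)
  | _ => num 0

/-- A list, with `num 0` as the empty list and `pair` as cons. -/
def ofList (l : List Val) : Val := l.foldr pair (num 0)

/-- A rational number in lowest terms `(a - b) / d`, as the tree `((a, b), d)`. -/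
def ofRat (o : ℚ) : Val :=
  pair (pair (num o.num.toNat) (num (-o.num).toNat)) (num o.den)

/-- The tree `((a, b), d)` with `d ≠ 0` (not necessarily in lowest terms) denotes `(a - b) / d`. -/
def Denotes (v : Val) (o : ℚ) : Prop :=
  ∃ a b d : ℕ, d ≠ 0 ∧ v = pair (pair (num a) (num b)) (num d) ∧ o = ((a : ℚ) - b) / d

end Val

/-- Programs; `E` is the type of the external instructions (coin flips, oracle calls). -/
inductive Prog (E : Type) : Type
  /-- return the input -/
  | skip : Prog E
  /-- return the number `n` -/
  | const (n : ℕ) : Prog E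
  | fst : Prog E
  | snd : Prog E
  | isPair : Prog E
  | add : Prog E
  | sub : Prog E
  | div : Prog E
  /-- run `f` on the input and `g` on the result -/
  | seq (f g : Prog E) : Prog E
  /-- run `f` and `g` on the input and return the pair of the results -/
  | pair (f g : Prog E) : Prog E
  /-- run `c` on the input; if the result is true run `f`, else `g`, on the input -/
  | cond (c f g : Prog E) : Prog E
  /-- as long as `c` returns true on the current value, replace this value by the result of `f` -/
  | loop (c f : Prog E) : Prog E
  /-- an external instruction, called on the input -/
  | op (e : E) : Prog E

/-- The length of a program; constants count with their bit length, `w` is the length of an external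
instruction. -/
def Prog.size {E : Type} (w : E → ℕ) : Prog E → ℕ
  | .const n => 1 + n.size
  | .seq f g => 1 + f.size w + g.size w
  | .pair f g => 1 + f.size w + g.size w
  | .cond c f g => 1 + c.size w + f.size w + g.size w
  | .loop c f => 1 + c.size w + f.size w
  | .op e => 1 + w e
  | _ => 1

/-- The computation tree of a program: a leaf carries the result, a node is the call of an external
instruction, with one subtree for every value it may return. -/
inductive Comp (E : Type) (α : Type) : Type
  | ret (a : α) : Comp E α
  | call (e : E) (v : Val) (k : Val → Comp E α) : Comp E α

def Comp.bind {E α β : Type} : Comp E α → (α → Comp E β) → Comp E β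
  | .ret a, f => f a
  | .call e v k, f => .call e v fun w => (k w).bind f

/-- Computations with a budget of steps.  The result is a value together with the number of steps
that are left, or `none` if the budget did not suffice. -/
abbrev Timed (E α : Type) : Type := ℕ → Comp E (Option (α × ℕ))

namespace Timed

variable {E α β : Type}

def ret (a : α) : Timed E α := fun t => .ret (some (a, t))

def bind (x : Timed E α) (f : α → Timed E β) : Timed E β := fun t =>
  (x t).bind fun
    | none => .ret none
    | some (a, t') => f a t'

/-- Spend one step, then continue with `x`. -/
def step (x : Timed E α) : Timed E α
  | 0 => .ret none
  | t + 1 => x t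

/-- At most `k` rounds of the loop with condition `c` and body `f`. -/
def rounds (c f : Val → Timed E Val) : ℕ → Val → Timed E Val
  | 0, _ => fun _ => .ret none
  | k + 1, v => bind (c v) fun a => if a.isTrue then bind (f v) (rounds c f k) else ret v

end Timed

/-- Run a program on an input, with a budget of steps.  (In `loop`, every complete round spends at
least two steps, so the bound `t + 1` on the number of rounds is no restriction.) -/
def Prog.run {E : Type} : Prog E → Val → Timed E Val
  | .skip, v => .step (.ret v)
  | .const n, _ => .step (.ret (.num n))
  | .fst, v => .step (.ret v.fst)
  | .snd, v => .step (.ret v.snd)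
  | .isPair, v => .step (.ret v.isPair)
  | .add, v => .step (.ret (v.arith fun a b => a + b))
  | .sub, v => .step (.ret (v.arith fun a b => a - b))
  | .div, v => .step (.ret (v.arith fun a b => a / b))
  | .seq f g, v => .step (.bind (f.run v) g.run)
  | .pair f g, v => .step (.bind (f.run v) fun a => .bind (g.run v) fun b => .ret (.pair a b))
  | .cond c f g, v => .step (.bind (c.run v) fun a => if a.isTrue then f.run v else g.run v)
  | .loop c f, v => .step fun t => Timed.rounds c.run f.run (t + 1) v t
  | .op e, v => .step fun t => .call e v fun w => .ret (some (w, t))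

/-- Deterministic programs have no external instructions; this is the result of their computation. -/
def Comp.result {α : Type} : Comp Empty α → α
  | .ret a => a
  | .call e _ _ => e.elim

/-- The deterministic program `p` halts on input `v` within `t` steps and returns `w`. -/
def Prog.Returns (p : Prog Empty) (v w : Val) (t : ℕ) : Prop :=
  (p.run v t).result.map Prod.fst = some w

/-! ### Randomized programs -/

/-- The external instruction of randomized programs: the flip of a fair coin. -/
inductive RandOp : Type
  | flip : RandOp

/-- The distribution of the result of a randomized computation. -/
noncomputable def Comp.dist {α : Type} : Comp RandOp α → PMF α
  | .ret a => PMF.pure a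
  | .call .flip _ k => (PMF.uniformOfFintype Bool).bind fun b => (k (.ofBool b)).dist

/-- On input `v` the randomized program `p` halts after at most `B` steps, whatever the coins show,
and its output has the distribution `μ`. -/
def Computes (p : Prog RandOp) (v : Val) (μ : PMF Val) (B : ℝ) : Prop :=
  ∃ t : ℕ, (t : ℝ) ≤ B ∧ (p.run v t).dist.map (Option.map Prod.fst) = μ.map some

/-- The length of a randomized program. -/
def randSize (p : Prog RandOp) : ℕ := p.size fun _ => 1

/-! ### Learning: distributions, error, encodings -/

section Learning

variable {X : Type*}

/-- The error of the hypothesis `f` under the distribution `D` of labelled examples. -/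
noncomputable def err (D : PMF (X × Bool)) (f : X → Bool) : ℝ≥0∞ :=
  D.toOuterMeasure {z | f z.1 ≠ z.2}

/-- `D` is realizable by a concept of `C`. -/
def Realizable (C : Set (X → Bool)) (D : PMF (X × Bool)) : Prop := ∃ c ∈ C, err D c = 0

/-- The output `v` is (the `b`-bit code of) a hypothesis of error at most `α`.  The map `hyp` is the
representation of hypotheses by `b`-bit numbers. -/
def Good {b : ℕ} (hyp : Fin (2 ^ b) → X → Bool) (D : PMF (X × Bool)) (α : ℝ) (v : Val) : Prop :=
  ∃ c : Fin (2 ^ b), v = .num c ∧ err D (hyp c) ≤ ENNReal.ofReal α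

/-- The encoding of a labelled example, given an encoding of the points. -/
def encExample (enc : X → Val) (z : X × Bool) : Val := .pair (enc z.1) (.ofBool z.2)

/-- The encoding of the data of one user, who holds `m` labelled examples. -/
def encUser {m : ℕ} (enc : X → Val) (u : Fin m → X × Bool) : Val :=
  .ofList (List.ofFn fun j => encExample enc (u j))

/-- The encoding of a dataset, a list of users. -/
def encData {m : ℕ} (enc : X → Val) (S : List (Fin m → X × Bool)) : Val :=
  .ofList (S.map (encUser enc))

/-! ### Statistical query algorithms -/

/-- The external instructions of a (randomized) statistical query algorithm: a coin flip, and a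
query to the oracle.  If `query body` is called on `v`, the function that is queried maps a labelled
example `z` to the number returned by the deterministic program `body` on `(v, z)`. -/
inductive SQOp : Type
  | flip : SQOp
  | query (body : Prog Empty) : SQOp

/-- The length of a statistical query program. -/
def sqSize (A : Prog SQOp) : ℕ :=
  A.size fun
    | .flip => 1
    | .query body => 1 + body.size fun e => e.elim

/-- The statistical query `body`, called on `v`, is the function `φ` from the support of `D` to
`[-1, 1]`, and each of its values is computed within `T` steps. -/
def IsQuery (enc : X → Val) (D : PMF (X × Bool)) (T : ℕ) (body : Prog Empty) (v : Val)
    (φ : X × Bool → ℚ) : Prop :=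
  ∀ z ∈ D.support, |φ z| ≤ 1 ∧
    ∃ w : Val, body.Returns (.pair v (encExample enc z)) w T ∧ w.Denotes (φ z)

/-- `SQSat … good q x`: whatever the coins show, and whatever answers within `τ` of the true
expectations the oracle gives, the computation `x` makes at most `q` queries, all of them proper
and computable within `T` steps, does not exceed its budget, and returns a value with `good`. -/
def SQSat [Fintype X] (enc : X → Val) (D : PMF (X × Bool)) (τ : ℝ) (T : ℕ) (good : Val → Prop) :
    ℕ → Comp SQOp (Option (Val × ℕ)) → Prop
  | _, .ret none => False
  | _, .ret (some (v, _)) => good v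
  | q, .call .flip _ k => ∀ c : Bool, SQSat enc D τ T good q (k (.ofBool c))
  | 0, .call (.query _) _ _ => False
  | q + 1, .call (.query body) v k =>
      ∃ φ : X × Bool → ℚ, IsQuery enc D T body v φ ∧
        ∀ o : ℚ, |(o : ℝ) - ∑ z, (D z).toReal * (φ z : ℝ)| ≤ τ →
          SQSat enc D τ T good q (k (.ofRat o))

/-- The program `A` `α`-learns `C` with `q` statistical queries of tolerance `τ`, in time `T`, with
hypotheses that are represented by `b` bits. -/
def SQLearns [Fintype X] (enc : X → Val) (C : Set (X → Bool)) {b : ℕ}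
    (hyp : Fin (2 ^ b) → X → Bool) (α τ : ℝ) (q T : ℕ) (A : Prog SQOp) : Prop :=
  ∀ D : PMF (X × Bool), Realizable C D →
    SQSat enc D τ T (Good hyp D α) q (A.run (.num 0) T)

/-! ### User-level differentially private learners -/

/-- One dataset arises from the other by the removal of one user. -/
def Neighboring {U : Type*} (S S' : List U) : Prop :=
  (∃ i < S.length, S' = S.eraseIdx i) ∨ ∃ i < S'.length, S = S'.eraseIdx i

/-- The two distributions are `(ε, δ)`-indistinguishable, in this order. -/
def Close {Ω : Type*} (ε δ : ℝ) (μ ν : PMF Ω) : Prop :=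
  ∀ O : Set Ω, μ.toOuterMeasure O ≤
    ENNReal.ofReal (Real.exp ε) * ν.toOuterMeasure O + ENNReal.ofReal δ

/-- `(ε, δ)`-differential privacy at the level of users (central model). -/
def IsDP {U Ω : Type*} (ε δ : ℝ) (M : List U → PMF Ω) : Prop :=
  ∀ S S' : List U, Neighboring S S' → Close ε δ (M S) (M S')

/-- `(α, β)`-accuracy with `n` users who hold `m` samples each: for every distribution `D` that is
realizable by `C`, with probability at least `1 - β` over `n * m` independent samples from `D` and
the coins of the learner, the output is a hypothesis of error at most `α`. -/
def IsAccurate [Fintype X] (C : Set (X → Bool)) {b : ℕ} (hyp : Fin (2 ^ b) → X → Bool)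
    (n m : ℕ) (α β : ℝ) (M : List (Fin m → X × Bool) → PMF Val) : Prop :=
  ∀ D : PMF (X × Bool), Realizable C D →
    ENNReal.ofReal (1 - β) ≤
      ∑ S : Fin n → Fin m → X × Bool,
        (∏ i, ∏ j, D (S i j)) * (M (List.ofFn S)).toOuterMeasure {v | Good hyp D α v}

/-- There is an `(ε, δ)`-DP `(α, β)`-accurate learner for `C` with `n` users who hold `m` samples
each, given by a program of length at most `L` that runs in at most `B N` steps on datasets with `N`
users. -/
def CentralLearner [Fintype X] (enc : X → Val) (C : Set (X → Bool)) {b : ℕ}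
    (hyp : Fin (2 ^ b) → X → Bool) (α β ε δ : ℝ) (n m : ℕ) (L : ℝ) (B : ℕ → ℝ) : Prop :=
  ∃ (p : Prog RandOp) (M : List (Fin m → X × Bool) → PMF Val),
    (randSize p : ℝ) ≤ L ∧
    (∀ S, Computes p (encData enc S) (M S) (B S.length)) ∧
    IsDP ε δ M ∧
    IsAccurate C hyp n m α β M

/-! ### The local model with public randomness -/

/-- The messages of all users, who apply the randomizer `R` independently to their data. -/
noncomputable def messages {U : Type*} (R : U → PMF Val) : List U → PMF (List Val)
  | [] => PMF.pure []
  | u :: S => (R u).bind fun w => (messages R S).map (w :: ·)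

/-- What is visible to the outside: the public randomness (distributed as `G`) and the messages. -/
noncomputable def transcript {U : Type*} (G : PMF Val) (R : Val → U → PMF Val) (S : List U) :
    PMF (Val × List Val) :=
  G.bind fun r => (messages (R r) S).map fun w => (r, w)

/-- Pure differential privacy in the local model: if the data of one user changes, then the
probability of each event about the transcript changes at most by the factor `exp ε`. -/
def IsLocalDP {U : Type*} (ε : ℝ) (G : PMF Val) (R : Val → U → PMF Val) : Prop :=
  ∀ (S : List U) (i : ℕ) (u : U), i < S.length →
    Close ε 0 (transcript G R S) (transcript G R (S.set i u))

/-- There is an `ε`-DP `(α, β)`-accurate learner for `C` in the (non-interactive) local model with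
public randomness, with `n` users who hold `m` samples each.  It is given by three programs of total
length at most `L`: `gen` draws the public randomness, `rnd` is the randomizer that every user
applies to the public randomness and her own samples, and `ana` is the analyzer, which receives the
public randomness and the messages.  With `N` users each of them runs in at most `B N` steps. -/
def LocalLearner [Fintype X] (enc : X → Val) (C : Set (X → Bool)) {b : ℕ}
    (hyp : Fin (2 ^ b) → X → Bool) (α β ε : ℝ) (n m : ℕ) (L : ℝ) (B : ℕ → ℝ) : Prop :=
  ∃ (gen rnd ana : Prog RandOp) (G : PMF Val) (R : Val → (Fin m → X × Bool) → PMF Val)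
    (M : Val × List Val → PMF Val),
    (randSize gen + randSize rnd + randSize ana : ℝ) ≤ L ∧
    Computes gen (.num 0) G (B 0) ∧
    (∀ r ∈ G.support, ∀ u, Computes rnd (.pair r (encUser enc u)) (R r u) (B 0)) ∧
    (∀ S, ∀ x ∈ (transcript G R S).support,
      Computes ana (.pair x.1 (.ofList x.2)) (M x) (B S.length)) ∧
    IsLocalDP ε G R ∧
    IsAccurate C hyp n m α β fun S => (transcript G R S).bind M

end Learning

end UserDP

open UserDP

/-!
The proof turns the statistical query algorithm into a *stable* learner for a single user, and then
spends the privacy budget on nothing but a vote of the users on the outcome of this learner.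

**Stability** (`exists_userLearner`).  All users share a tape of random numbers.  Every user simulates
the algorithm on her own samples: coin flips are read off the tape, and a query is answered by the
empirical average of its values, rounded to a grid of width about `τ` whose random offset is read off
the tape as well.  The average of `m` samples is within about `1 / √m` of the mean, so by Hermite's
identity (`sum_range_add_div`) a random offset separates the two only with probability of order
`1 / (τ √m)` (`ex_ex_cell_ne_le`).  Hence, with `m` of order `(q / (β τ))²`, a user arrives with
probability `1 - β / 20` at the same hypothesis as the simulation in which the true means are rounded
with the same offsets (`ex_execTape_ne_le`).  In that simulation all answers are admissible, so its
hypothesis is good.  By Markov's inequality (`ex_ex_le_of_numWrong`), nine tenths of the users agree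
on a good hypothesis except with probability `β / 2`, for any number of users.

**Central model** (`centralLearner_of_stable`).  The removal of a user changes the gap between the
majority hypothesis and all the others by at most one.  The majority hypothesis is released with a
probability that depends on the gap, and otherwise a default output is returned.  In (i), the default
is a fixed output, and the release probability grows from about `δ` to `1` by factors `1 + ε` within
`O(log (2 / δ) / ε)` steps.  In (ii), the default is a uniform `b`-bit code, which yields the majority
hypothesis with probability `2 ^ (-b)`; so the growth can start there, without any `δ`
(`AmpParams.close_mech`, `AmpParams.sub_amp_le`).

**Local model** (`localLearner_of_stable`).  Every user draws one of the `b` lengths of prefixes of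
her code and the seed of a one-bit hash function, and sends both together with the hash value of her
prefix of this length, disguised by randomized response.  The analyzer extends prefixes bit by bit,
and keeps the `L` prefixes with which most messages agree.  A competitor that differs from the truth
in the `s` longest prefixes beats it with probability `4 ^ (-s)` only (`LocalParams.ex_score_le`),
and there are about `2 ^ s` of these; so the expected number of competitors is bounded, the truth
survives with `L` of order `b / β`, and a few surplus messages about full codes settle the final
choice (`LocalParams.ex_decode_ne_le`).  The hash functions let `O((b + log (1 / β)) / ε²)` users
suffice, and the search runs in polynomial time.

**Programs.**  All learners are written in the language of the statement.  A `Comb` is a program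
together with the function that it computes and a bound on its running time; these bundles are closed
under composition, folds over lists and bounded iteration.  `Prog.compile` replaces the external
instructions of a program by verified programs and adds a clock, so that the simulation of the
statistical query algorithm halts on all data (`exists_comb_compile`), as privacy and the time bounds
demand.
-/

namespace UserDP

open scoped ENNReal

/-! ### Running programs: deterministic and random big-step rules -/

section Det

variable {E α β : Type}

/-- Started with at least `T` steps, the timed computation `x` performs no external instruction,
returns `a`, and spends at most `T` steps. -/
def Timed.Det (x : Timed E α) (a : α) (T : ℕ) : Prop :=
  ∀ t, ∃ t', t ≤ t' ∧ x (T + t) = .ret (some (a, t'))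

theorem Timed.Det.mono {x : Timed E α} {a : α} {T T' : ℕ} (h : x.Det a T) (hT : T ≤ T') :
    x.Det a T' := fun t => by
  obtain ⟨t', h1, h2⟩ := h (T' - T + t)
  exact ⟨t', by omega, by rw [← h2]; congr 1; omega⟩

theorem Timed.Det.ret (a : α) : (Timed.ret a : Timed E α).Det a 0 := fun t => ⟨t, le_rfl, by
  simp [Timed.ret]⟩

theorem Timed.Det.step {x : Timed E α} {a : α} {T : ℕ} (h : x.Det a T) : x.step.Det a (T + 1) :=
  fun t => by
    obtain ⟨t', h1, h2⟩ := h t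
    refine ⟨t', h1, ?_⟩
    rw [← h2, show T + 1 + t = (T + t) + 1 by omega]
    rfl

theorem Timed.Det.bind {x : Timed E α} {f : α → Timed E β} {a : α} {b : β} {T T' : ℕ}
    (h : x.Det a T) (h' : (f a).Det b T') : (x.bind f).Det b (T + T') := fun t => by
  obtain ⟨t1, h1, h2⟩ := h (T' + t)
  obtain ⟨t2, h3, h4⟩ := h' (t1 - T')
  refine ⟨t2, by omega, ?_⟩
  rw [← h4, Timed.bind, show T + T' + t = T + (T' + t) by omega, h2, Comp.bind,
    show T' + (t1 - T') = t1 by omega]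

/-- The program `p`, run on `v`, performs no external instruction and returns `w` after at most `T`
steps. -/
def Prog.Runs (p : Prog E) (v w : Val) (T : ℕ) : Prop := (p.run v).Det w T

namespace Prog.Runs

variable {p q f g c : Prog E} {v w u a b : Val} {T T' T'' : ℕ}

theorem mono (h : p.Runs v w T) (hT : T ≤ T') : p.Runs v w T' := Timed.Det.mono h hT

theorem skip : (Prog.skip : Prog E).Runs v v 1 := (Timed.Det.ret v).step
theorem const {n : ℕ} : (Prog.const n : Prog E).Runs v (.num n) 1 := (Timed.Det.ret _).step
theorem fst : (Prog.fst : Prog E).Runs v v.fst 1 := (Timed.Det.ret _).step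
theorem snd : (Prog.snd : Prog E).Runs v v.snd 1 := (Timed.Det.ret _).step
theorem isPair : (Prog.isPair : Prog E).Runs v v.isPair 1 := (Timed.Det.ret _).step
theorem add : (Prog.add : Prog E).Runs v (v.arith fun a b => a + b) 1 := (Timed.Det.ret _).step
theorem sub : (Prog.sub : Prog E).Runs v (v.arith fun a b => a - b) 1 := (Timed.Det.ret _).step
theorem div : (Prog.div : Prog E).Runs v (v.arith fun a b => a / b) 1 := (Timed.Det.ret _).step

theorem seq (hf : f.Runs v w T) (hg : g.Runs w u T') : (Prog.seq f g).Runs v u (T + T' + 1) :=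
  (Timed.Det.bind hf hg).step

theorem pair (hf : f.Runs v a T) (hg : g.Runs v b T') :
    (Prog.pair f g).Runs v (.pair a b) (T + T' + 1) := by
  exact (Timed.Det.bind hf
    (f := fun a => Timed.bind (g.run v) fun b => Timed.ret (Val.pair a b))
    (Timed.Det.bind hg (Timed.Det.ret _))).step

theorem cond_true (hc : c.Runs v a T) (ha : a.isTrue = true) (hf : f.Runs v w T') :
    (Prog.cond c f g).Runs v w (T + T' + 1) := by
  have h : Timed.Det ((fun a : Val => if a.isTrue then f.run v else g.run v) a) w T' := by
    simp only [ha, if_true]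
    exact hf
  exact (Timed.Det.bind hc h).step

theorem cond_false (hc : c.Runs v a T) (ha : a.isTrue = false) (hg : g.Runs v w T') :
    (Prog.cond c f g).Runs v w (T + T' + 1) := by
  have h : Timed.Det ((fun a : Val => if a.isTrue then f.run v else g.run v) a) w T' := by
    simp only [ha, Bool.false_eq_true, if_false]
    exact hg
  exact (Timed.Det.bind hc h).step

end Prog.Runs

/-- The loop with condition `c` and body `f`, started in `v`, ends in `w` after at most `T` steps
(provided that more than `T` rounds are allowed). -/
def Prog.LoopRuns (c f : Prog E) (v w : Val) (T : ℕ) : Prop :=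
  ∀ k, T < k → (Timed.rounds c.run f.run k v).Det w T

namespace Prog.LoopRuns

variable {c f : Prog E} {v w u a : Val} {T T' T'' : ℕ}

theorem exit (hc : c.Runs v a T) (ha : a.isTrue = false) : LoopRuns c f v v T := by
  intro k hk
  obtain ⟨k, rfl⟩ : ∃ j, k = j + 1 := ⟨k - 1, by omega⟩
  exact Timed.Det.bind hc (T' := 0) (by simpa [ha] using Timed.Det.ret v)

theorem round (hc : c.Runs v a T) (ha : a.isTrue = true) (hf : f.Runs v u T')
    (h : LoopRuns c f u w T'') : LoopRuns c f v w (T + T' + T'' + 1) := by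
  intro k hk
  obtain ⟨k, rfl⟩ : ∃ j, k = j + 1 := ⟨k - 1, by omega⟩
  have := Timed.Det.bind hc (T' := T' + T'')
    (f := fun a => if a.isTrue then .bind (f.run v) (Timed.rounds c.run f.run k) else .ret v)
    (by simpa [ha] using Timed.Det.bind hf (h k (by omega)))
  exact Timed.Det.mono this (by omega)

theorem mono (h : LoopRuns c f v w T) (hT : T ≤ T') : LoopRuns c f v w T' :=
  fun k hk => (h k (by omega)).mono hT

theorem loop (h : LoopRuns c f v w T) : (Prog.loop c f).Runs v w (T + 1) := by
  intro t
  obtain ⟨t', h1, h2⟩ := h (T + t + 1) (by omega) t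
  refine ⟨t', h1, ?_⟩
  rw [← h2, show T + 1 + t = (T + t) + 1 by omega]
  rfl

end Prog.LoopRuns

end Det

/-! ### Random programs -/

section Law

variable {α β : Type}

/-- The coins of the second computation are independent of those of the first one. -/
theorem Comp.dist_bind (x : Comp RandOp α) (f : α → Comp RandOp β) :
    (x.bind f).dist = x.dist.bind fun a => (f a).dist := by
  induction x with
  | ret a => simp [Comp.bind, Comp.dist]
  | call e v k ih =>
    cases e
    simp [Comp.bind, Comp.dist, ih, PMF.bind_bind]

/-- Started with at least `T` steps, the randomized timed computation `x` spends at most `T` of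
them, and its result has the distribution `μ`. -/
def Timed.Law (x : Timed RandOp α) (μ : PMF α) (T : ℕ) : Prop :=
  ∀ t, (x (T + t)).dist.map (Option.map Prod.fst) = μ.map some ∧
    ∀ a t', some (a, t') ∈ (x (T + t)).dist.support → t ≤ t'

theorem Timed.Law.mono {x : Timed RandOp α} {μ : PMF α} {T T' : ℕ} (h : x.Law μ T) (hT : T ≤ T') :
    x.Law μ T' := fun t => by
  have := h (T' - T + t)
  rw [show T + (T' - T + t) = T' + t by omega] at this
  exact ⟨this.1, fun a t' ha => by have := this.2 a t' ha; omega⟩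

theorem Timed.Det.law {x : Timed RandOp α} {a : α} {T : ℕ} (h : x.Det a T) :
    x.Law (PMF.pure a) T := fun t => by
  obtain ⟨t', h1, h2⟩ := h t
  rw [h2]
  refine ⟨by simp [Comp.dist, PMF.pure_map], ?_⟩
  intro b t'' hb
  simp [Comp.dist] at hb
  omega

theorem Timed.Law.step {x : Timed RandOp α} {μ : PMF α} {T : ℕ} (h : x.Law μ T) :
    x.step.Law μ (T + 1) := fun t => by
  rw [show T + 1 + t = (T + t) + 1 by omega]
  exact h t

theorem Timed.Law.bind {x : Timed RandOp α} {f : α → Timed RandOp β} {μ : PMF α}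
    {κ : α → PMF β} {T T' : ℕ} (h : x.Law μ T) (h' : ∀ a ∈ μ.support, (f a).Law (κ a) T') :
    (x.bind f).Law (μ.bind κ) (T + T') := fun t => by
  obtain ⟨h1, h2⟩ := h (T' + t)
  rw [show T + T' + t = T + (T' + t) by omega]
  set ν := (x (T + (T' + t))).dist with hν
  have hsupp : ∀ o ∈ ν.support, ∃ a t', o = some (a, T' + t') ∧ t ≤ t' ∧ a ∈ μ.support := by
    intro o ho
    have : (Option.map Prod.fst o) ∈ (μ.map some).support := by
      rw [← h1, PMF.support_map]; exact ⟨o, ho, rfl⟩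
    rw [PMF.support_map] at this
    obtain ⟨a, ha, hao⟩ := this
    obtain _ | ⟨b, s⟩ := o
    · simp at hao
    · have hs := h2 b s ho
      simp only [Option.map_some, Option.some.injEq] at hao
      subst hao
      exact ⟨a, s - T', by congr 2; omega, by omega, ha⟩
  have hd : (Timed.bind x f (T + (T' + t))).dist = ν.bind fun o =>
      (match o with
        | none => Comp.ret none
        | some (a, t') => f a t' : Comp RandOp (Option (β × ℕ))).dist := by
    exact Comp.dist_bind _ _
  rw [hd]
  constructor
  · rw [PMF.map_bind]
    have hl : ∀ o ∈ ν.support, PMF.map (Option.map Prod.fst)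
        (match o with
        | none => Comp.ret none
        | some (a, t') => f a t' : Comp RandOp (Option (β × ℕ))).dist =
        (match Option.map Prod.fst o with
        | none => PMF.pure none
        | some a => (κ a).map some) := by
      intro o ho
      obtain ⟨a, t', rfl, ht, ha⟩ := hsupp o ho
      exact (h' a ha t').1
    calc _ = ν.bind fun o => (match Option.map Prod.fst o with
        | none => PMF.pure none
        | some a => (κ a).map some) := by
          ext b
          rw [PMF.bind_apply, PMF.bind_apply]
          refine tsum_congr fun o => ?_
          by_cases ho : o ∈ ν.support
          · rw [hl o ho]
          · rw [PMF.mem_support_iff, not_not] at ho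
            simp [ho]
      _ = (ν.map (Option.map Prod.fst)).bind fun o => (match o with
        | none => PMF.pure none
        | some a => (κ a).map some) := by
          rw [PMF.bind_map]; rfl
      _ = _ := by
          rw [h1, PMF.bind_map, PMF.map_bind]; rfl
  · intro b t' hb
    rw [PMF.mem_support_bind_iff] at hb
    obtain ⟨o, ho, hb⟩ := hb
    obtain ⟨a, s, rfl, hs, ha⟩ := hsupp o ho
    have := (h' a ha s).2 b t' hb
    omega

theorem Timed.Law.computes {p : Prog RandOp} {v : Val} {μ : PMF Val} {T : ℕ} {B : ℝ}
    (h : (p.run v).Law μ T) (hT : (T : ℝ) ≤ B) : Computes p v μ B :=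
  ⟨T, hT, by simpa using (h 0).1⟩

namespace Prog

variable {p f g : Prog RandOp} {v : Val} {μ ν : PMF Val} {κ : Val → PMF Val} {T T' : ℕ}

theorem law_seq (hf : (f.run v).Law μ T) (hg : ∀ w ∈ μ.support, (g.run w).Law (κ w) T') :
    ((Prog.seq f g).run v).Law (μ.bind κ) (T + T' + 1) :=
  (hf.bind hg).step

theorem law_pair (hf : (f.run v).Law μ T) (hg : (g.run v).Law ν T') :
    ((Prog.pair f g).run v).Law (μ.bind fun a => ν.map fun b => .pair a b) (T + T' + 1) := by
  exact (hf.bind (f := fun a => Timed.bind (g.run v) fun b => Timed.ret (Val.pair a b))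
    (κ := fun a => ν.bind fun b => PMF.pure (Val.pair a b)) (T' := T' + 0)
    fun a _ => hg.bind (κ := fun b => PMF.pure (Val.pair a b))
      fun b _ => (Timed.Det.ret _).law).step

theorem Runs.law {w : Val} (h : p.Runs v w T) : (p.run v).Law (PMF.pure w) T := Timed.Det.law h

theorem law_flip : ((Prog.op RandOp.flip).run v).Law
    ((PMF.uniformOfFintype Bool).map Val.ofBool) 1 := by
  intro t
  have : (Prog.op RandOp.flip).run v (1 + t) =
      .call RandOp.flip v fun w => .ret (some (w, t)) := by
    rw [Nat.add_comm]; rfl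
  rw [this]
  constructor
  · simp only [Comp.dist, PMF.map_bind, PMF.pure_map, Option.map_some]
    rw [PMF.map_comp]
    rfl
  · intro a t' h
    simp [Comp.dist] at h
    omega

end Prog

end Law


/-! ### Verified deterministic programs -/

namespace Val

/-- The number at a leaf; a pair counts as `0`. -/
def toNum : Val → ℕ
  | num n => n
  | pair _ _ => 0

/-- Left fold over the spine of a tree, read as a list. -/
def foldl (f : Val → Val → Val) : Val → Val → Val
  | num _, s => s
  | pair x l, s => foldl f l (f x s)

@[simp] theorem fst_pair (a b : Val) : (pair a b).fst = a := rfl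
@[simp] theorem snd_pair (a b : Val) : (pair a b).snd = b := rfl
@[simp] theorem fst_num (n : ℕ) : (num n).fst = num 0 := rfl
@[simp] theorem snd_num (n : ℕ) : (num n).snd = num 0 := rfl
@[simp] theorem isPair_pair (a b : Val) : (pair a b).isPair = num 1 := rfl
@[simp] theorem isPair_num (n : ℕ) : (num n).isPair = num 0 := rfl
@[simp] theorem isTrue_pair (a b : Val) : (pair a b).isTrue = true := rfl
@[simp] theorem isTrue_num (n : ℕ) : (num n).isTrue = decide (n ≠ 0) := by
  cases n <;> simp [isTrue]
@[simp] theorem arith_pair_num (f : ℕ → ℕ → ℕ) (a b : ℕ) :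
    (pair (num a) (num b)).arith f = num (f a b) := rfl
@[simp] theorem toNum_num (n : ℕ) : (num n).toNum = n := rfl
@[simp] theorem toNum_pair (a b : Val) : (pair a b).toNum = 0 := rfl
@[simp] theorem ofList_nil : ofList [] = num 0 := rfl
@[simp] theorem ofList_cons (v : Val) (l : List Val) : ofList (v :: l) = pair v (ofList l) := rfl

theorem foldl_ofList (f : Val → Val → Val) (l : List Val) (s : Val) :
    foldl f (ofList l) s = l.foldl (fun s x => f x s) s := by
  induction l generalizing s with
  | nil => rfl
  | cons x l ih => simp [foldl, ih]

end Val

/-- A program without coin flips, together with the function that it computes and a bound on its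
running time. -/
structure Comb where
  prog : Prog RandOp
  fn : Val → Val
  cost : Val → ℕ
  ok : ∀ v, prog.Runs v (fn v) (cost v)

namespace Comb

/-- The length of the program. -/
def size (c : Comb) : ℕ := randSize c.prog

/-- The identity. -/
def id : Comb := ⟨.skip, fun v => v, fun _ => 1, fun _ => .skip⟩
/-- The constant `n`, whatever the input. -/
def const (n : ℕ) : Comb := ⟨.const n, fun _ => .num n, fun _ => 1, fun _ => .const⟩
/-- The first component. -/
def fst : Comb := ⟨.fst, Val.fst, fun _ => 1, fun _ => .fst⟩
/-- The second component. -/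
def snd : Comb := ⟨.snd, Val.snd, fun _ => 1, fun _ => .snd⟩
/-- The test whether the input is a pair. -/
def isPair : Comb := ⟨.isPair, Val.isPair, fun _ => 1, fun _ => .isPair⟩
/-- The sum of a pair of numbers. -/
def add : Comb := ⟨.add, Val.arith fun a b => a + b, fun _ => 1, fun _ => .add⟩
/-- The truncated difference of a pair of numbers. -/
def sub : Comb := ⟨.sub, Val.arith fun a b => a - b, fun _ => 1, fun _ => .sub⟩
/-- The integer quotient of a pair of numbers. -/
def div : Comb := ⟨.div, Val.arith fun a b => a / b, fun _ => 1, fun _ => .div⟩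

/-- First `f`, then `g`. -/
def seq (f g : Comb) : Comb :=
  ⟨.seq f.prog g.prog, fun v => g.fn (f.fn v), fun v => f.cost v + g.cost (f.fn v) + 1,
    fun v => (f.ok v).seq (g.ok _)⟩

/-- The pair of the results of `f` and `g`. -/
def pair (f g : Comb) : Comb :=
  ⟨.pair f.prog g.prog, fun v => .pair (f.fn v) (g.fn v), fun v => f.cost v + g.cost v + 1,
    fun v => (f.ok v).pair (g.ok v)⟩

/-- Case distinction; the running time is that of the branch that is taken. -/
def cond (c f g : Comb) : Comb :=
  ⟨.cond c.prog f.prog g.prog, fun v => if (c.fn v).isTrue then f.fn v else g.fn v,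
    fun v => c.cost v + (if (c.fn v).isTrue then f.cost v else g.cost v) + 1, fun v => by
      by_cases h : (c.fn v).isTrue = true
      · simp only [h, if_true]
        exact (c.ok v).cond_true h (f.ok v)
      · rw [if_neg h, if_neg h]
        exact (c.ok v).cond_false (by simpa using h) (g.ok v)⟩

section simps

variable (f g c : Comb) (v : Val) (n : ℕ)

@[simp] theorem id_fn : id.fn v = v := rfl
@[simp] theorem const_fn : (const n).fn v = .num n := rfl
@[simp] theorem fst_fn : fst.fn v = v.fst := rfl
@[simp] theorem snd_fn : snd.fn v = v.snd := rfl
@[simp] theorem isPair_fn : isPair.fn v = v.isPair := rfl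
@[simp] theorem add_fn : add.fn v = v.arith fun a b => a + b := rfl
@[simp] theorem sub_fn : sub.fn v = v.arith fun a b => a - b := rfl
@[simp] theorem div_fn : div.fn v = v.arith fun a b => a / b := rfl
@[simp] theorem seq_fn : (f.seq g).fn v = g.fn (f.fn v) := rfl
@[simp] theorem pair_fn : (f.pair g).fn v = .pair (f.fn v) (g.fn v) := rfl
@[simp] theorem cond_fn : (cond c f g).fn v = if (c.fn v).isTrue then f.fn v else g.fn v := rfl

@[simp] theorem id_cost : id.cost v = 1 := rfl
@[simp] theorem const_cost : (const n).cost v = 1 := rfl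
@[simp] theorem fst_cost : fst.cost v = 1 := rfl
@[simp] theorem snd_cost : snd.cost v = 1 := rfl
@[simp] theorem isPair_cost : isPair.cost v = 1 := rfl
@[simp] theorem add_cost : add.cost v = 1 := rfl
@[simp] theorem sub_cost : sub.cost v = 1 := rfl
@[simp] theorem div_cost : div.cost v = 1 := rfl
@[simp] theorem seq_cost : (f.seq g).cost v = f.cost v + g.cost (f.fn v) + 1 := rfl
@[simp] theorem pair_cost : (f.pair g).cost v = f.cost v + g.cost v + 1 := rfl
@[simp] theorem cond_cost : (cond c f g).cost v =
    c.cost v + (if (c.fn v).isTrue then f.cost v else g.cost v) + 1 := rfl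

@[simp] theorem id_size : id.size = 1 := rfl
@[simp] theorem const_size : (const n).size = 1 + n.size := rfl
@[simp] theorem fst_size : fst.size = 1 := rfl
@[simp] theorem snd_size : snd.size = 1 := rfl
@[simp] theorem isPair_size : isPair.size = 1 := rfl
@[simp] theorem add_size : add.size = 1 := rfl
@[simp] theorem sub_size : sub.size = 1 := rfl
@[simp] theorem div_size : div.size = 1 := rfl
@[simp] theorem seq_size : (f.seq g).size = 1 + f.size + g.size := rfl
@[simp] theorem pair_size : (f.pair g).size = 1 + f.size + g.size := rfl
@[simp] theorem cond_size : (cond c f g).size = 1 + c.size + f.size + g.size := rfl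

end simps

/-- The number at a leaf. -/
def toNum : Comb := cond isPair (const 0) id

@[simp] theorem toNum_fn (v : Val) : toNum.fn v = .num v.toNum := by
  cases v <;> simp [toNum]

@[simp] theorem toNum_cost_le (v : Val) : toNum.cost v = 3 := by
  cases v <;> simp [toNum]

@[simp] theorem toNum_size : toNum.size = 4 := by simp [toNum]

/-! #### Folds over lists -/

/-- The condition of the loop of `fold`: is there a first element? -/
def foldCond : Comb := snd.seq (fst.seq isPair)

/-- One round of the loop of `fold`. -/
def foldStep (body : Comb) : Comb :=
  fst.pair ((snd.seq (fst.seq snd)).pair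
    ((fst.pair ((snd.seq (fst.seq fst)).pair (snd.seq snd))).seq body))

/-- The running time of `fold`. -/
def foldCost (body : Comb) (e : Val) : Val → Val → ℕ
  | .num _, _ => 10
  | .pair x l, s =>
    body.cost (.pair e (.pair x s)) + 40 + foldCost body e l (body.fn (.pair e (.pair x s)))

theorem fold_loopRuns (body : Comb) (e l s : Val) :
    ∃ n, Prog.LoopRuns foldCond.prog (foldStep body).prog (.pair e (.pair l s))
      (.pair e (.pair (.num n)
        (l.foldl (fun x s => body.fn (.pair e (.pair x s))) s))) (foldCost body e l s) := by
  induction l generalizing s with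
  | num n =>
    refine ⟨n, (Prog.LoopRuns.exit (foldCond.ok _) ?_).mono ?_⟩
    · simp [foldCond]
    · simp [foldCond, foldCost]
  | pair x l _ ih =>
    obtain ⟨n, h⟩ := ih (body.fn (.pair e (.pair x s)))
    refine ⟨n, ?_⟩
    have h1 := Prog.LoopRuns.round (foldCond.ok (.pair e (.pair (.pair x l) s)))
      (by simp [foldCond]) ((foldStep body).ok (.pair e (.pair (.pair x l) s))) h
    exact h1.mono (by simp [foldCond, foldStep, foldCost]; omega)

/-- Left fold: on input `(e, (l, s))` the list `l` is folded with initial state `s`; the body is run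
on `(e, (x, s))`, where `x` is the current element and `s` the current state. -/
def fold (body : Comb) : Comb where
  prog := .seq (fst.pair ((snd.seq fst).pair (snd.seq snd))).prog
    (.seq (.loop foldCond.prog (foldStep body).prog) (snd.seq snd).prog)
  fn v := v.snd.fst.foldl (fun x s => body.fn (.pair v.fst (.pair x s))) v.snd.snd
  cost v := foldCost body v.fst v.snd.fst v.snd.snd + 20
  ok v := by
    obtain ⟨n, h⟩ := fold_loopRuns body v.fst v.snd.fst v.snd.snd
    refine (((fst.pair ((snd.seq fst).pair (snd.seq snd))).ok v).seq
      (h.loop.seq ((snd.seq snd).ok _))).mono ?_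
    simp
    omega

@[simp] theorem fold_size (body : Comb) : (fold body).size = 40 + body.size := by
  simp only [fold, size, randSize, Prog.size, foldCond, foldStep, fst, snd, isPair, pair, seq]
  omega

/-- The value of `fold` in terms of typed data: `enc` and `encs` encode the elements and the
states. -/
theorem fold_fn_ofList {α σ : Type*} (body : Comb) (e : Val) (l : List α) (enc : α → Val)
    (encs : σ → Val) (f : σ → α → σ)
    (h : ∀ x ∈ l, ∀ s, body.fn (.pair e (.pair (enc x) (encs s))) = encs (f s x)) (s : σ) :
    (fold body).fn (.pair e (.pair (.ofList (l.map enc)) (encs s))) = encs (l.foldl f s) := by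
  simp only [fold, Val.fst_pair, Val.snd_pair, Val.foldl_ofList]
  induction l generalizing s with
  | nil => rfl
  | cons x l ih =>
    simp only [List.map_cons, List.foldl_cons]
    rw [h x (by simp)]
    exact ih (fun y hy => h y (by simp [hy])) _

/-- The running time of `fold`, if one round takes at most `c` steps on states with `P`. -/
theorem fold_cost_le (body : Comb) (e : Val) (l : List Val) (s : Val) (P : Val → Prop) (c : ℕ)
    (hs : P s) (h : ∀ x ∈ l, ∀ s, P s → body.cost (.pair e (.pair x s)) ≤ c ∧
      P (body.fn (.pair e (.pair x s)))) :
    (fold body).cost (.pair e (.pair (.ofList l) s)) ≤ l.length * (c + 40) + 30 := by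
  simp only [fold, Val.fst_pair, Val.snd_pair]
  suffices foldCost body e (.ofList l) s ≤ l.length * (c + 40) + 10 by omega
  induction l generalizing s with
  | nil => simp [foldCost]
  | cons x l ih =>
    have h1 := h x (by simp) s hs
    have h2 := ih _ h1.2 (fun y hy => h y (by simp [hy]))
    simp only [Val.ofList_cons, foldCost, List.length_cons]
    have := h1.1
    rw [Nat.succ_mul]
    omega

/-- The running time of `fold`, if one round takes at most `c` steps. -/
theorem fold_cost_le' (body : Comb) (e : Val) (l : List Val) (s : Val) (c : ℕ)
    (h : ∀ x ∈ l, ∀ s, body.cost (.pair e (.pair x s)) ≤ c) :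
    (fold body).cost (.pair e (.pair (.ofList l) s)) ≤ l.length * (c + 40) + 30 :=
  fold_cost_le body e l s (fun _ => True) c trivial fun x hx s _ => ⟨h x hx s, trivial⟩

/-! #### Bounded iteration -/

/-- The condition of the loop of `iter`. -/
def iterCond : Comb := snd.seq fst

/-- One round of the loop of `iter`. -/
def iterStep (body : Comb) : Comb :=
  fst.pair ((((snd.seq fst).pair (const 1)).seq sub).pair ((fst.pair (snd.seq snd)).seq body))

/-- The running time of `iter`. -/
def iterCost (body : Comb) (e : Val) : ℕ → Val → ℕ
  | 0, _ => 10
  | n + 1, s => body.cost (.pair e s) + 40 + iterCost body e n (body.fn (.pair e s))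

theorem iter_loopRuns (body : Comb) (e : Val) (n : ℕ) (s : Val) :
    Prog.LoopRuns iterCond.prog (iterStep body).prog (.pair e (.pair (.num n) s))
      (.pair e (.pair (.num 0) ((fun s => body.fn (.pair e s))^[n] s)))
      (iterCost body e n s) := by
  induction n generalizing s with
  | zero =>
    refine (Prog.LoopRuns.exit (iterCond.ok _) ?_).mono ?_
    · simp [iterCond]
    · simp [iterCond, iterCost]
  | succ n ih =>
    have h1 := Prog.LoopRuns.round (iterCond.ok (.pair e (.pair (.num (n + 1)) s)))
      (by simp [iterCond]) ((iterStep body).ok (.pair e (.pair (.num (n + 1)) s)))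
      (ih (body.fn (.pair e s)))
    exact h1.mono (by simp [iterCond, iterStep, iterCost]; omega)

/-- Bounded iteration: on input `(e, (n, s))` the state `s` is replaced `n` times by the result of
the body on `(e, s)`. -/
def iter (body : Comb) : Comb where
  prog := .seq (fst.pair (((snd.seq fst).seq toNum).pair (snd.seq snd))).prog
    (.seq (.loop iterCond.prog (iterStep body).prog) (snd.seq snd).prog)
  fn v := (fun s => body.fn (.pair v.fst s))^[v.snd.fst.toNum] v.snd.snd
  cost v := iterCost body v.fst v.snd.fst.toNum v.snd.snd + 20
  ok v := by
    have h := iter_loopRuns body v.fst v.snd.fst.toNum v.snd.snd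
    have h0 := (fst.pair (((snd.seq fst).seq toNum).pair (snd.seq snd))).ok v
    simp only [pair_fn, fst_fn, seq_fn, snd_fn, toNum_fn] at h0
    refine (h0.seq (h.loop.seq ((snd.seq snd).ok _))).mono ?_
    simp
    omega

@[simp] theorem iter_size (body : Comb) : (iter body).size = 40 + body.size := by
  simp only [iter, size, randSize, Prog.size, iterCond, iterStep, fst, snd, isPair, pair, seq, sub,
    const, toNum, cond, id]
  simp
  omega

@[simp] theorem iter_fn (body : Comb) (e s : Val) (n : ℕ) :
    (iter body).fn (.pair e (.pair (.num n) s)) = (fun s => body.fn (.pair e s))^[n] s := rfl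

theorem iter_fn_typed {σ : Type*} (body : Comb) (e : Val) (n : ℕ) (encs : σ → Val) (f : σ → σ)
    (h : ∀ s, body.fn (.pair e (encs s)) = encs (f s)) (s : σ) :
    (iter body).fn (.pair e (.pair (.num n) (encs s))) = encs (f^[n] s) := by
  rw [iter_fn]
  induction n generalizing s with
  | zero => rfl
  | succ n ih => rw [Function.iterate_succ_apply, Function.iterate_succ_apply, h, ih]

theorem iter_cost_le (body : Comb) (e : Val) (n : ℕ) (s : Val) (P : Val → Prop) (c : ℕ)
    (hs : P s) (h : ∀ s, P s → body.cost (.pair e s) ≤ c ∧ P (body.fn (.pair e s))) :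
    (iter body).cost (.pair e (.pair (.num n) s)) ≤ n * (c + 40) + 30 := by
  simp only [iter, Val.fst_pair, Val.snd_pair, Val.toNum_num]
  suffices iterCost body e n s ≤ n * (c + 40) + 10 by omega
  induction n generalizing s with
  | zero => simp [iterCost]
  | succ n ih =>
    have h1 := h s hs
    have h2 := ih _ h1.2
    simp only [iterCost]
    have := h1.1
    rw [Nat.succ_mul]
    omega

theorem iter_cost_le' (body : Comb) (e : Val) (n : ℕ) (s : Val) (c : ℕ)
    (h : ∀ s, body.cost (.pair e s) ≤ c) :
    (iter body).cost (.pair e (.pair (.num n) s)) ≤ n * (c + 40) + 30 :=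
  iter_cost_le body e n s (fun _ => True) c trivial fun s _ => ⟨h s, trivial⟩

end Comb

/-! ### Clocked simulation of programs with external instructions -/

section Simulation

variable {E α β : Type}

/-- Run a computation, where the external instruction `e`, called on `v` in the state `s`, is
answered according to the function `H`: the value of `H e (v, s)` is the pair of the answer and of
the new state. -/
def Comp.exec (H : E → Val → Val) : Comp E α → Val → α × Val
  | .ret a, s => (a, s)
  | .call e v k, s => (k (H e (.pair v s)).fst).exec H (H e (.pair v s)).snd

theorem Comp.exec_bind (H : E → Val → Val) (x : Comp E α) (f : α → Comp E β) (s : Val) :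
    (x.bind f).exec H s = (f (x.exec H s).1).exec H (x.exec H s).2 := by
  induction x generalizing s with
  | ret a => rfl
  | call e v k ih => simp [Comp.bind, Comp.exec, ih]

/-- If a sequential composition succeeds, then so do its parts. -/
theorem Timed.exec_bind_eq_some {H : E → Val → Val} {x : Timed E α} {f : α → Timed E β} {t : ℕ}
    {s s2 : Val} {o : β × ℕ} (h : (x.bind f t).exec H s = (some o, s2)) :
    ∃ a t1 s1, (x t).exec H s = (some (a, t1), s1) ∧ (f a t1).exec H s1 = (some o, s2) := by
  rw [Timed.bind, Comp.exec_bind] at h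
  rcases hx : (x t).exec H s with ⟨r, s1⟩
  rw [hx] at h
  cases r with
  | none => simp [Comp.exec] at h
  | some r => exact ⟨r.1, r.2, s1, rfl, h⟩

/-- The state of a simulation: the current value `v`, the clock `t` and the state `s` of the
environment. -/
abbrev simState (v : Val) (t : ℕ) (s : Val) : Val := .pair v (.pair (.num t) s)

/-- One tick of the clock. -/
def tick : Comb :=
  Comb.fst.pair ((((Comb.snd.seq Comb.fst).pair (Comb.const 1)).seq Comb.sub).pair
    (Comb.snd.seq Comb.snd))

/-- Do nothing if the clock shows zero; otherwise let the clock tick and run `p`. -/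
def gate (p : Prog RandOp) : Prog RandOp :=
  .cond (Comb.snd.seq Comb.fst).prog (.seq tick.prog p) .skip

theorem gate_dead {p : Prog RandOp} {v s : Val} :
    (gate p).Runs (simState v 0 s) (simState v 0 s) 10 :=
  (Prog.Runs.cond_false ((Comb.snd.seq Comb.fst).ok _) (by simp) .skip).mono (by simp)

theorem gate_live {p : Prog RandOp} {v s w : Val} {t T : ℕ} (h : p.Runs (simState v t s) w T) :
    (gate p).Runs (simState v (t + 1) s) w (T + 30) := by
  refine (Prog.Runs.cond_true ((Comb.snd.seq Comb.fst).ok _) (by simp)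
    ((tick.ok _).seq (u := w) (T' := T) ?_)).mono ?_
  · simpa [tick] using h
  · simp [tick]
    omega

/-- `(v, (a, (t, s))) ↦ (v, (t, s))` -/
def keepVal : Comb := Comb.fst.pair (Comb.snd.seq Comb.snd)

/-- `(v, (a, s)) ↦ (a, (v, s))` -/
def swapVal : Comb := (Comb.snd.seq Comb.fst).pair keepVal

/-- `(a, (b, s)) ↦ ((a, b), s)` -/
def joinVal : Comb := (Comb.fst.pair (Comb.snd.seq Comb.fst)).pair (Comb.snd.seq Comb.snd)

/-- Continue the loop of a simulation: the test was positive, and the clock does not show zero. -/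
def goOn : Comb :=
  Comb.cond (Comb.snd.seq Comb.fst) (Comb.snd.seq (Comb.snd.seq Comb.fst)) (Comb.const 0)

/-- `(v, s) ↦ (v, (1, s))`: another round of the loop is due. -/
def raiseFlag : Comb := Comb.fst.pair ((Comb.const 1).pair Comb.snd)

/-- `(v, (a, s)) ↦ (v, (0, s))`: the loop is finished. -/
def lowerFlag : Comb := Comb.fst.pair ((Comb.const 0).pair (Comb.snd.seq Comb.snd))

/-- Translation of a program with external instructions: the external instruction `e` is replaced by
the program `h e`, and a clock is added, with one tick for every instruction that is executed.  When
the clock has run down, nothing happens any more. -/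
def Prog.compile (h : E → Comb) : Prog E → Prog RandOp
  | .skip => gate .skip
  | .const n => gate ((Comb.const n).pair Comb.snd).prog
  | .fst => gate ((Comb.fst.seq Comb.fst).pair Comb.snd).prog
  | .snd => gate ((Comb.fst.seq Comb.snd).pair Comb.snd).prog
  | .isPair => gate ((Comb.fst.seq Comb.isPair).pair Comb.snd).prog
  | .add => gate ((Comb.fst.seq Comb.add).pair Comb.snd).prog
  | .sub => gate ((Comb.fst.seq Comb.sub).pair Comb.snd).prog
  | .div => gate ((Comb.fst.seq Comb.div).pair Comb.snd).prog
  | .seq f g => gate (.seq (f.compile h) (g.compile h))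
  | .pair f g => gate (.seq (.pair .fst (f.compile h))
      (.seq (.pair (Comb.snd.seq Comb.fst).prog (.seq keepVal.prog (g.compile h))) joinVal.prog))
  | .cond c f g => gate (.seq (.pair .fst (c.compile h))
      (.cond (Comb.snd.seq Comb.fst).prog (.seq keepVal.prog (f.compile h))
        (.seq keepVal.prog (g.compile h))))
  | .loop c f => gate (.seq raiseFlag.prog
      (.seq (.loop (Comb.snd.seq Comb.fst).prog
        (.seq keepVal.prog (.seq (.pair .fst (c.compile h)) (.cond goOn.prog
          (.seq (.seq keepVal.prog (f.compile h)) raiseFlag.prog) lowerFlag.prog))))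
        keepVal.prog))
  | .op e => gate (.seq (.pair (Comb.snd.seq Comb.fst).prog (.seq keepVal.prog (h e).prog))
      swapVal.prog)

/-- Started in the state `(v, t, s)`, the program `p'` halts, its running time is proportional to the
number of clock ticks that it used (with a discount if it was started before the clock had run
down), and it agrees with the timed computation `x`, if this succeeds. -/
def SimAt (H : E → Val → Val) (I : Val → Prop) (C : ℕ) (p' : Prog RandOp) (x : Timed E Val)
    (v : Val) (t : ℕ) (s : Val) : Prop :=
  ∃ w t' s' k, I s' ∧ t' ≤ t ∧ k ≤ 10 * (t - t') + 1 ∧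
    (0 < t → t' < t ∧ k + 3 ≤ 10 * (t - t')) ∧
    p'.Runs (simState v t s) (simState w t' s') (C * k) ∧
    ∀ a t1 s1, (x t).exec H s = (some (a, t1), s1) → w = a ∧ t' = t1 ∧ s' = s1

variable {H : E → Val → Val} {I : Val → Prop} {C : ℕ}

theorem simAt_gate (hC : 100 ≤ C) {p : Prog RandOp} {x : Timed E Val} {v s : Val} {t : ℕ}
    (hI : I s)
    (h : ∀ t, ∃ w t' s' k, I s' ∧ t' ≤ t ∧ k ≤ 10 * (t - t') + 6 ∧
      p.Runs (simState v t s) (simState w t' s') (C * k) ∧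
      ∀ a t1 s1, (x t).exec H s = (some (a, t1), s1) → w = a ∧ t' = t1 ∧ s' = s1) :
    SimAt H I C (gate p) x.step v t s := by
  cases t with
  | zero =>
    refine ⟨v, 0, s, 1, hI, le_rfl, by omega, by simp, gate_dead.mono (by omega), ?_⟩
    intro a t1 s1 h1
    simp [Timed.step, Comp.exec] at h1
  | succ t =>
    obtain ⟨w, t', s', k, h1, h2, h3, h4, h5⟩ := h t
    exact ⟨w, t', s', k + 1, h1, by omega, by omega, fun _ => ⟨by omega, by omega⟩,
      (gate_live h4).mono (by rw [Nat.mul_succ]; omega), h5⟩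

theorem simAt_gate_pure (hC : 100 ≤ C) {f : Comb} {v s : Val} {t : ℕ} (hI : I s)
    (hf : ∀ t, f.cost (simState v t s) ≤ 10) (w : Val)
    (hw : ∀ t, f.fn (simState v t s) = simState w t s) :
    SimAt H I C (gate f.prog) (Timed.step (.ret w) : Timed E Val) v t s := by
  refine simAt_gate hC hI fun t => ⟨w, t, s, 1, hI, le_rfl, by omega, ?_, ?_⟩
  · have := f.ok (simState v t s)
    rw [hw] at this
    exact this.mono (by have := hf t; omega)
  · intro a t1 s1 h
    simp [Timed.ret, Comp.exec] at h
    tauto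

/-- The translation is correct.  The invariant `I` of the environment bounds the running time of the
programs that replace the external instructions, even in simulations that do not succeed: the
translated program always halts in time `O(C * t)`. -/
theorem compile_sim (h : E → Comb) (I : Val → Prop) (C : ℕ) (hC : 100 ≤ C)
    (hI : ∀ e v s, I s → I ((h e).fn (.pair v s)).snd)
    (hh : ∀ e v s, I s → (h e).cost (.pair v s) ≤ C) (p : Prog E) :
    ∀ v t s, I s → SimAt (fun e => (h e).fn) I C (p.compile h) (p.run v) v t s := by
  induction p with
  | skip =>
    intro v t s hs
    exact simAt_gate_pure (f := Comb.id) hC hs (by simp) v (by simp)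
  | const n =>
    intro v t s hs
    exact simAt_gate_pure hC hs (by simp) _ (by simp)
  | fst | snd | isPair | add | sub | div =>
    intro v t s hs
    exact simAt_gate_pure hC hs (by simp) _ (by simp)
  | op e =>
    intro v t s hs
    refine simAt_gate hC hs fun t =>
      ⟨((h e).fn (.pair v s)).fst, t, ((h e).fn (.pair v s)).snd, 2, hI e v s hs, le_rfl, by omega,
        ?_, ?_⟩
    · have h1 := (((Comb.snd.seq Comb.fst).pair (keepVal.seq (h e))).seq swapVal).ok
        (simState v t s)
      have h2 := hh e v s hs
      simp [keepVal, swapVal] at h1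
      exact h1.mono (by omega)
    · intro a t1 s1 h1
      simp [Comp.exec] at h1
      tauto
  | seq f g ihf ihg =>
    intro v t s hs
    refine simAt_gate hC hs fun t => ?_
    obtain ⟨w1, t1, s1, k1, hs1, ht1, hk1, -, hr1, he1⟩ := ihf v t s hs
    obtain ⟨w2, t2, s2, k2, hs2, ht2, hk2, -, hr2, he2⟩ := ihg w1 t1 s1 hs1
    refine ⟨w2, t2, s2, k1 + k2 + 1, hs2, by omega, by omega,
      (hr1.seq hr2).mono (by rw [mul_add, mul_add]; omega), ?_⟩
    intro a t3 s3 h3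
    obtain ⟨b, t4, s4, h4, h5⟩ := Timed.exec_bind_eq_some h3
    obtain ⟨rfl, rfl, rfl⟩ := he1 _ _ _ h4
    exact he2 _ _ _ h5
  | pair f g ihf ihg =>
    intro v t s hs
    refine simAt_gate hC hs fun t => ?_
    obtain ⟨w1, t1, s1, k1, hs1, ht1, hk1, -, hr1, he1⟩ := ihf v t s hs
    obtain ⟨w2, t2, s2, k2, hs2, ht2, hk2, -, hr2, he2⟩ := ihg v t1 s1 hs1
    refine ⟨.pair w1 w2, t2, s2, k1 + k2 + 1, hs2, by omega, by omega, ?_, ?_⟩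
    · have h1 : Prog.Runs (Prog.pair Prog.fst (f.compile h)) (simState v t s) _ _ :=
        Prog.Runs.fst.pair hr1
      have h2 := keepVal.ok (.pair v (simState w1 t1 s1))
      have h3 := ((Comb.snd.seq Comb.fst).ok (.pair v (simState w1 t1 s1))).pair
        (h2.seq (u := simState w2 t2 s2) (T' := C * k2) (by simpa [keepVal] using hr2))
      refine (h1.seq (h3.seq (u := simState (.pair w1 w2) t2 s2) (joinVal.ok _))).mono ?_
      simp [keepVal, joinVal]
      rw [mul_add, mul_add]
      omega
    · intro a t3 s3 h3
      obtain ⟨b, t4, s4, h4, h5⟩ := Timed.exec_bind_eq_some h3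
      obtain ⟨rfl, rfl, rfl⟩ := he1 _ _ _ h4
      obtain ⟨b, t4, s4, h4, h5⟩ := Timed.exec_bind_eq_some h5
      obtain ⟨rfl, rfl, rfl⟩ := he2 _ _ _ h4
      simp [Timed.ret, Comp.exec] at h5
      tauto
  | cond c f g ihc ihf ihg =>
    intro v t s hs
    refine simAt_gate hC hs fun t => ?_
    obtain ⟨w1, t1, s1, k1, hs1, ht1, hk1, -, hr1, he1⟩ := ihc v t s hs
    have h1 : Prog.Runs (Prog.pair Prog.fst (c.compile h)) (simState v t s) _ _ :=
      Prog.Runs.fst.pair hr1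
    have h2 := keepVal.ok (.pair v (simState w1 t1 s1))
    have h3 := (Comb.snd.seq Comb.fst).ok (.pair v (simState w1 t1 s1))
    cases hw : w1.isTrue with
    | true =>
      obtain ⟨w2, t2, s2, k2, hs2, ht2, hk2, -, hr2, he2⟩ := ihf v t1 s1 hs1
      refine ⟨w2, t2, s2, k1 + k2 + 1, hs2, by omega, by omega, ?_, ?_⟩
      · refine (h1.seq (h3.cond_true (by simpa using hw)
          (h2.seq (u := simState w2 t2 s2) (T' := C * k2) (by simpa [keepVal] using hr2)))).mono ?_
        simp [keepVal]
        rw [mul_add, mul_add]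
        omega
      · intro a t3 s3 h3
        obtain ⟨b, t4, s4, h4, h5⟩ := Timed.exec_bind_eq_some h3
        obtain ⟨rfl, rfl, rfl⟩ := he1 _ _ _ h4
        rw [if_pos hw] at h5
        exact he2 _ _ _ h5
    | false =>
      obtain ⟨w2, t2, s2, k2, hs2, ht2, hk2, -, hr2, he2⟩ := ihg v t1 s1 hs1
      refine ⟨w2, t2, s2, k1 + k2 + 1, hs2, by omega, by omega, ?_, ?_⟩
      · refine (h1.seq (h3.cond_false (by simpa using hw)
          (h2.seq (u := simState w2 t2 s2) (T' := C * k2) (by simpa [keepVal] using hr2)))).mono ?_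
        simp [keepVal]
        rw [mul_add, mul_add]
        omega
      · intro a t3 s3 h3
        obtain ⟨b, t4, s4, h4, h5⟩ := Timed.exec_bind_eq_some h3
        obtain ⟨rfl, rfl, rfl⟩ := he1 _ _ _ h4
        rw [if_neg (by simp [hw])] at h5
        exact he2 _ _ _ h5
  | loop c f ihc ihf =>
    intro v t s hs
    refine simAt_gate hC hs fun t => ?_
    -- the rounds of the loop, by induction on the clock
    have key : ∀ n t v s, t < n → I s → ∃ w t' s' k, I s' ∧ t' ≤ t ∧
        k ≤ 10 * (t - t') + 2 ∧
        Prog.LoopRuns (Comb.snd.seq Comb.fst).prog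
          (.seq keepVal.prog (.seq (.pair .fst (c.compile h)) (.cond goOn.prog
            (.seq (.seq keepVal.prog (f.compile h)) raiseFlag.prog) lowerFlag.prog)))
          (.pair v (.pair (.num 1) (.pair (.num t) s)))
          (.pair w (.pair (.num 0) (.pair (.num t') s'))) (C * k) ∧
        ∀ m x t2 s2, t < m →
          (Timed.rounds c.run f.run m v t).exec (fun e => (h e).fn) s = (some (x, t2), s2) →
            w = x ∧ t' = t2 ∧ s' = s2 := by
      intro n
      induction n with
      | zero => intro t v s h0; omega
      | succ n ih =>
        intro t v s htn hs
        obtain ⟨a, t1, s1, k1, hs1, ht1, hk1, hk1', hr1, he1⟩ := ihc v t s hs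
        have h1 : (Prog.pair Prog.fst (c.compile h)).Runs (simState v t s) _ _ :=
          Prog.Runs.fst.pair hr1
        have h0 := keepVal.ok (.pair v (.pair (.num 1) (.pair (.num t) s)))
        by_cases hgo : a.isTrue = true ∧ 0 < t1
        · obtain ⟨w2, t2, s2, k2, hs2, ht2, hk2, hk2', hr2, he2⟩ := ihf v t1 s1 hs1
          obtain ⟨w, t', s', k, hs', ht', hk, hl, he⟩ := ih t2 w2 s2 (by omega) hs2
          have hg : (goOn.fn (.pair v (simState a t1 s1))).isTrue = true := by
            simp [goOn, hgo.1]
            omega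
          refine ⟨w, t', s', k1 + k2 + k + 1, hs', by omega, by omega, ?_, ?_⟩
          · have h2 := ((keepVal.ok (.pair v (simState a t1 s1))).seq (T' := C * k2)
              (u := simState w2 t2 s2) (by simpa [keepVal] using hr2)).seq (raiseFlag.ok _)
            have h3 := h0.seq (Prog.Runs.seq (by simpa [keepVal] using h1)
              (Prog.Runs.cond_true (g := lowerFlag.prog)
                (goOn.ok (.pair v (simState a t1 s1))) hg h2))
            refine (Prog.LoopRuns.round ((Comb.snd.seq Comb.fst).ok _) (by simp) h3 hl).mono ?_
            simp [keepVal, goOn, hgo.1, raiseFlag]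
            rw [mul_add, mul_add, mul_add]
            omega
          · intro m x t4 s4 hm h4
            obtain ⟨m, rfl⟩ : ∃ j, m = j + 1 := ⟨m - 1, by omega⟩
            obtain ⟨b, t5, s5, h5, h6⟩ := Timed.exec_bind_eq_some h4
            obtain ⟨rfl, rfl, rfl⟩ := he1 _ _ _ h5
            rw [if_pos hgo.1] at h6
            obtain ⟨b, t6, s6, h7, h8⟩ := Timed.exec_bind_eq_some h6
            obtain ⟨rfl, rfl, rfl⟩ := he2 _ _ _ h7
            exact he m x t4 s4 (by omega) h8
        · refine ⟨v, t1, s1, k1 + 1, hs1, ht1, by omega, ?_, ?_⟩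
          · have hg : (goOn.fn (.pair v (simState a t1 s1))).isTrue = false := by
              cases ha : a.isTrue with
              | true => simp [goOn, ha]; simp [ha] at hgo; exact hgo
              | false => simp [goOn, ha]
            have hg' : goOn.cost (.pair v (simState a t1 s1)) ≤ 20 := by
              simp only [goOn, Comb.cond_cost]
              split_ifs <;> simp
            have h3 := h0.seq (Prog.Runs.seq (by simpa [keepVal] using h1)
              (Prog.Runs.cond_false (f := .seq (.seq keepVal.prog (f.compile h)) raiseFlag.prog)
                (goOn.ok (.pair v (simState a t1 s1))) hg
                (lowerFlag.ok _)))
            refine (Prog.LoopRuns.round ((Comb.snd.seq Comb.fst).ok _) (by simp) h3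
              (Prog.LoopRuns.exit ((Comb.snd.seq Comb.fst).ok _) (by simp [lowerFlag]))).mono ?_
            simp only [keepVal, lowerFlag, Comb.pair_cost, Comb.seq_cost, Comb.fst_cost,
              Comb.snd_cost, Comb.const_cost] at *
            rw [mul_add]
            omega
          · intro m x t4 s4 hm h4
            obtain ⟨m, rfl⟩ : ∃ j, m = j + 1 := ⟨m - 1, by omega⟩
            obtain ⟨b, t5, s5, h5, h6⟩ := Timed.exec_bind_eq_some h4
            obtain ⟨rfl, rfl, rfl⟩ := he1 _ _ _ h5
            cases ha : a.isTrue with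
            | true =>
              -- the clock has run down, so the body cannot be executed
              obtain rfl : t1 = 0 := by simp [ha] at hgo; exact hgo
              rw [if_pos ha] at h6
              obtain ⟨b, t6, s6, h7, h8⟩ := Timed.exec_bind_eq_some h6
              have : f.run v 0 = .ret none := by cases f <;> rfl
              rw [this] at h7
              simp [Comp.exec] at h7
            | false =>
              rw [if_neg (by simp [ha])] at h6
              simp [Timed.ret, Comp.exec] at h6
              tauto
    obtain ⟨w, t', s', k, hs', ht', hk, hl, he⟩ := key (t + 1) t v s (by omega) hs
    refine ⟨w, t', s', k + 1, hs', ht', by omega, ?_, ?_⟩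
    · refine ((raiseFlag.ok _).seq
        (hl.loop.seq (u := simState w t' s') (keepVal.ok _))).mono ?_
      simp [keepVal, raiseFlag]
      rw [mul_add]
      omega
    · intro x t2 s2 h2
      exact he (t + 1) x t2 s2 (by omega) h2

theorem size_gate (p : Prog RandOp) : randSize (gate p) = 20 + randSize p := by
  have : tick.size = 14 := by simp [tick]
  simp only [Comb.size, randSize] at this
  simp only [gate, randSize, Prog.size, this, Comb.seq, Comb.snd, Comb.fst]
  omega

theorem size_compile_le (h : E → Comb) (p : Prog E) :
    randSize (p.compile h) ≤ 100 * p.size fun e => (h e).size := by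
  have h0 : ∀ c : Comb, randSize c.prog = c.size := fun _ => rfl
  have h1 : randSize keepVal.prog = 5 := by rfl
  have h2 : randSize swapVal.prog = 9 := by rfl
  have h3 : randSize joinVal.prog = 9 := by rfl
  have h4 : randSize (Comb.snd.seq Comb.fst).prog = 3 := by rfl
  have h5 : randSize goOn.prog = 10 := by simp [h0, goOn]
  have h6 : randSize raiseFlag.prog = 6 := by simp [h0, raiseFlag]
  have h7 : randSize lowerFlag.prog = 7 := by rfl
  induction p with
  | skip => rw [Prog.compile, size_gate]; simp [randSize, Prog.size]
  | const n =>
    rw [Prog.compile, size_gate]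
    simp [h0, Prog.size]
    omega
  | fst | snd | isPair | add | sub | div =>
    rw [Prog.compile, size_gate]
    simp [h0, Prog.size]
  | op e =>
    rw [Prog.compile, size_gate]
    simp only [randSize, Prog.size, Comb.size] at *
    omega
  | seq f g ihf ihg | pair f g ihf ihg | cond c f g ihc ihf ihg | loop c f ihc ihf =>
    rw [Prog.compile, size_gate]
    simp only [randSize, Prog.size] at *
    omega

/-- Programs with a clock as verified programs: the result of the simulation. -/
theorem exists_comb_compile (h : E → Comb) (p : Prog E) (T : ℕ) (B : Val → ℕ)
    (I : Val → Val → Prop) (hI0 : ∀ s, I s s)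
    (hI : ∀ s0 e v s, I s0 s → I s0 ((h e).fn (.pair v s)).snd)
    (hh : ∀ s0 e v s, I s0 s → (h e).cost (.pair v s) ≤ B s0) :
    ∃ c : Comb, c.size ≤ 100 * (p.size fun e => (h e).size) + 30 + T.size ∧
      (∀ v s, c.cost (.pair v s) = (B s + 100) * (10 * T + 1) + 30) ∧
      ∀ v s a t1 s1, (p.run v T).exec (fun e => (h e).fn) s = (some (a, t1), s1) →
        c.fn (.pair v s) = a := by
  have key : ∀ x : Val, ∃ w, Prog.Runs
      (.seq (Comb.fst.pair ((Comb.const T).pair Comb.snd)).prog (.seq (p.compile h) .fst)) x w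
      ((B x.snd + 100) * (10 * T + 1) + 30) ∧
      ∀ a t1 s1, (p.run x.fst T).exec (fun e => (h e).fn) x.snd = (some (a, t1), s1) → w = a := by
    intro x
    obtain ⟨w, t', s', k, -, -, hk, -, hr, he⟩ := compile_sim h (I x.snd) (B x.snd + 100) (by omega)
      (hI x.snd) (fun e v s hs => (hh _ _ _ _ hs).trans (by omega)) p x.fst T x.snd (hI0 _)
    refine ⟨w, ((Comb.ok _ x).seq (hr.seq .fst)).mono ?_, fun a t1 s1 h1 => (he a t1 s1 h1).1⟩
    have : (B x.snd + 100) * k ≤ (B x.snd + 100) * (10 * T + 1) :=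
      Nat.mul_le_mul_left _ (by omega)
    simp
    omega
  choose fn hr hf using key
  refine ⟨⟨_, fn, fun x => (B x.snd + 100) * (10 * T + 1) + 30, hr⟩, ?_, ?_, ?_⟩
  · have h1 := size_compile_le h p
    simp only [Comb.size, randSize, Prog.size, Comb.pair, Comb.fst, Comb.const, Comb.snd] at *
    omega
  · intro v s
    rfl
  · intro v s a t1 s1 h1
    exact hf (.pair v s) a t1 s1 h1

end Simulation


/-! ### The program of one user: statistical queries answered by rounded averages -/

namespace Val

/-- The number of elements of a tree that is read as a list. -/
def len : Val → ℕ
  | num _ => 0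
  | pair _ l => l.len + 1

@[simp] theorem len_ofList (l : List Val) : (ofList l).len = l.length := by
  induction l with
  | nil => rfl
  | cons x l ih => simp [len, ih]

end Val

namespace Comb

theorem fold_cost_le_len (body : Comb) (e l s : Val) (c : ℕ)
    (h : ∀ x s, body.cost (.pair e (.pair x s)) ≤ c) :
    (fold body).cost (.pair e (.pair l s)) ≤ l.len * (c + 40) + 30 := by
  simp only [fold, Val.fst_pair, Val.snd_pair]
  suffices foldCost body e l s ≤ l.len * (c + 40) + 10 by omega
  induction l generalizing s with
  | num n => simp [foldCost]
  | pair x l _ ih =>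
    have h1 := h x s
    have h2 := ih (body.fn (.pair e (.pair x s)))
    simp only [foldCost, Val.len]
    rw [Nat.succ_mul]
    omega

theorem cond_fn_true {c f g : Comb} {v : Val} (h : (c.fn v).isTrue = true) :
    (cond c f g).fn v = f.fn v := by
  rw [cond_fn, if_pos h]

theorem cond_fn_false {c f g : Comb} {v : Val} (h : (c.fn v).isTrue = false) :
    (cond c f g).fn v = g.fn v := by
  rw [cond_fn, if_neg (by simp [h])]

/-- Multiplication by the constant `W`, by repeated addition. -/
def mulConst (W : ℕ) : Comb := (toNum.pair ((const W).pair (const 0))).seq (iter add)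

@[simp] theorem mulConst_fn (W : ℕ) (v : Val) : (mulConst W).fn v = .num (W * v.toNum) := by
  simp only [mulConst, seq_fn, pair_fn, toNum_fn, const_fn]
  rw [iter_fn_typed add (.num v.toNum) W Val.num (fun s => v.toNum + s) (by simp)]
  congr 1
  have : ∀ n s, (fun s => v.toNum + s)^[n] s = n * v.toNum + s := by
    intro n
    induction n with
    | zero => simp
    | succ n ih => intro s; rw [Function.iterate_succ_apply, ih]; ring
  simp [this]

theorem mulConst_cost_le (W : ℕ) (v : Val) : (mulConst W).cost v ≤ 41 * W + 40 := by
  have h := iter_cost_le' add (.num v.toNum) W (.num 0) 1 (by simp)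
  simp [mulConst]
  omega

theorem mulConst_size_le (W : ℕ) : (mulConst W).size ≤ 60 + W.size := by
  simp [mulConst]
  omega

/-- The minimum with the constant `k`. -/
def minConst (k : ℕ) : Comb := (id.pair ((id.pair (const k)).seq sub)).seq sub

@[simp] theorem minConst_fn (k n : ℕ) : (minConst k).fn (.num n) = .num (min n k) := by
  simp [minConst]
  omega

@[simp] theorem minConst_cost (k : ℕ) (v : Val) : (minConst k).cost v = 9 := by simp [minConst]

theorem minConst_size_le (k : ℕ) : (minConst k).size ≤ 20 + k.size := by
  simp [minConst]
  omega

end Comb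

/-- Parameters of the simulation of a statistical query algorithm: the time bound `T`, the number
`m` of samples, the number `Q` of offsets that are used in randomized rounding, the resolution `W`
of the values of the queries, the shift `P0`, and the denominator `p` of the answers. -/
structure SimParams where
  T : ℕ
  m : ℕ
  Q : ℕ
  W : ℕ
  P0 : ℕ
  p : ℕ

section Handler

open Comb

theorem Comp.exec_empty {α : Type} (H : Empty → Val → Val) (x : Comp Empty α) (s : Val) :
    x.exec H s = (x.result, s) := by
  cases x with
  | ret a => rfl
  | call e => exact e.elim

/-- A deterministic program is translated like any other one; this adds a time limit, which keeps the
private learners fast on samples that are not in the support of the distribution. -/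
theorem exists_evalBody (T : ℕ) (body : Prog Empty) : ∃ c : Comb,
    c.size ≤ 100 * (body.size fun e => e.elim) + 40 + T.size ∧
    (∀ v, c.cost v = 1000 * T + 134) ∧ ∀ v w, body.Returns v w T → c.fn v = w := by
  obtain ⟨c, h1, h2, h3⟩ := exists_comb_compile (fun e : Empty => e.elim) body T (fun _ => 0)
    (fun _ _ => True) (fun _ => trivial) (fun _ e => e.elim) (fun _ e => e.elim)
  refine ⟨(Comb.id.pair (Comb.const 0)).seq c, ?_, ?_, ?_⟩
  · have : ∀ w w' : Empty → ℕ, body.size w = body.size w' := fun w w' => by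
      rw [show w = w' from funext fun e => e.elim]
    rw [this _ (fun e => e.elim)] at h1
    simp only [seq_size, pair_size, id_size, const_size, Nat.size_zero]
    linarith
  · intro v
    simp [h2]
    omega
  · intro v w h
    simp only [seq_fn, pair_fn, id_fn, const_fn]
    simp only [Prog.Returns, Option.map_eq_some_iff] at h
    obtain ⟨⟨a, t⟩, h4, rfl⟩ := h
    refine h3 _ _ a t (.num 0) ?_
    rw [Comp.exec_empty, h4]

/-- The value of the query `body`, computed with a time limit of `T` steps. -/
noncomputable def evalBody (T : ℕ) (body : Prog Empty) : Comb := (exists_evalBody T body).choose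

theorem evalBody_size (T : ℕ) (body : Prog Empty) :
    (evalBody T body).size ≤ 100 * (body.size fun e => e.elim) + 40 + T.size :=
  (exists_evalBody T body).choose_spec.1

@[simp] theorem evalBody_cost (T : ℕ) (body : Prog Empty) (v : Val) :
    (evalBody T body).cost v = 1000 * T + 134 :=
  (exists_evalBody T body).choose_spec.2.1 v

theorem evalBody_fn {T : ℕ} {body : Prog Empty} {v w : Val} (h : body.Returns v w T) :
    (evalBody T body).fn v = w :=
  (exists_evalBody T body).choose_spec.2.2 v w h

/-- The integer `W + W (a - b) / d`, rounded towards `W`, as a function of the rational number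
`((a, b), d)`. -/
def discretize (W : ℕ) : Comb :=
  ((((const W).pair ((((fst.seq sub).seq (mulConst W)).pair snd).seq div)).seq add).pair
    ((((fst.seq ((snd.pair fst).seq sub)).seq (mulConst W)).pair snd).seq div)).seq sub

theorem discretize_fn (W a b d : ℕ) :
    (discretize W).fn (.pair (.pair (.num a) (.num b)) (.num d)) =
      .num (W + W * (a - b) / d - W * (b - a) / d) := by
  simp [discretize]

theorem discretize_cost_le (W : ℕ) (v : Val) : (discretize W).cost v ≤ 82 * W + 110 := by
  simp only [discretize, seq_cost, pair_cost, const_cost, fst_cost, snd_cost, sub_cost, add_cost,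
    div_cost, seq_fn, pair_fn, fst_fn, snd_fn]
  have h1 := mulConst_cost_le W (sub.fn v.fst)
  have h2 := mulConst_cost_le W (sub.fn (.pair v.fst.snd v.fst.fst))
  omega

theorem discretize_size_le (W : ℕ) : (discretize W).size ≤ 160 + 3 * W.size := by
  have := mulConst_size_le W
  simp [discretize]
  omega

/-- The discretized value of the query `body`, called on `v`, at the labelled example `x`. -/
noncomputable def psi (P : SimParams) (body : Prog Empty) (v x : Val) : ℕ :=
  ((discretize P.W).fn ((evalBody P.T body).fn (.pair v x))).toNum

/-- One step of the summation: `(v, (x, s)) ↦ s + psi v x`. -/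
noncomputable def sumStep (P : SimParams) (body : Prog Empty) : Comb :=
  ((snd.seq snd).pair
    (((fst.pair (snd.seq fst)).seq (evalBody P.T body)).seq ((discretize P.W).seq toNum))).seq add

/-- The answer, a rational number of denominator `p` in lowest terms, as a function of the number of
the cell. -/
def answer (P : SimParams) : Comb :=
  ((((id.pair (const P.P0)).seq sub).seq (minConst (P.p - 1))).pair
    ((((const P.P0).pair id).seq sub).seq (minConst (P.p - 1)))).seq
  (cond add (id.pair (const P.p)) (((const 0).pair (const 0)).pair (const 1)))

/-- The rational number that is encoded by `answer`. -/
def answerRat (P : SimParams) (c : ℕ) : ℚ :=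
  (((min (c - P.P0) (P.p - 1) : ℕ) : ℤ) - ((min (P.P0 - c) (P.p - 1) : ℕ) : ℤ) : ℤ) / (P.p : ℤ)

theorem answer_fn (P : SimParams) (hp : P.p.Prime) (c : ℕ) :
    (answer P).fn (.num c) = .ofRat (answerRat P c) := by
  have h2 := hp.two_le
  -- a number of absolute value less than a prime is coprime to it
  have key : ∀ n : ℕ, n ≠ 0 → n ≤ P.p - 1 → Nat.Coprime n P.p := fun n h0 h1 =>
    (Nat.coprime_of_lt_prime h0 (by omega) hp).symm
  have h3 : ∀ z : ℤ, z.natAbs ≠ 0 → z.natAbs ≤ P.p - 1 →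
      ((z : ℚ) / (P.p : ℤ)).num = z ∧ ((z : ℚ) / (P.p : ℤ)).den = P.p := fun z h0 h1 =>
    ⟨Rat.num_div_eq_of_coprime (by omega) (by simpa using key _ h0 h1),
      by have := Rat.den_div_eq_of_coprime (a := z) (b := P.p) (by omega)
          (by simpa using key _ h0 h1)
         exact_mod_cast this⟩
  simp only [answer, seq_fn, pair_fn, id_fn, const_fn, sub_fn, Val.arith_pair_num, minConst_fn,
    answerRat]
  by_cases h0 : c = P.P0
  · subst h0
    rw [cond_fn_false (by simp)]
    simp [Val.ofRat]
  · obtain ⟨h4, h5⟩ := h3 (((min (c - P.P0) (P.p - 1) : ℕ) : ℤ) -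
      ((min (P.P0 - c) (P.p - 1) : ℕ) : ℤ)) (by omega) (by omega)
    rw [Val.ofRat, h4, h5, cond_fn_true (by simp; omega)]
    simp only [pair_fn, id_fn, const_fn]
    congr 3 <;> omega

@[simp] theorem answer_cost_le (P : SimParams) (v : Val) : (answer P).cost v ≤ 60 := by
  simp only [answer, seq_cost, pair_cost, cond_cost, id_cost, const_cost, sub_cost, add_cost,
    minConst_cost]
  split_ifs <;> omega

theorem answer_size_le (P : SimParams) :
    (answer P).size ≤ 100 + 2 * P.P0.size + 3 * P.p.size := by
  have h1 := minConst_size_le (P.p - 1)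
  have h2 : (P.p - 1).size ≤ P.p.size := Nat.size_le_size (Nat.sub_le _ _)
  simp [answer]
  omega

/-- The answer to a query: `(v, (tape, samples)) ↦ (answer, (rest of the tape, samples))`.  The
average of the discretized values is rounded down to a multiple of `Q`, after a random offset,
which is the first number on the tape, has been added. -/
noncomputable def queryHandler (P : SimParams) (body : Prog Empty) : Comb :=
  (((((((fst.pair ((snd.seq snd).pair (const 0))).seq (fold (sumStep P body))).pair
    (const P.m)).seq div).pair ((snd.seq (fst.seq fst)).seq toNum)).seq add).pair
      (const P.Q)).seq (div.seq (answer P)) |>.pair ((snd.seq (fst.seq snd)).pair (snd.seq snd))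

/-- A coin flip: `(v, (tape, samples)) ↦ (coin, (rest of the tape, samples))`. -/
def flipHandler (P : SimParams) : Comb :=
  ((((snd.seq (fst.seq fst)).seq toNum).pair (const (P.Q / 2))).seq div).pair
    ((snd.seq (fst.seq snd)).pair (snd.seq snd))

/-- The programs that replace the external instructions of a statistical query algorithm. -/
noncomputable def handler (P : SimParams) : SQOp → Comb
  | .flip => flipHandler P
  | .query body => queryHandler P body

/-- The number of the cell to which an average `A` is rounded, if the offset is `r`. -/
def cell (P : SimParams) (A r : ℕ) : ℕ := (A + r) / P.Q

/-- The answer to an external instruction, if the average of a query is given by the function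
`avg`, and `r` is the current number on the tape. -/
noncomputable def respond (P : SimParams) (avg : Prog Empty → Val → ℕ) (r : ℕ) : SQOp → Val → Val
  | .flip, _ => .num (r / (P.Q / 2))
  | .query body, v => .ofRat (answerRat P (cell P (avg body v) r))

/-- The average of the discretized values of a query over a list of samples. -/
noncomputable def empAvg (P : SimParams) (xs : List Val) (body : Prog Empty) (v : Val) : ℕ :=
  (xs.map (psi P body v)).sum / P.m

/-- Run a computation; the `i`-th external instruction is answered according to `H` and the `i`-th
number on the tape (`0` if there is none). -/
def Comp.execTape {E α : Type} (H : ℕ → E → Val → Val) : Comp E α → List ℕ → α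
  | .ret a, _ => a
  | .call e v k, r => (k (H (r.headD 0) e v)).execTape H r.tail

/-- The encoding of a tape. -/
def encTape (r : List ℕ) : Val := .ofList (r.map .num)

@[simp] theorem encTape_fst (r : List ℕ) : (encTape r).fst = .num (r.headD 0) := by
  cases r <;> rfl

@[simp] theorem encTape_snd (r : List ℕ) : (encTape r).snd = encTape r.tail := by
  cases r <;> rfl

theorem sumStep_fold (P : SimParams) (body : Prog Empty) (v : Val) (xs : List Val) :
    (fold (sumStep P body)).fn (.pair v (.pair (.ofList xs) (.num 0))) =
      .num (xs.map (psi P body v)).sum := by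
  have h := fold_fn_ofList (sumStep P body) v xs (fun x => x) Val.num
    (fun s x => s + psi P body v x) (fun x _ s => by simp [sumStep, psi]) 0
  simp only [List.map_id'] at h
  rw [h]
  congr 1
  have : ∀ s, xs.foldl (fun s x => s + psi P body v x) s = s + (xs.map (psi P body v)).sum := by
    clear h
    induction xs with
    | nil => simp
    | cons x xs ih => intro s; simp [ih]; ring
  simp [this]

theorem handler_fn (P : SimParams) (hp : P.p.Prime) (e : SQOp) (v : Val) (r : List ℕ)
    (xs : List Val) :
    (handler P e).fn (.pair v (.pair (encTape r) (.ofList xs))) =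
      .pair (respond P (empAvg P xs) (r.headD 0) e v) (.pair (encTape r.tail) (.ofList xs)) := by
  cases e with
  | flip => simp [handler, flipHandler, respond]
  | query body =>
    simp only [handler, queryHandler, respond, pair_fn, seq_fn, fst_fn, snd_fn, const_fn,
      Val.fst_pair, Val.snd_pair, sumStep_fold, encTape_fst, toNum_fn, Val.toNum_num, div_fn,
      add_fn, Val.arith_pair_num, answer_fn P hp, encTape_snd]
    rfl

/-- The simulation on a state that holds the tape and the samples reads the tape cell by cell. -/
theorem exec_handler (P : SimParams) (hp : P.p.Prime) {α : Type} (x : Comp SQOp α) (r : List ℕ)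
    (xs : List Val) :
    (x.exec (fun e => (handler P e).fn) (.pair (encTape r) (.ofList xs))).1 =
      x.execTape (respond P (empAvg P xs)) r := by
  induction x generalizing r with
  | ret a => rfl
  | call e v k ih =>
    simp only [Comp.exec, Comp.execTape, handler_fn P hp, Val.fst_pair, Val.snd_pair, ih]

theorem handler_cost_le (P : SimParams) (e : SQOp) (v s : Val) :
    (handler P e).cost (.pair v s) ≤ s.snd.len * (1000 * P.T + 82 * P.W + 340) + 200 := by
  cases e with
  | flip => simp [handler, flipHandler]
  | query body =>
    have h1 := fold_cost_le_len (sumStep P body) v s.snd (.num 0)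
      (1000 * P.T + 82 * P.W + 300) (fun x s => by
        have := discretize_cost_le P.W ((evalBody P.T body).fn (v.pair x))
        simp [sumStep]
        omega)
    have h2 := answer_cost_le P
    simp only [handler, queryHandler, pair_cost, seq_cost, fst_cost, snd_cost, const_cost,
      div_cost, add_cost, toNum_cost_le, pair_fn, fst_fn, snd_fn, seq_fn, const_fn, Val.fst_pair,
      Val.snd_pair]
    have h3 := h2 (div.fn (((add.fn ((div.fn (((fold (sumStep P body)).fn
      (v.pair (s.snd.pair (.num 0)))).pair (.num P.m))).pair
        (.num s.fst.fst.toNum))).pair (.num P.Q))))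
    simp only [toNum_fn]
    have : 1000 * P.T + 82 * P.W + 300 + 40 = 1000 * P.T + 82 * P.W + 340 := by ring
    rw [this] at h1
    omega

theorem handler_snd (P : SimParams) (e : SQOp) (v s : Val) :
    ((handler P e).fn (.pair v s)).snd.snd = s.snd := by
  cases e <;> simp [handler, flipHandler, queryHandler]

/-- The total length of the constants that occur in the program of a user. -/
def SimParams.sizes (P : SimParams) : ℕ :=
  P.T.size + P.m.size + P.Q.size + P.W.size + P.P0.size + P.p.size

theorem _root_.UserDP.Prog.size_le_mul {E : Type} (p : Prog E) {w w' : E → ℕ} {K : ℕ} (hK : 1 ≤ K)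
    (h : ∀ e, 1 + w e ≤ K * (1 + w' e)) : p.size w ≤ K * p.size w' := by
  induction p with
  | skip | fst | snd | isPair | add | sub | div => simpa [Prog.size] using hK
  | const n => exact Nat.le_mul_of_pos_left _ hK
  | op e => exact h e
  | seq f g ihf ihg | pair f g ihf ihg | cond c f g ihc ihf ihg | loop c f ihc ihf =>
    simp only [Prog.size, mul_add]
    omega

theorem handler_size_le (P : SimParams) (e : SQOp) :
    1 + (handler P e).size ≤ (1000 + 10 * P.sizes) * (1 + match e with
      | .flip => 1
      | .query body => 1 + body.size fun e => e.elim) := by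
  cases e with
  | flip =>
    have : (P.Q / 2).size ≤ P.Q.size := Nat.size_le_size (Nat.div_le_self _ _)
    simp [handler, flipHandler, SimParams.sizes]
    omega
  | query body =>
    have h1 := evalBody_size P.T body
    have h2 := discretize_size_le P.W
    have h3 := answer_size_le P
    have h4 : 10 * P.sizes ≤ (10 * P.sizes) * (1 + (1 + body.size fun e => e.elim)) :=
      Nat.le_mul_of_pos_right _ (by omega)
    rw [add_mul]
    simp [handler, queryHandler, sumStep]
    simp only [SimParams.sizes] at *
    omega

/-- The program of one user, who simulates the statistical query algorithm `A` on a tape and her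
own samples: there is a program with the following running time and length, which computes the
output of `A` if all statistical queries are answered by rounded averages. -/
theorem exists_userComb (P : SimParams) (hp : P.p.Prime) (A : Prog SQOp) (b : ℕ) : ∃ c : Comb,
    c.size ≤ (300000 + 3000 * P.sizes) * (sqSize A + b + 1) ∧
    (∀ r xs, c.cost (.pair (encTape r) (.ofList xs)) ≤
      (xs.length * (1000 * P.T + 82 * P.W + 340) + 300) * (10 * P.T + 1) + 100) ∧
    ∀ r xs, ∃ n < 2 ^ b, c.fn (.pair (encTape r) (.ofList xs)) = .num n ∧
      ∀ w t, (A.run (.num 0) P.T).execTape (respond P (empAvg P xs)) r = some (w, t) →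
        n = min w.toNum (2 ^ b - 1) := by
  obtain ⟨c, h1, h2, h3⟩ := exists_comb_compile (handler P) A P.T
    (fun s => s.snd.len * (1000 * P.T + 82 * P.W + 340) + 200)
    (fun s0 s => s.snd = s0.snd) (fun _ => rfl) (fun s0 e v s h => by rw [handler_snd, h])
    (fun s0 e v s h => by
      have := handler_cost_le P e v s
      simp only [h] at this
      exact this)
  refine ⟨(((const 0).pair id).seq c).seq (toNum.seq (minConst (2 ^ b - 1))), ?_, ?_, ?_⟩
  · have hA : (A.size fun e => (handler P e).size) ≤ (1000 + 10 * P.sizes) * sqSize A := by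
      refine A.size_le_mul (by omega) fun e => (handler_size_le P e).trans (le_of_eq ?_)
      cases e <;> rfl
    have h4 := minConst_size_le (2 ^ b - 1)
    have h5 : (2 ^ b - 1).size ≤ b + 1 :=
      (Nat.size_le_size (Nat.sub_le _ _)).trans (Nat.size_pow).le
    have h6 : P.T.size ≤ P.sizes := by simp [SimParams.sizes]; omega
    simp
    nlinarith
  · intro r xs
    simp [h2]
    nlinarith
  · intro r xs
    refine ⟨_, ?_, by simp; rfl, ?_⟩
    · have := Nat.two_pow_pos b
      omega
    · intro w t h
      rcases h4 : (A.run (.num 0) P.T).exec (fun e => (handler P e).fn)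
        (.pair (encTape r) (.ofList xs)) with ⟨o, s⟩
      have h5 := exec_handler P hp (A.run (.num 0) P.T) r xs
      rw [h4, h] at h5
      simp only at h5
      subst h5
      rw [h3 _ _ _ _ _ h4]

end Handler


/-! ### Expectations and product distributions -/

section Expectation

variable {α β γ : Type*}

open Classical in
/-- The indicator of a proposition. -/
noncomputable def ind (p : Prop) : ℝ≥0∞ := if p then 1 else 0

theorem ind_of_true {p : Prop} (h : p) : ind p = 1 := if_pos h

theorem ind_of_false {p : Prop} (h : ¬p) : ind p = 0 := if_neg h

theorem ind_le_one (p : Prop) : ind p ≤ 1 := by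
  by_cases h : p
  · rw [ind_of_true h]
  · rw [ind_of_false h]; exact zero_le_one

theorem ind_mono {p q : Prop} (h : p → q) : ind p ≤ ind q := by
  by_cases hp : p
  · rw [ind_of_true hp, ind_of_true (h hp)]
  · rw [ind_of_false hp]; exact zero_le

/-- The expectation of a nonnegative function.  With values in `ℝ≥0∞`, no integrability has to be
checked. -/
noncomputable def ex (μ : PMF α) (f : α → ℝ≥0∞) : ℝ≥0∞ := ∑' a, μ a * f a

theorem ex_mono {μ : PMF α} {f g : α → ℝ≥0∞} (h : ∀ a ∈ μ.support, f a ≤ g a) :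
    ex μ f ≤ ex μ g := by
  refine ENNReal.tsum_le_tsum fun a => ?_
  by_cases ha : a ∈ μ.support
  · exact mul_le_mul_right (h a ha) _
  · simp [(PMF.apply_eq_zero_iff μ a).2 ha]

theorem ex_congr {μ : PMF α} {f g : α → ℝ≥0∞} (h : ∀ a ∈ μ.support, f a = g a) :
    ex μ f = ex μ g :=
  le_antisymm (ex_mono fun a ha => (h a ha).le) (ex_mono fun a ha => (h a ha).ge)

@[simp] theorem ex_const (μ : PMF α) (c : ℝ≥0∞) : ex μ (fun _ => c) = c := by
  rw [ex, ENNReal.tsum_mul_right, μ.tsum_coe, one_mul]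

theorem ex_add (μ : PMF α) (f g : α → ℝ≥0∞) : ex μ (fun a => f a + g a) = ex μ f + ex μ g := by
  simp only [ex, mul_add, ENNReal.tsum_add]

theorem ex_mul_left (μ : PMF α) (c : ℝ≥0∞) (f : α → ℝ≥0∞) :
    ex μ (fun a => c * f a) = c * ex μ f := by
  simp only [ex, ← ENNReal.tsum_mul_left]
  exact tsum_congr fun a => by ring

theorem ex_finset_sum {ι : Type*} (s : Finset ι) (μ : PMF α) (f : ι → α → ℝ≥0∞) :
    ex μ (fun a => ∑ i ∈ s, f i a) = ∑ i ∈ s, ex μ (f i) := by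
  classical
  induction s using Finset.induction_on with
  | empty => simp [ex]
  | insert i s hi ih => simp only [Finset.sum_insert hi, ex_add, ih]

theorem ex_comm (μ : PMF α) (ν : PMF β) (f : α → β → ℝ≥0∞) :
    ex μ (fun a => ex ν (f a)) = ex ν fun b => ex μ fun a => f a b := by
  simp only [ex, ← ENNReal.tsum_mul_left]
  rw [ENNReal.tsum_comm]
  exact tsum_congr fun b => tsum_congr fun a => by ring

@[simp] theorem ex_pure (a : α) (f : α → ℝ≥0∞) : ex (PMF.pure a) f = f a := by
  rw [ex, tsum_eq_single a]
  · simp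
  · intro b hb
    simp [hb]

@[simp] theorem ex_bind (μ : PMF α) (κ : α → PMF β) (f : β → ℝ≥0∞) :
    ex (μ.bind κ) f = ex μ fun a => ex (κ a) f := by
  simp only [ex, PMF.bind_apply, ← ENNReal.tsum_mul_left, ← ENNReal.tsum_mul_right]
  rw [ENNReal.tsum_comm]
  exact tsum_congr fun b => tsum_congr fun a => by ring

@[simp] theorem ex_map (μ : PMF α) (g : α → β) (f : β → ℝ≥0∞) :
    ex (μ.map g) f = ex μ fun a => f (g a) := by
  simp [PMF.map]

theorem toOuterMeasure_eq_ex (μ : PMF α) (O : Set α) :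
    μ.toOuterMeasure O = ex μ fun a => ind (a ∈ O) := by
  rw [PMF.toOuterMeasure_apply, ex]
  refine tsum_congr fun a => ?_
  by_cases ha : a ∈ O <;> simp [ha, ind]

/-- The uniform distribution on `{0, …, 2 ^ w - 1}`. -/
noncomputable def unif (w : ℕ) : PMF ℕ := (PMF.uniformOfFintype (Fin (2 ^ w))).map Fin.val

theorem ex_unif (w : ℕ) (f : ℕ → ℝ≥0∞) :
    ex (unif w) f = (2 ^ w)⁻¹ * ∑ i ∈ Finset.range (2 ^ w), f i := by
  rw [unif, ex_map, ex, tsum_fintype, Finset.mul_sum, Finset.sum_range]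
  simp

theorem mem_support_unif {w i : ℕ} : i ∈ (unif w).support ↔ i < 2 ^ w := by
  rw [unif, PMF.support_map]
  constructor
  · rintro ⟨j, -, rfl⟩
    exact j.2
  · intro h
    exact ⟨⟨i, h⟩, by simp, rfl⟩

/-- The distribution of a tape: `n` independent numbers, each uniform on `{0, …, 2 ^ w - 1}`. -/
noncomputable def tapes (w : ℕ) : ℕ → PMF (List ℕ)
  | 0 => PMF.pure []
  | n + 1 => (unif w).bind fun r => (tapes w n).map (r :: ·)

theorem ex_tapes_succ (w n : ℕ) (f : List ℕ → ℝ≥0∞) :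
    ex (tapes w (n + 1)) f = ex (unif w) fun r => ex (tapes w n) fun l => f (r :: l) := by
  simp [tapes]

theorem mem_support_tapes {w n : ℕ} {l : List ℕ} (h : l ∈ (tapes w n).support) :
    l.length = n ∧ ∀ r ∈ l, r < 2 ^ w := by
  induction n generalizing l with
  | zero => simp [tapes] at h; simp [h]
  | succ n ih =>
    rw [tapes, PMF.mem_support_bind_iff] at h
    obtain ⟨r, hr, h⟩ := h
    rw [PMF.support_map] at h
    obtain ⟨l', h, rfl⟩ := h
    obtain ⟨h1, h2⟩ := ih h
    rw [mem_support_unif] at hr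
    simp [h1, hr]
    exact h2

variable {Z : Type*} [Fintype Z]

theorem sum_prod_eq {R : Type*} [CommSemiring R] (n : ℕ) (F : Fin n → Z → R) :
    ∑ u : Fin n → Z, ∏ i, F i (u i) = ∏ i, ∑ z, F i z := by
  classical
  rw [Finset.prod_univ_sum, Fintype.piFinset_univ]

/-- The distribution of `n` independent samples. -/
noncomputable def iid (n : ℕ) (p : PMF Z) : PMF (Fin n → Z) :=
  ⟨fun u => ∏ j, p (u j), by
    have h : ∑ z, p z = 1 := by rw [← tsum_fintype (L := .unconditional _)]; exact p.tsum_coe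
    have : ∑ u : Fin n → Z, ∏ j, p (u j) = 1 := by
      rw [sum_prod_eq n fun _ => p]
      simp [h]
    rw [← this]
    exact hasSum_fintype _⟩

@[simp] theorem iid_apply (n : ℕ) (p : PMF Z) (u : Fin n → Z) : iid n p u = ∏ j, p (u j) := rfl

theorem ex_fintype (p : PMF Z) (f : Z → ℝ≥0∞) : ex p f = ∑ z, p z * f z := tsum_fintype _

theorem ex_iid_apply (n : ℕ) (p : PMF Z) (i : Fin n) (f : Z → ℝ≥0∞) :
    ex (iid n p) (fun u => f (u i)) = ex p f := by
  classical
  rw [ex_fintype, ex_fintype]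
  have h : ∑ z, p z = 1 := by rw [← tsum_fintype (L := .unconditional _)]; exact p.tsum_coe
  have h1 : ∀ u : Fin n → Z, iid n p u * f (u i) =
      ∏ j, (p (u j) * if j = i then f (u j) else 1) := fun u => by
    rw [Finset.prod_mul_distrib, iid_apply]
    simp
  simp only [h1]
  rw [sum_prod_eq n fun j z => p z * if j = i then f z else 1, Finset.prod_eq_single i]
  · simp
  · intro j _ hj
    simp [hj, h]
  · simp

theorem sum_toReal_eq_one (p : PMF Z) : ∑ z, (p z).toReal = 1 := by
  have h : ∑ z, p z = 1 := by rw [← tsum_fintype (L := .unconditional _)]; exact p.tsum_coe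
  rw [← ENNReal.toReal_sum fun z _ => p.apply_ne_top z, h, ENNReal.toReal_one]

/-- The variance of a sum of independent centered random variables. -/
theorem sum_iid_sq (n : ℕ) (p : Z → ℝ) (hp : ∑ z, p z = 1) (g : Z → ℝ) (hg : ∑ z, p z * g z = 0) :
    ∑ u : Fin n → Z, (∏ j, p (u j)) * (∑ j, g (u j)) ^ 2 = n * ∑ z, p z * g z ^ 2 := by
  classical
  have h1 : ∀ u : Fin n → Z, (∏ j, p (u j)) * (∑ j, g (u j)) ^ 2 =
      ∑ j, ∑ k, ∏ i, (p (u i) * ((if i = j then g (u i) else 1) *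
        if i = k then g (u i) else 1)) := fun u => by
    rw [sq, Finset.sum_mul_sum, Finset.mul_sum]
    refine Finset.sum_congr rfl fun j _ => ?_
    rw [Finset.mul_sum]
    refine Finset.sum_congr rfl fun k _ => ?_
    rw [Finset.prod_mul_distrib, Finset.prod_mul_distrib, Finset.prod_ite_eq', Finset.prod_ite_eq']
    simp
  simp only [h1]
  rw [Finset.sum_comm]
  have h2 : ∀ j : Fin n, ∑ u : Fin n → Z, ∑ k, ∏ i, (p (u i) * ((if i = j then g (u i) else 1) *
      if i = k then g (u i) else 1)) = ∑ z, p z * g z ^ 2 := fun j => by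
    rw [Finset.sum_comm, Finset.sum_eq_single j]
    · rw [sum_prod_eq n fun i z => p z * ((if i = j then g z else 1) * if i = j then g z else 1),
        Finset.prod_eq_single j]
      · simp [sq]
      · intro i _ hi
        simp [hi, hp]
      · simp
    · intro k _ hk
      rw [sum_prod_eq n fun i z => p z * ((if i = j then g z else 1) * if i = k then g z else 1)]
      refine Finset.prod_eq_zero (Finset.mem_univ j) ?_
      simp [hk.symm, hg]
    · simp
  rw [Finset.sum_congr rfl fun j _ => h2 j]
  simp

/-- The expected deviation of an empirical average of `k ^ 2` samples from the mean. -/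
theorem sum_iid_abs_sub_le (k : ℕ) (hk : 0 < k) (p : PMF Z) (f : Z → ℝ) (B : ℝ) (hB : 0 < B)
    (hf : ∀ z ∈ p.support, |f z - ∑ z, (p z).toReal * f z| ≤ B) :
    ∑ u : Fin (k ^ 2) → Z, (∏ j, (p (u j)).toReal) *
      |(∑ j, f (u j)) / (k ^ 2 : ℕ) - ∑ z, (p z).toReal * f z| ≤ B / k := by
  set μ := ∑ z, (p z).toReal * f z with hμ
  have hp := sum_toReal_eq_one p
  have hk' : (0 : ℝ) < k := by exact_mod_cast hk
  have h1 := sum_iid_sq (k ^ 2) (fun z => (p z).toReal) hp (fun z => f z - μ) (by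
    simp only [mul_sub, Finset.sum_sub_distrib, ← Finset.sum_mul, hp, ← hμ]
    ring)
  have h2 : ∑ z, (p z).toReal * (f z - μ) ^ 2 ≤ B ^ 2 := by
    calc _ ≤ ∑ z, (p z).toReal * B ^ 2 := by
          refine Finset.sum_le_sum fun z _ => ?_
          by_cases hz : z ∈ p.support
          · refine mul_le_mul_of_nonneg_left ?_ ENNReal.toReal_nonneg
            rw [← sq_abs]
            exact pow_le_pow_left₀ (abs_nonneg _) (hf z hz) 2
          · simp [(PMF.apply_eq_zero_iff p z).2 hz]
      _ = B ^ 2 := by rw [← Finset.sum_mul, hp, one_mul]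
  have hone : ∑ u : Fin (k ^ 2) → Z, (∏ j, (p (u j)).toReal) = 1 := by
    rw [sum_prod_eq (k ^ 2) fun _ z => (p z).toReal]
    simp [hp]
  -- the inequality of arithmetic and geometric means replaces the Cauchy-Schwarz inequality
  have h3 : ∀ u : Fin (k ^ 2) → Z, |(∑ j, f (u j)) / (k ^ 2 : ℕ) - μ| ≤
      ((∑ j, (f (u j) - μ)) ^ 2 + (B * k) ^ 2) / (2 * B * k ^ 3) := fun u => by
    have : (∑ j, f (u j)) / (k ^ 2 : ℕ) - μ = (∑ j, (f (u j) - μ)) / k ^ 2 := by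
      rw [Finset.sum_sub_distrib]
      simp
      field_simp
    rw [this, abs_div, abs_of_pos (by positivity : (0 : ℝ) < (k : ℝ) ^ 2),
      div_le_div_iff₀ (by positivity) (by positivity)]
    set y := ∑ j, (f (u j) - μ)
    have : 0 ≤ (|y| - B * k) ^ 2 := sq_nonneg _
    rw [sub_sq, sq_abs] at this
    nlinarith [mul_le_mul_of_nonneg_right (by linarith : 2 * |y| * (B * k) ≤ y ^ 2 + (B * k) ^ 2)
      (by positivity : (0 : ℝ) ≤ (k : ℝ) ^ 2)]
  calc _ ≤ ∑ u : Fin (k ^ 2) → Z, (∏ j, (p (u j)).toReal) *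
        (((∑ j, (f (u j) - μ)) ^ 2 + (B * k) ^ 2) / (2 * B * k ^ 3)) :=
        Finset.sum_le_sum fun u _ => mul_le_mul_of_nonneg_left (h3 u)
          (Finset.prod_nonneg fun _ _ => ENNReal.toReal_nonneg)
    _ = ((∑ u : Fin (k ^ 2) → Z, (∏ j, (p (u j)).toReal) * (∑ j, (f (u j) - μ)) ^ 2) +
          (B * k) ^ 2) / (2 * B * k ^ 3) := by
        simp only [mul_div, mul_add, add_div, Finset.sum_add_distrib, ← Finset.sum_div,
          ← Finset.sum_mul, hone, one_mul]
    _ ≤ (k ^ 2 * B ^ 2 + (B * k) ^ 2) / (2 * B * k ^ 3) := by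
        rw [h1]
        push_cast
        gcongr
    _ = B / k := by field_simp; ring

end Expectation


/-! ### The number of external instructions -/

section Bounded

variable {E α β : Type}

/-- The computation calls at most `n` external instructions, and the sum of the number of calls and
the number of steps that are left in the end is at most `n`. -/
def Comp.Bounded : ℕ → Comp E (Option (α × ℕ)) → Prop
  | _, .ret none => True
  | n, .ret (some (_, t)) => t ≤ n
  | 0, .call _ _ _ => False
  | n + 1, .call _ _ k => ∀ w, Bounded n (k w)

theorem Comp.bounded_ret {n t : ℕ} {a : α} (h : t ≤ n) :
    (Comp.ret (some (a, t)) : Comp E (Option (α × ℕ))).Bounded n := by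
  simpa [Comp.Bounded] using h

theorem Comp.Bounded.mono {x : Comp E (Option (α × ℕ))} {n n' : ℕ} (h : x.Bounded n)
    (hn : n ≤ n') : x.Bounded n' := by
  induction x generalizing n n' with
  | ret a =>
    rcases a with _ | ⟨a, t⟩
    · simp [Comp.Bounded]
    · simp only [Comp.Bounded] at *
      omega
  | call e v k ih =>
    cases n with
    | zero => simp [Comp.Bounded] at h
    | succ n =>
      obtain ⟨n', rfl⟩ : ∃ j, n' = j + 1 := ⟨n' - 1, by omega⟩
      simp only [Comp.Bounded] at *
      exact fun w => ih w (h w) (by omega)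

theorem Timed.bounded_bind {x : Timed E α} {f : α → Timed E β} {t : ℕ} (h : (x t).Bounded t)
    (hf : ∀ a t, (f a t).Bounded t) : (x.bind f t).Bounded t := by
  rw [Timed.bind]
  generalize x t = y at h
  induction y generalizing t with
  | ret a =>
    rcases a with _ | ⟨a, t'⟩
    · simp [Comp.bind, Comp.Bounded]
    · exact (hf a t').mono (by simpa [Comp.Bounded] using h)
  | call e v k ih =>
    cases t with
    | zero => simp [Comp.Bounded] at h
    | succ n =>
      simp only [Comp.Bounded, Comp.bind] at *
      exact fun w => ih w (h w)

theorem Timed.bounded_step {x : Timed E α} (h : ∀ t, (x t).Bounded t) (t : ℕ) :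
    (x.step t).Bounded t := by
  cases t with
  | zero => simp [Timed.step, Comp.Bounded]
  | succ t => exact (h t).mono (by omega)

theorem Timed.bounded_rounds {c f : Val → Timed E Val} (hc : ∀ v t, (c v t).Bounded t)
    (hf : ∀ v t, (f v t).Bounded t) (k : ℕ) (v : Val) (t : ℕ) :
    (Timed.rounds c f k v t).Bounded t := by
  induction k generalizing v t with
  | zero => simp [Timed.rounds, Comp.Bounded]
  | succ k ih =>
    refine Timed.bounded_bind (hc v t) fun a t => ?_
    split
    · exact Timed.bounded_bind (hf v t) fun w t => ih w t
    · exact Comp.bounded_ret (le_refl t)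

/-- Every external instruction costs a step, so the budget bounds the number of calls; hence a tape
with as many numbers as there are steps suffices. -/
theorem Prog.bounded_run (p : Prog E) (v : Val) (t : ℕ) : (p.run v t).Bounded t := by
  induction p generalizing v t with
  | skip | const | fst | snd | isPair | add | sub | div =>
    exact Timed.bounded_step (fun t => Comp.bounded_ret (le_refl t)) t
  | seq f g ihf ihg =>
    exact Timed.bounded_step (fun t => Timed.bounded_bind (ihf v t) fun a t => ihg a t) t
  | pair f g ihf ihg =>
    exact Timed.bounded_step (fun t => Timed.bounded_bind (ihf v t) fun a t =>
      Timed.bounded_bind (ihg v t) fun b t => Comp.bounded_ret (le_refl t)) t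
  | cond c f g ihc ihf ihg =>
    refine Timed.bounded_step (fun t => Timed.bounded_bind (ihc v t) fun a t => ?_) t
    split
    · exact ihf v t
    · exact ihg v t
  | loop c f ihc ihf =>
    exact Timed.bounded_step (fun t => Timed.bounded_rounds ihc ihf _ v t) t
  | op e =>
    cases t with
    | zero => simp [Prog.run, Timed.step, Comp.Bounded]
    | succ t => exact fun w => Comp.bounded_ret (le_refl t)

end Bounded

/-! ### Randomized rounding -/

/-- Hermite's identity for the integer parts of the shifts of `A / Q`. -/
theorem sum_range_add_div (A Q : ℕ) (hQ : 0 < Q) :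
    ∑ r ∈ Finset.range Q, (A + r) / Q = A := by
  induction A with
  | zero =>
    refine Finset.sum_eq_zero fun r hr => ?_
    rw [Finset.mem_range] at hr
    simp [Nat.div_eq_of_lt hr]
  | succ A ih =>
    have h1 : ∑ r ∈ Finset.range Q, (A + 1 + r) / Q + A / Q =
        ∑ r ∈ Finset.range Q, (A + r) / Q + (A + Q) / Q := by
      rw [← Finset.sum_range_succ fun r => (A + r) / Q, Finset.sum_range_succ']
      simp only [add_zero]
      congr 1
      exact Finset.sum_congr rfl fun r _ => by rw [show A + 1 + r = A + (r + 1) by ring]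
    rw [ih, Nat.add_div_right _ hQ] at h1
    omega

/-- The number of offsets for which two numbers are rounded to different cells is at most the
difference of the numbers. -/
theorem card_cell_ne_le (P : SimParams) (hQ : 0 < P.Q) {A B : ℕ} (h : A ≤ B) :
    ((Finset.range P.Q).filter fun r => cell P A r ≠ cell P B r).card ≤ B - A := by
  have h1 : ∑ r ∈ Finset.range P.Q, ((B + r) / P.Q - (A + r) / P.Q) = B - A := by
    rw [Finset.sum_tsub_distrib, sum_range_add_div _ _ hQ, sum_range_add_div _ _ hQ]
    intro r _
    exact Nat.div_le_div_right (by omega)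
  rw [Finset.card_filter, ← h1]
  refine Finset.sum_le_sum fun r _ => ?_
  have : (A + r) / P.Q ≤ (B + r) / P.Q := Nat.div_le_div_right (by omega)
  by_cases h2 : (A + r) / P.Q = (B + r) / P.Q
  · rw [if_neg (by simpa [cell] using h2)]
    exact Nat.zero_le _
  · rw [if_pos (by simpa [cell] using h2)]
    omega

/-- The probability that two numbers are rounded to different cells. -/
theorem ex_cell_ne_le (P : SimParams) {w : ℕ} (hQ : P.Q = 2 ^ w) (A B : ℕ) :
    ex (unif w) (fun r => ind (cell P A r ≠ cell P B r)) ≤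
      ENNReal.ofReal (|(A : ℝ) - B| / P.Q) := by
  wlog h : A ≤ B generalizing A B
  · have := this B A (by omega)
    rw [abs_sub_comm]
    simpa only [ne_comm] using this
  have hpos : 0 < P.Q := hQ ▸ Nat.two_pow_pos w
  rw [ex_unif, ← hQ]
  have h1 : ∑ r ∈ Finset.range P.Q, ind (cell P A r ≠ cell P B r) =
      ((Finset.range P.Q).filter fun r => cell P A r ≠ cell P B r).card := by
    rw [Finset.card_filter]
    push_cast
    exact Finset.sum_congr rfl fun r _ => by simp [ind]
  have h2 : ((2 : ℝ≥0∞) ^ w) = ENNReal.ofReal P.Q := by simp [hQ]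
  have h3 := card_cell_ne_le P hpos h
  rw [h1, abs_sub_comm, abs_of_nonneg (by simpa using h), div_eq_inv_mul, h2,
    ENNReal.ofReal_mul (by positivity), ENNReal.ofReal_inv_of_pos (by exact_mod_cast hpos)]
  gcongr
  rw [← Nat.cast_sub h, ENNReal.ofReal_natCast]
  exact_mod_cast h3

section Stability

variable {Z : Type*} [Fintype Z]

/-- The mean of a function, rounded down. -/
noncomputable def floorMean (D : PMF Z) (f : Z → ℕ) : ℕ := ⌊∑ z, (D z).toReal * (f z : ℝ)⌋₊

/-- With high probability over the samples and the offset, the empirical average of a bounded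
function and its mean are rounded to the same cell. -/
theorem ex_ex_cell_ne_le (P : SimParams) {w k : ℕ} (hQ : P.Q = 2 ^ w) (hm : P.m = k ^ 2)
    (hk : 0 < k) (D : PMF Z) (f : Z → ℕ) (hf : ∀ z ∈ D.support, f z ≤ 2 * P.W) :
    ex (iid P.m D) (fun u => ex (unif w) fun r =>
      ind (cell P ((∑ j, f (u j)) / P.m) r ≠ cell P (floorMean D f) r)) ≤
      ENNReal.ofReal ((2 * (P.W + 1) / k + 1) / P.Q) := by
  have hp := sum_toReal_eq_one D
  set μ := ∑ z, (D z).toReal * (f z : ℝ) with hμ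
  have hμ0 : 0 ≤ μ := Finset.sum_nonneg fun z _ => by positivity
  have hμ1 : μ ≤ 2 * P.W := by
    calc μ ≤ ∑ z, (D z).toReal * (2 * P.W) := by
          refine Finset.sum_le_sum fun z _ => ?_
          by_cases hz : z ∈ D.support
          · have : (f z : ℝ) ≤ 2 * P.W := by exact_mod_cast hf z hz
            gcongr
          · simp [(PMF.apply_eq_zero_iff D z).2 hz]
      _ = _ := by rw [← Finset.sum_mul, hp, one_mul]
  have hdev := sum_iid_abs_sub_le k hk D (fun z => (f z : ℝ)) (2 * (P.W + 1)) (by positivity)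
    (fun z hz => by
      have : (f z : ℝ) ≤ 2 * P.W := by exact_mod_cast hf z hz
      rw [abs_le]
      constructor <;> linarith [(Nat.cast_nonneg (f z) : (0 : ℝ) ≤ f z)])
  rw [← hm, ← hμ] at hdev
  have hfl : ∀ u : Fin P.m → Z, |((((∑ j, f (u j)) / P.m : ℕ) : ℝ) - (floorMean D f : ℕ))| ≤
      |(∑ j, (f (u j) : ℝ)) / (P.m : ℕ) - μ| + 1 := fun u => by
    have h1 : (((∑ j, f (u j)) / P.m : ℕ) : ℝ) = ⌊(∑ j, (f (u j) : ℝ)) / (P.m : ℕ)⌋₊ := by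
      rw [← Nat.floor_div_eq_div (K := ℝ)]
      push_cast
      rfl
    rw [h1, floorMean, ← hμ]
    set y := (∑ j, (f (u j) : ℝ)) / (P.m : ℕ)
    have hy : 0 ≤ y := by positivity
    have h2 := Nat.floor_le hy
    have h3 := Nat.lt_floor_add_one y
    have h4 := Nat.floor_le hμ0
    have h5 := Nat.lt_floor_add_one μ
    rw [abs_le]
    constructor
    · have := neg_abs_le (y - μ); linarith
    · have := le_abs_self (y - μ); linarith
  have hsum : ∑ u : Fin P.m → Z, (∏ j, (D (u j)).toReal) *
      ((|(∑ j, (f (u j) : ℝ)) / (P.m : ℕ) - μ| + 1) / P.Q) ≤ (2 * (P.W + 1) / k + 1) / P.Q := by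
    have hone : ∑ u : Fin P.m → Z, (∏ j, (D (u j)).toReal) = 1 := by
      rw [sum_prod_eq P.m fun _ z => (D z).toReal]
      simp [hp]
    simp only [mul_div, mul_add, mul_one, ← Finset.sum_div, Finset.sum_add_distrib, hone]
    gcongr
    simpa [mul_add] using hdev
  refine le_trans ?_ (ENNReal.ofReal_le_ofReal hsum)
  rw [ENNReal.ofReal_sum_of_nonneg fun u _ => mul_nonneg
    (Finset.prod_nonneg fun _ _ => ENNReal.toReal_nonneg) (by positivity), ex_fintype]
  refine Finset.sum_le_sum fun u _ => ?_
  rw [ENNReal.ofReal_mul (Finset.prod_nonneg fun _ _ => ENNReal.toReal_nonneg),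
    ENNReal.ofReal_prod_of_nonneg fun _ _ => ENNReal.toReal_nonneg]
  simp only [ENNReal.ofReal_toReal (D.apply_ne_top _), iid_apply]
  gcongr
  refine (ex_cell_ne_le P hQ _ _).trans (ENNReal.ofReal_le_ofReal ?_)
  gcongr
  exact hfl u

end Stability


/-! ### Stability of the simulation -/

section Stable

variable {X : Type*} [Fintype X]

/-- The conditions on the parameters under which rounded averages are admissible answers to queries
of tolerance `τ`.  A value `φ` is represented by `W (1 + φ)`, and the cells have length `Q = W / P0`,
so that the number of the cell of an average is `P0 (1 + φ)` up to rounding.  For `τ ≥ 1` the answer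
`0` is always admissible, and the resolution `W = 0` makes a single sample suffice. -/
structure SimParams.Fits (P : SimParams) (τ : ℝ) (w k : ℕ) : Prop where
  prime : P.p.Prime
  hQ : P.Q = 2 ^ w
  hw : 1 ≤ w
  hm : P.m = k ^ 2
  hk : 0 < k
  hW : P.W = P.P0 * P.Q
  tol : (P.P0 = P.p ∧ 3 ≤ τ * P.p) ∨ (P.P0 = 0 ∧ 1 ≤ τ)

/-- The mean of the discretized values of a query, rounded down. -/
noncomputable def meanAvg (P : SimParams) (enc : X → Val) (D : PMF (X × Bool)) (body : Prog Empty)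
    (v : Val) : ℕ :=
  floorMean D fun z => psi P body v (encExample enc z)

/-- The empirical averages of the user with the samples `u`. -/
noncomputable def userAvg (P : SimParams) (enc : X → Val) (u : Fin P.m → X × Bool) :
    Prog Empty → Val → ℕ :=
  empAvg P (List.ofFn fun j => encExample enc (u j))

omit [Fintype X] in
theorem userAvg_eq (P : SimParams) (enc : X → Val) (u : Fin P.m → X × Bool) (body : Prog Empty)
    (v : Val) :
    userAvg P enc u body v = (∑ j, psi P body v (encExample enc (u j))) / P.m := by
  rw [userAvg, empAvg, List.map_ofFn, List.sum_ofFn]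
  rfl

omit [Fintype X] in
/-- The discretized value of a query approximates `W (1 + φ)`. -/
theorem psi_spec {P : SimParams} {enc : X → Val} {D : PMF (X × Bool)} {body : Prog Empty} {v : Val}
    {φ : X × Bool → ℚ} (h : IsQuery enc D P.T body v φ) {z : X × Bool} (hz : z ∈ D.support) :
    psi P body v (encExample enc z) ≤ 2 * P.W ∧
      |(psi P body v (encExample enc z) : ℝ) - P.W * (1 + (φ z : ℝ))| ≤ 1 := by
  obtain ⟨h1, w, hw, a, b, d, hd, rfl, hφ⟩ := h z hz
  have hpsi : psi P body v (encExample enc z) = P.W + P.W * (a - b) / d - P.W * (b - a) / d := by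
    rw [psi, evalBody_fn hw, discretize_fn, Val.toNum_num]
  rw [hpsi]
  have hd' : (0 : ℚ) < d := by exact_mod_cast Nat.pos_of_ne_zero hd
  have hdr : (0 : ℝ) < d := by exact_mod_cast Nat.pos_of_ne_zero hd
  rw [hφ, abs_le, le_div_iff₀ hd', div_le_iff₀ hd'] at h1
  have fl : ∀ n : ℕ, (n : ℝ) / d - 1 ≤ ((n / d : ℕ) : ℝ) ∧ ((n / d : ℕ) : ℝ) ≤ (n : ℝ) / d :=
    fun n => by
      refine ⟨?_, Nat.cast_div_le⟩
      rw [← Nat.floor_div_eq_div (K := ℝ)]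
      exact (Nat.sub_one_lt_floor _).le
  have hφr : ((φ z : ℚ) : ℝ) = ((a : ℝ) - b) / d := by rw [hφ]; push_cast; rfl
  rw [hφr]
  rcases le_total b a with hab | hab
  · have h2 : a - b ≤ d := by
      have : (a : ℚ) ≤ d + b := by linarith
      have : a ≤ d + b := by exact_mod_cast this
      omega
    have h3 : P.W * (a - b) / d ≤ P.W := by
      refine Nat.div_le_of_le_mul ?_
      rw [mul_comm]
      exact Nat.mul_le_mul_right _ h2
    rw [Nat.sub_eq_zero_of_le hab, Nat.mul_zero, Nat.zero_div, Nat.sub_zero]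
    refine ⟨by omega, ?_⟩
    obtain ⟨h4, h5⟩ := fl (P.W * (a - b))
    push_cast [Nat.cast_sub hab] at h4 h5 ⊢
    rw [abs_le]
    have : (P.W : ℝ) * (1 + ((a : ℝ) - b) / d) = P.W + P.W * ((a : ℝ) - b) / d := by ring
    rw [this]
    constructor <;> linarith
  · have h2 : b - a ≤ d := by
      have : (b : ℚ) ≤ d + a := by linarith
      have : b ≤ d + a := by exact_mod_cast this
      omega
    have h3 : P.W * (b - a) / d ≤ P.W := by
      refine Nat.div_le_of_le_mul ?_
      rw [mul_comm]
      exact Nat.mul_le_mul_right _ h2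
    rw [Nat.sub_eq_zero_of_le hab, Nat.mul_zero, Nat.zero_div, Nat.add_zero]
    refine ⟨(Nat.sub_le _ _).trans (by omega), ?_⟩
    obtain ⟨h4, h5⟩ := fl (P.W * (b - a))
    rw [Nat.cast_sub h3]
    push_cast [Nat.cast_sub hab] at h4 h5 ⊢
    rw [abs_le]
    have : (P.W : ℝ) * (1 + ((a : ℝ) - b) / d) = P.W - P.W * ((b : ℝ) - a) / d := by ring
    rw [this]
    constructor <;> linarith

/-- The rounded mean is an admissible answer of the oracle. -/
theorem abs_answerRat_sub_le {P : SimParams} {τ : ℝ} {w k : ℕ} (hP : P.Fits τ w k) {enc : X → Val}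
    {D : PMF (X × Bool)} {body : Prog Empty} {v : Val} {φ : X × Bool → ℚ}
    (h : IsQuery enc D P.T body v φ) {r : ℕ} (hr : r < P.Q) :
    |(answerRat P (cell P (meanAvg P enc D body v) r) : ℝ) - ∑ z, (D z).toReal * (φ z : ℝ)| ≤ τ := by
  have hD := sum_toReal_eq_one D
  have hQ : (0 : ℝ) < P.Q := by exact_mod_cast (Nat.zero_le r).trans_lt hr
  have hp2 := hP.prime.two_le
  have hp : (0 : ℝ) < P.p := by exact_mod_cast hP.prime.pos
  set E := ∑ z, (D z).toReal * (φ z : ℝ) with hE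
  have hE1 : |E| ≤ 1 := by
    refine ((Finset.abs_sum_le_sum_abs _ _).trans ?_).trans hD.le
    refine Finset.sum_le_sum fun z _ => ?_
    by_cases hz : z ∈ D.support
    · rw [abs_mul, abs_of_nonneg ENNReal.toReal_nonneg]
      have : |((φ z : ℚ) : ℝ)| ≤ 1 := by exact_mod_cast (h z hz).1
      exact mul_le_of_le_one_right ENNReal.toReal_nonneg this
    · simp [(PMF.apply_eq_zero_iff D z).2 hz]
  have hmean : |∑ z, (D z).toReal * (psi P body v (encExample enc z) : ℝ) - P.W * (1 + E)| ≤ 1 := by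
    have : ∑ z, (D z).toReal * (psi P body v (encExample enc z) : ℝ) - P.W * (1 + E) =
        ∑ z, (D z).toReal * ((psi P body v (encExample enc z) : ℝ) - P.W * (1 + (φ z : ℝ))) := by
      simp only [mul_sub, Finset.sum_sub_distrib]
      congr 1
      rw [mul_add, mul_one, hE, Finset.mul_sum]
      have h1 : (P.W : ℝ) = ∑ z, (D z).toReal * P.W := by rw [← Finset.sum_mul, hD, one_mul]
      nth_rewrite 1 [h1]
      rw [← Finset.sum_add_distrib]
      exact Finset.sum_congr rfl fun z _ => by ring
    rw [this]
    refine ((Finset.abs_sum_le_sum_abs _ _).trans ?_).trans hD.le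
    refine Finset.sum_le_sum fun z _ => ?_
    by_cases hz : z ∈ D.support
    · rw [abs_mul, abs_of_nonneg ENNReal.toReal_nonneg]
      exact mul_le_of_le_one_right ENNReal.toReal_nonneg (psi_spec h hz).2
    · simp [(PMF.apply_eq_zero_iff D z).2 hz]
  rw [meanAvg, floorMean]
  set μ := ∑ z, (D z).toReal * (psi P body v (encExample enc z) : ℝ) with hμ
  have hμ0 : 0 ≤ μ := Finset.sum_nonneg fun z _ => by positivity
  have hf1 := Nat.floor_le hμ0
  have hf2 := Nat.lt_floor_add_one μ
  rcases hP.tol with ⟨hP0, hτ⟩ | ⟨hP0, hτ⟩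
  · set A := ⌊μ⌋₊
    set c := cell P A r with hc
    have hc1 : (c : ℝ) * P.Q ≤ A + r := by exact_mod_cast Nat.div_mul_le_self (A + r) P.Q
    have hc2 : (A : ℝ) + r < (c + 1) * P.Q := by
      have := Nat.lt_mul_div_succ (A + r) ((Nat.zero_le r).trans_lt hr)
      rw [mul_comm] at this
      exact_mod_cast this
    have hr' : (r : ℝ) < P.Q := by exact_mod_cast hr
    have hQ2 : (2 : ℝ) ≤ P.Q := by
      rw [hP.hQ]
      have := Nat.pow_le_pow_right (n := 2) (by norm_num) hP.hw
      exact_mod_cast this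
    rw [hP.hW, hP0] at hmean
    push_cast at hmean
    rw [abs_le] at hmean hE1
    -- the number of the cell approximates `p (1 + E)`
    have hx : |(c : ℝ) - P.p - P.p * E| ≤ 3 := by
      rw [abs_le]
      constructor
      · by_contra hcon
        push Not at hcon
        nlinarith
      · by_contra hcon
        push Not at hcon
        nlinarith
    have hz : ∃ y : ℤ, answerRat P c = (y : ℚ) / P.p ∧ |(y : ℝ) - P.p * E| ≤ 3 := by
      refine ⟨((min (c - P.P0) (P.p - 1) : ℕ) : ℤ) - ((min (P.P0 - c) (P.p - 1) : ℕ) : ℤ), by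
        rw [answerRat]; push_cast; rfl, ?_⟩
      rw [hP0]
      have hcases : (((min (c - P.p) (P.p - 1) : ℕ) : ℤ) - ((min (P.p - c) (P.p - 1) : ℕ) : ℤ) =
          (c : ℤ) - P.p) ∨ (((min (c - P.p) (P.p - 1) : ℕ) : ℤ) -
          ((min (P.p - c) (P.p - 1) : ℕ) : ℤ) = (P.p : ℤ) - 1 ∧ (P.p : ℤ) - 1 < c - P.p) ∨
          (((min (c - P.p) (P.p - 1) : ℕ) : ℤ) - ((min (P.p - c) (P.p - 1) : ℕ) : ℤ) =
            1 - (P.p : ℤ) ∧ (c : ℤ) - P.p < 1 - P.p) := by omega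
      rw [abs_le] at hx ⊢
      rcases hcases with h1 | ⟨h1, h2⟩ | ⟨h1, h2⟩
      · rw [h1]; push_cast; exact hx
      · rw [h1]
        have h2' : (P.p : ℝ) - 1 < c - P.p := by exact_mod_cast h2
        push_cast
        constructor <;> nlinarith
      · rw [h1]
        have h2' : (c : ℝ) - P.p < 1 - P.p := by exact_mod_cast h2
        push_cast
        constructor <;> nlinarith
    obtain ⟨y, hy1, hy2⟩ := hz
    rw [hy1]
    push_cast
    have : (y : ℝ) / P.p - E = (y - P.p * E) / P.p := by field_simp
    rw [this, abs_div, abs_of_pos hp, div_le_iff₀ hp]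
    linarith
  · have hW : P.W = 0 := by rw [hP.hW, hP0, Nat.zero_mul]
    have hA : ⌊μ⌋₊ = 0 := by
      have : μ = 0 := by
        rw [hμ]
        refine Finset.sum_eq_zero fun z _ => ?_
        by_cases hz : z ∈ D.support
        · have := (psi_spec h hz).1
          rw [hW] at this
          have : psi P body v (encExample enc z) = 0 := by omega
          simp [this]
        · simp [(PMF.apply_eq_zero_iff D z).2 hz]
      simp [this]
    rw [hA]
    have : answerRat P (cell P 0 r) = 0 := by
      simp [answerRat, cell, Nat.div_eq_of_lt hr, hP0]
    rw [this]
    simpa using hE1.trans hτ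

/-- The simulation with the answers computed from the samples of one user and the simulation with
the answers computed from the true means end, on the same tape, with the same result, except with a
probability that is proportional to the number of queries; and the result of the latter simulation
is good. -/
theorem ex_execTape_ne_le {P : SimParams} {τ : ℝ} {w k : ℕ} (hP : P.Fits τ w k) (enc : X → Val)
    (D : PMF (X × Bool)) (good : Val → Prop) (x : Comp SQOp (Option (Val × ℕ))) (q n : ℕ)
    (hx : SQSat enc D τ P.T good q x) (hn : x.Bounded n) :
    (∀ r ∈ (tapes w n).support,
      ∃ v t, x.execTape (respond P (meanAvg P enc D)) r = some (v, t) ∧ good v) ∧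
    ex (iid P.m D) (fun u => ex (tapes w n) fun r =>
      ind (x.execTape (respond P (userAvg P enc u)) r ≠
        x.execTape (respond P (meanAvg P enc D)) r)) ≤
      (min q n : ℕ) * ENNReal.ofReal ((2 * (P.W + 1) / k + 1) / P.Q) := by
  induction x generalizing q n with
  | ret o =>
    constructor
    · intro r _
      rcases o with _ | ⟨v, t⟩
      · simp [SQSat] at hx
      · exact ⟨v, t, rfl, by simpa [SQSat] using hx⟩
    · simp [Comp.execTape, ind_of_false]
  | call e v κ ih =>
    obtain _ | n := n
    · simp [Comp.Bounded] at hn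
    simp only [Comp.Bounded] at hn
    cases e with
    | flip =>
      have hb : ∀ r ∈ (unif w).support, ∃ c : Bool, Val.num (r / (P.Q / 2)) = Val.ofBool c := by
        intro r hr
        rw [mem_support_unif] at hr
        have hw := hP.hw
        have h1 : P.Q / 2 = 2 ^ (w - 1) := by
          rw [hP.hQ, ← Nat.pow_div hw (by norm_num)]
        have h2 : 2 ^ w = 2 * 2 ^ (w - 1) := by rw [← pow_succ']; congr 1; omega
        have h3 : r / (P.Q / 2) < 2 := by
          rw [h1]
          exact Nat.div_lt_of_lt_mul (by rw [mul_comm, ← h2]; exact hr)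
        have h4 : r / (P.Q / 2) = 0 ∨ r / (P.Q / 2) = 1 := by
          generalize r / (P.Q / 2) = y at h3
          omega
        rcases h4 with h4 | h4 <;> rw [h4]
        · exact ⟨false, rfl⟩
        · exact ⟨true, rfl⟩
      have hx' : ∀ c : Bool, SQSat enc D τ P.T good q (κ (.ofBool c)) := by
        cases q <;> simpa only [SQSat] using hx
      constructor
      · intro r hr
        rw [tapes, PMF.mem_support_bind_iff] at hr
        obtain ⟨r0, hr0, hr⟩ := hr
        rw [PMF.support_map] at hr
        obtain ⟨l, hl, rfl⟩ := hr
        obtain ⟨c, hc⟩ := hb r0 hr0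
        have := (ih _ q n (hx' c) (hn _)).1 l hl
        simpa [Comp.execTape, respond, hc] using this
      · simp only [ex_tapes_succ, Comp.execTape, respond, List.headD_cons, List.tail_cons]
        rw [ex_comm]
        calc _ ≤ ex (unif w) fun _ => (min q n : ℕ) *
              ENNReal.ofReal ((2 * (P.W + 1) / k + 1) / P.Q) := by
              refine ex_mono fun r hr => ?_
              obtain ⟨c, hc⟩ := hb r hr
              rw [hc]
              exact (ih _ q n (hx' c) (hn _)).2
          _ ≤ _ := by
              rw [ex_const]
              gcongr
              omega
    | query body =>
      obtain _ | q := q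
      · simp [SQSat] at hx
      simp only [SQSat] at hx
      obtain ⟨φ, hφ, hx⟩ := hx
      have hx' : ∀ r ∈ (unif w).support, SQSat enc D τ P.T good q
          (κ (.ofRat (answerRat P (cell P (meanAvg P enc D body v) r)))) := fun r hr =>
        hx _ (abs_answerRat_sub_le hP hφ (by rw [hP.hQ]; exact mem_support_unif.1 hr))
      constructor
      · intro r hr
        rw [tapes, PMF.mem_support_bind_iff] at hr
        obtain ⟨r0, hr0, hr⟩ := hr
        rw [PMF.support_map] at hr
        obtain ⟨l, hl, rfl⟩ := hr
        have := (ih _ q n (hx' r0 hr0) (hn _)).1 l hl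
        simpa [Comp.execTape, respond] using this
      · simp only [ex_tapes_succ, Comp.execTape, respond, List.headD_cons, List.tail_cons]
        set σ := ENNReal.ofReal ((2 * (P.W + 1) / k + 1) / P.Q) with hσ
        have h1 : ex (iid P.m D) (fun u => ex (unif w) fun r =>
            ind (cell P (userAvg P enc u body v) r ≠ cell P (meanAvg P enc D body v) r)) ≤ σ := by
          have h := ex_ex_cell_ne_le P hP.hQ hP.hm hP.hk D
            (fun z => psi P body v (encExample enc z)) fun z hz => (psi_spec hφ hz).1
          simpa only [userAvg_eq, meanAvg] using h
        have h2 : ex (iid P.m D) (fun u => ex (unif w) fun r => ex (tapes w n) fun l => ind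
            ((κ (.ofRat (answerRat P (cell P (meanAvg P enc D body v) r)))).execTape
                (respond P (userAvg P enc u)) l ≠
                (κ (.ofRat (answerRat P (cell P (meanAvg P enc D body v) r)))).execTape
                (respond P (meanAvg P enc D)) l)) ≤ (min q n : ℕ) * σ := by
          rw [ex_comm, ← ex_const (unif w) ((min q n : ℕ) * σ)]
          exact ex_mono fun r hr => (ih _ q n (hx' r hr) (hn _)).2
        -- either the answers differ, or the computations differ after the same answer
        calc _ ≤ ex (iid P.m D) fun u => ex (unif w) (fun r =>
              ind (cell P (userAvg P enc u body v) r ≠ cell P (meanAvg P enc D body v) r)) +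
              ex (unif w) fun r => ex (tapes w n) fun l => ind
              ((κ (.ofRat (answerRat P (cell P (meanAvg P enc D body v) r)))).execTape
                (respond P (userAvg P enc u)) l ≠
                (κ (.ofRat (answerRat P (cell P (meanAvg P enc D body v) r)))).execTape
                (respond P (meanAvg P enc D)) l) := by
              refine ex_mono fun u _ => ?_
              rw [← ex_add]
              refine ex_mono fun r _ => ?_
              by_cases hcell : cell P (userAvg P enc u body v) r = cell P (meanAvg P enc D body v) r
              · rw [hcell]
                simp [ind_of_false]
              · rw [ind_of_true hcell]
                refine le_add_right ?_
                calc _ ≤ ex (tapes w n) fun _ => 1 := ex_mono fun l _ => ind_le_one _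
                  _ = 1 := ex_const _ _
          _ ≤ σ + (min q n : ℕ) * σ := by
              rw [ex_add]
              exact add_le_add h1 h2
          _ = _ := by
              rw [Nat.add_min_add_right]
              push_cast
              ring

end Stable


/-! ### The stable learner of one user -/

section UserLearner

variable {X : Type*} [Fintype X]

/-- The choice of the parameters: the denominator `p` is a prime of order `1 / τ`, by Bertrand's
postulate, `Q` is of order `B q'`, and the number of samples is the square of a number of order
`B q' / τ`, where `q'` bounds the number of queries. -/
theorem exists_simParams (τ : ℝ) (hτ : 0 < τ) (T B q Y : ℕ) (hB : 1 ≤ B) (hTY : T ≤ Y)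
    (hBY : B ≤ Y) (hY : 8 / τ + 2 ≤ Y) : ∃ (P : SimParams) (w k : ℕ), P.Fits τ w k ∧ P.T = T ∧
      (P.m : ℝ) ≤ (32 * B * q / τ + 1) ^ 2 ∧ P.m ≤ 25 * Y ^ 6 ∧ w ≤ 16 * Y ^ 2 ∧ P.W ≤ 16 * Y ^ 3 ∧
      P.sizes ≤ 60 * Y ^ 6 ∧
      (min q T : ℕ) * ENNReal.ofReal ((2 * (P.W + 1) / k + 1) / P.Q) ≤ (B : ℝ≥0∞)⁻¹ := by
  obtain ⟨P0, p, hp, hP0, hpY, htol⟩ : ∃ P0 p : ℕ, p.Prime ∧ (P0 : ℝ) ≤ 8 / τ ∧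
      (p : ℝ) ≤ 8 / τ + 2 ∧ ((P0 = p ∧ 3 ≤ τ * p) ∨ (P0 = 0 ∧ 1 ≤ τ)) := by
    by_cases h : 1 ≤ τ
    · exact ⟨0, 2, Nat.prime_two, by simp; positivity, by simp; positivity, Or.inr ⟨rfl, h⟩⟩
    · push Not at h
      have h0 : 0 < ⌈3 / τ⌉₊ := Nat.ceil_pos.2 (by positivity)
      obtain ⟨p, hp, h1, h2⟩ := Nat.exists_prime_lt_and_le_two_mul _ h0.ne'
      have h3 : (p : ℝ) ≤ 2 * ⌈3 / τ⌉₊ := by exact_mod_cast h2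
      have h4 := Nat.ceil_lt_add_one (show 0 ≤ 3 / τ by positivity)
      have h5 : (⌈3 / τ⌉₊ : ℝ) ≤ p := by exact_mod_cast h1.le
      have h6 := Nat.le_ceil (3 / τ)
      have h7 : 1 < 1 / τ := by rw [lt_div_iff₀ hτ]; linarith
      have h8 : 3 / τ = 3 * (1 / τ) := by ring
      have h9 : 8 / τ = 8 * (1 / τ) := by ring
      refine ⟨p, p, hp, by rw [h9]; linarith, by rw [h9]; linarith, Or.inl ⟨rfl, ?_⟩⟩
      have : 3 / τ ≤ p := h6.trans h5
      rwa [div_le_iff₀ hτ, mul_comm] at this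
  set q' := min q T with hq'
  set w := Nat.clog 2 (6 * B * q' + 2) with hw
  have hw1 : 1 ≤ w := Nat.clog_pos (by norm_num) (by omega)
  have hQ1 : 6 * B * q' + 2 ≤ 2 ^ w := Nat.le_pow_clog (by norm_num) _
  have hQ2 : 2 ^ w ≤ 2 * (6 * B * q' + 2) := by
    have h1 := Nat.pow_pred_clog_lt_self (b := 2) (by norm_num) (x := 6 * B * q' + 2) (by omega)
    rw [← hw, Nat.pred_eq_sub_one] at h1
    have h2 : 2 ^ w = 2 * 2 ^ (w - 1) := (mul_pow_sub_one (by omega) 2).symm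
    omega
  have hq'T : q' ≤ Y := (min_le_right _ _).trans hTY
  have hq'q : q' ≤ q := min_le_left _ _
  have hP0Y : P0 ≤ Y := by
    have : (P0 : ℝ) ≤ Y := by linarith
    exact_mod_cast this
  have hpY' : p ≤ Y := by
    have : (p : ℝ) ≤ Y := by linarith
    exact_mod_cast this
  have hY1 : 1 ≤ Y := hB.trans hBY
  have hYY : B * q' ≤ Y ^ 2 := by rw [sq]; exact Nat.mul_le_mul hBY hq'T
  have hY2 : 1 ≤ Y ^ 2 := Nat.one_le_pow _ _ hY1
  have hY3 : 1 ≤ Y ^ 3 := Nat.one_le_pow _ _ hY1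
  have hQ3 : 2 ^ w ≤ 16 * Y ^ 2 := by nlinarith
  have hW : P0 * 2 ^ w ≤ 16 * Y ^ 3 := by
    calc P0 * 2 ^ w ≤ Y * (16 * Y ^ 2) := Nat.mul_le_mul hP0Y hQ3
      _ = _ := by ring
  set k := 4 * B * q' * P0 + 1 with hk
  have hkY : k ≤ 5 * Y ^ 3 := by
    have : B * q' * P0 ≤ Y ^ 2 * Y := Nat.mul_le_mul hYY hP0Y
    have h2 : Y ^ 2 * Y = Y ^ 3 := by ring
    have h3 : 4 * B * q' * P0 = 4 * (B * q' * P0) := by ring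
    omega
  have hm : k ^ 2 ≤ 25 * Y ^ 6 := by
    calc k ^ 2 ≤ (5 * Y ^ 3) ^ 2 := Nat.pow_le_pow_left hkY 2
      _ = _ := by ring
  have hwQ : w ≤ 2 ^ w := Nat.lt_two_pow_self.le
  refine ⟨⟨T, k ^ 2, 2 ^ w, P0 * 2 ^ w, P0, p⟩, w, k, ⟨hp, rfl, hw1, rfl, by omega, rfl, htol⟩, rfl,
    ?_, hm, hwQ.trans hQ3, hW, ?_, ?_⟩
  · have h1 : (B : ℝ) * q' * P0 ≤ B * q * (8 / τ) := by
      have : (q' : ℝ) ≤ q := by exact_mod_cast hq'q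
      gcongr
    have h2 : (k : ℝ) ≤ 32 * B * q / τ + 1 := by
      rw [hk]
      push_cast
      have : 32 * (B : ℝ) * q / τ = 4 * (B * q * (8 / τ)) := by ring
      rw [this]
      linarith
    push_cast
    gcongr
  · have hsize : ∀ n : ℕ, n.size ≤ n := fun n => Nat.size_le.2 Nat.lt_two_pow_self
    simp only [SimParams.sizes]
    have h1 : Y ≤ Y ^ 6 := Nat.le_self_pow (by norm_num) _
    have h2 : Y ^ 2 ≤ Y ^ 6 := Nat.pow_le_pow_right hY1 (by norm_num)
    have h3 : Y ^ 3 ≤ Y ^ 6 := Nat.pow_le_pow_right hY1 (by norm_num)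
    have := hsize T
    have := hsize (k ^ 2)
    have := hsize (2 ^ w)
    have := hsize (P0 * 2 ^ w)
    have := hsize P0
    have := hsize p
    omega
  · have hBr : (0 : ℝ) < B := by exact_mod_cast hB
    have hkr : (0 : ℝ) < k := by rw [hk]; positivity
    have hQr : (0 : ℝ) < (2 ^ w : ℕ) := by positivity
    rw [← ENNReal.ofReal_natCast, ← ENNReal.ofReal_natCast,
      ← ENNReal.ofReal_inv_of_pos hBr, ← ENNReal.ofReal_mul (by positivity)]
    refine ENNReal.ofReal_le_ofReal ?_
    push_cast at hQr ⊢
    have hQ1r : 6 * (B : ℝ) * q' + 2 ≤ 2 ^ w := by exact_mod_cast hQ1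
    have hkr' : (k : ℝ) = 4 * B * q' * P0 + 1 := by rw [hk]; push_cast; rfl
    have hk1 : (1 : ℝ) ≤ k := by rw [hkr']; have : 0 ≤ 4 * (B : ℝ) * q' * P0 := by positivity
                                 linarith
    have e1 : (q' : ℝ) * ((2 * (P0 * 2 ^ w + 1) / k + 1) / 2 ^ w) =
        2 * (q' * P0) / k + (2 * q' / k + q') / 2 ^ w := by
      field_simp
      ring
    rw [e1]
    have e2 : 2 * ((q' : ℝ) * P0) / k ≤ 1 / (2 * B) := by
      rw [div_le_div_iff₀ hkr (by positivity), hkr']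
      linarith
    have e3 : (2 * (q' : ℝ) / k + q') / 2 ^ w ≤ 1 / (2 * B) := by
      have : 2 * (q' : ℝ) / k ≤ 2 * q' := div_le_self (by positivity) hk1
      rw [div_le_div_iff₀ hQr (by positivity)]
      nlinarith
    have e4 : (B : ℝ)⁻¹ = 1 / (2 * B) + 1 / (2 * B) := by field_simp; norm_num
    linarith

/-- Stability: if all users share the tape, then almost all of them compute the same hypothesis,
and this hypothesis is good.  More precisely, the hypothesis `out r u` that a user with samples `u`
computes on the tape `r` differs from the good hypothesis `ref r` with probability at most `1 / B`
only. -/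
theorem exists_userLearner (enc : X ↪ Val) (C : Set (X → Bool)) {b : ℕ}
    (hyp : Fin (2 ^ b) → X → Bool) {α τ : ℝ} (hτ : 0 < τ) {q T : ℕ} {A : Prog SQOp}
    (hA : SQLearns enc C hyp α τ q T A) (B Y : ℕ) (hB : 1 ≤ B) (hTY : T ≤ Y)
    (hBY : B ≤ Y) (hY : 8 / τ + 2 ≤ Y) :
    ∃ (m w : ℕ) (c : Comb) (out : List ℕ → (Fin m → X × Bool) → ℕ),
      (m : ℝ) ≤ (32 * B * q / τ + 1) ^ 2 ∧ w ≤ 16 * Y ^ 2 ∧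
      c.size ≤ 500000 * Y ^ 6 * (sqSize A + b + 1) ∧
      (∀ r (u : Fin m → X × Bool), c.cost (.pair (encTape r) (encUser enc u)) ≤ 1000000 * Y ^ 10) ∧
      (∀ r (u : Fin m → X × Bool), c.fn (.pair (encTape r) (encUser enc u)) = .num (out r u)) ∧
      (∀ r (u : Fin m → X × Bool), out r u < 2 ^ b) ∧
      ∀ D, Realizable C D → ∃ ref : List ℕ → ℕ,
        (∀ r ∈ (tapes w T).support, Good hyp D α (.num (ref r))) ∧
        ex (iid m D) (fun u => ex (tapes w T) fun r => ind (out r u ≠ ref r)) ≤ (B : ℝ≥0∞)⁻¹ := by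
  obtain ⟨P, w, k, hP, rfl, hm, hmY, hw, hW, hsizes, hfail⟩ :=
    exists_simParams τ hτ T B q Y hB hTY hBY hY
  obtain ⟨c, hc1, hc2, hc3⟩ := exists_userComb P hP.prime A b
  choose out hout1 hout2 hout3 using hc3
  have hY1 : 1 ≤ Y := hB.trans hBY
  have henc : ∀ u : Fin P.m → X × Bool,
      encUser enc u = .ofList (List.ofFn fun j => encExample enc (u j)) := fun u => rfl
  refine ⟨P.m, w, c, fun r u => out r (List.ofFn fun j => encExample enc (u j)), hm, hw, ?_,
    fun r u => ?_, fun r u => by rw [henc]; exact hout2 _ _, fun r u => hout1 _ _, fun D hD => ?_⟩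
  · refine hc1.trans (Nat.mul_le_mul_right _ ?_)
    have : 1 ≤ Y ^ 6 := Nat.one_le_pow _ _ hY1
    omega
  · have h1 := hc2 r (List.ofFn fun j => encExample enc (u j))
    rw [List.length_ofFn] at h1
    rw [henc]
    refine h1.trans ?_
    have h3 : 1 ≤ Y ^ 3 := Nat.one_le_pow _ _ hY1
    have h9 : 1 ≤ Y ^ 9 := Nat.one_le_pow _ _ hY1
    have h10 : 1 ≤ Y ^ 10 := Nat.one_le_pow _ _ hY1
    have hYY : Y ≤ Y ^ 3 := Nat.le_self_pow (by norm_num) _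
    calc (P.m * (1000 * P.T + 82 * P.W + 340) + 300) * (10 * P.T + 1) + 100
        ≤ (25 * Y ^ 6 * (2700 * Y ^ 3) + 300 * Y ^ 9) * (11 * Y) + 100 * Y ^ 10 := by
          gcongr <;> omega
      _ = 745900 * Y ^ 10 := by ring
      _ ≤ _ := by omega
  · obtain ⟨h1, h2⟩ := ex_execTape_ne_le hP enc D (Good hyp D α) (A.run (.num 0) P.T) q P.T (hA D hD)
      (A.bounded_run _ _)
    refine ⟨fun r => match (A.run (.num 0) P.T).execTape (respond P (meanAvg P enc D)) r with
      | some (v, _) => v.toNum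
      | none => 0, fun r hr => ?_, ?_⟩
    · obtain ⟨v, t, hv, hgood⟩ := h1 r hr
      dsimp only
      rw [hv]
      obtain ⟨c, rfl, hc⟩ := hgood
      exact ⟨c, rfl, hc⟩
    · refine le_trans (ex_mono fun u _ => ex_mono fun r hr => ind_mono ?_) (h2.trans hfail)
      intro hne heq
      refine hne ?_
      obtain ⟨v, t, hv, hgood⟩ := h1 r hr
      dsimp only
      rw [hv]
      rw [hout3 _ _ _ _ (heq.trans hv)]
      obtain ⟨c, rfl, hc⟩ := hgood
      simp only [Val.toNum_num]
      have := c.2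
      omega

end UserLearner


/-! ### Drawing random numbers -/

theorem PMF.ext_of_ex {α : Type*} {μ ν : PMF α} (h : ∀ f, ex μ f = ex ν f) : μ = ν := by
  ext a
  have : ∀ ξ : PMF α, ex ξ (fun b => ind (b = a)) = ξ a := fun ξ => by
    rw [ex, tsum_eq_single a]
    · simp [ind_of_true]
    · intro b hb
      simp [ind_of_false hb]
  rw [← this μ, ← this ν, h]

theorem ex_bool (f : Bool → ℝ≥0∞) :
    ex (PMF.uniformOfFintype Bool) f = 2⁻¹ * (f false + f true) := by
  rw [ex_fintype]
  simp [mul_add, add_comm]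

theorem sum_range_two_mul (f : ℕ → ℝ≥0∞) (n : ℕ) :
    ∑ i ∈ Finset.range (2 * n), f i = ∑ i ∈ Finset.range n, (f (2 * i) + f (2 * i + 1)) := by
  induction n with
  | zero => rfl
  | succ n ih => rw [Finset.sum_range_succ, ← ih, mul_add, mul_one, Finset.sum_range_succ,
      Finset.sum_range_succ, add_assoc]

/-- A random number arises from its bits, which are drawn one after the other. -/
theorem unif_succ (w : ℕ) : unif (w + 1) =
    (unif w).bind fun s => (PMF.uniformOfFintype Bool).map fun c => 2 * s + c.toNat := by
  refine PMF.ext_of_ex fun f => ?_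
  rw [ex_unif, ex_bind, ex_unif, pow_succ', pow_succ', sum_range_two_mul, ENNReal.mul_inv, mul_comm,
    ← mul_assoc, mul_comm, mul_comm (∑ i ∈ Finset.range _, _), Finset.mul_sum]
  · congr 1
    exact Finset.sum_congr rfl fun i _ => by simp [ex_bool]
  · simp
  · simp

theorem unif_zero : unif 0 = PMF.pure 0 := PMF.ext_of_ex fun f => by simp [ex_unif]

/-- The program that draws a number from `unif w`. -/
def drawNum : ℕ → Prog RandOp
  | 0 => .const 0
  | w + 1 => .seq (.pair (drawNum w) (.op .flip))
      (.seq (.pair (.seq (.pair .fst .fst) .add) .snd) .add)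

/-- The program that draws a tape. -/
def drawTape (w : ℕ) : ℕ → Prog RandOp
  | 0 => .const 0
  | n + 1 => .pair (drawNum w) (drawTape w n)

theorem randSize_drawNum (w : ℕ) : randSize (drawNum w) ≤ 20 * w + 2 := by
  induction w with
  | zero => simp [drawNum, randSize, Prog.size]
  | succ w ih =>
    simp only [drawNum, randSize, Prog.size] at ih ⊢
    omega

theorem randSize_drawTape (w n : ℕ) : randSize (drawTape w n) ≤ (20 * w + 3) * n + 2 := by
  induction n with
  | zero => simp [drawTape, randSize, Prog.size]
  | succ n ih =>
    have := randSize_drawNum w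
    simp only [drawTape, randSize, Prog.size] at this ih ⊢
    rw [Nat.mul_succ]
    omega

theorem law_drawNum (w : ℕ) (v : Val) :
    ((drawNum w).run v).Law ((unif w).map .num) (20 * w + 1) := by
  induction w with
  | zero =>
    rw [unif_zero, PMF.pure_map]
    exact (Prog.Runs.const).law
  | succ w ih =>
    let g : Comb := ((Comb.fst.pair Comb.fst).seq Comb.add).pair Comb.snd |>.seq Comb.add
    have h := Prog.law_seq (Prog.law_pair ih (Prog.law_flip (v := v)))
      (g := g.prog) (κ := fun x => PMF.pure (g.fn x)) (T' := 16) fun x _ =>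
        (g.ok x).law.mono (by simp [g])
    refine ((congrArg (fun μ => Timed.Law _ μ _) ?_).mp h).mono (T' := 20 * (w + 1) + 1) (by omega)
    refine PMF.ext_of_ex fun f => ?_
    rw [unif_succ]
    simp only [ex_map, ex_bind, ex_pure]
    congr 1
    ext s
    congr 1
    ext c
    simp [g, Val.ofBool, two_mul]

theorem law_drawTape (w n : ℕ) (v : Val) :
    ((drawTape w n).run v).Law ((tapes w n).map encTape) ((20 * w + 2) * n + 1) := by
  induction n with
  | zero =>
    rw [tapes, PMF.pure_map]
    exact (Prog.Runs.const).law
  | succ n ih =>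
    have h := Prog.law_pair (law_drawNum w v) ih
    refine ((congrArg (fun μ => Timed.Law _ μ _) ?_).mp h).mono (by rw [Nat.mul_succ]; omega)
    refine PMF.ext_of_ex fun f => ?_
    simp [tapes, encTape]

/-- First draw, then apply a deterministic program to what was drawn and to the input. -/
theorem law_draw_comb {draw : Prog RandOp} {v : Val} {μ : PMF Val} {T T' : ℕ} (c : Comb)
    (h : (draw.run v).Law μ T) (hc : ∀ d ∈ μ.support, c.cost (.pair d v) ≤ T') :
    ((Prog.seq (.pair draw .skip) c.prog).run v).Law (μ.map fun d => c.fn (.pair d v))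
      (T + T' + 3) := by
  have h1 := Prog.law_seq (Prog.law_pair h (Prog.Runs.skip (v := v)).law) (g := c.prog)
    (κ := fun x => PMF.pure (c.fn x)) (T' := T') fun x hx => by
      rw [PMF.mem_support_bind_iff] at hx
      obtain ⟨d, hd, hx⟩ := hx
      rw [PMF.pure_map, PMF.mem_support_pure_iff] at hx
      subst hx
      exact (c.ok _).law.mono (hc d hd)
  refine ((congrArg (fun μ => Timed.Law _ μ _) ?_).mp h1).mono (by omega)
  refine PMF.ext_of_ex fun f => ?_
  simp

theorem randSize_draw_comb (draw : Prog RandOp) (c : Comb) :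
    randSize (.seq (.pair draw .skip) c.prog) = randSize draw + c.size + 3 := by
  simp only [randSize, Prog.size, Comb.size]
  omega


/-! ### Majority votes and private amplification -/

/-- By how much the occurrences of `x` outnumber the other elements of the list; `0` if they do
not. -/
def gap (x : ℕ) (l : List ℕ) : ℕ := l.count x - (l.length - l.count x)

/-- The majority element of a list and its gap; the gap is `0` if there is no majority. -/
def vote (l : List ℕ) : ℕ × ℕ :=
  l.foldl (fun s x => if s.2 < gap x l then (x, gap x l) else s) (0, 0)

theorem count_add_count_le {x y : ℕ} (h : x ≠ y) (l : List ℕ) :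
    l.count x + l.count y ≤ l.length := by
  induction l with
  | nil => simp
  | cons z l ih =>
    simp only [List.count_cons, List.length_cons, beq_iff_eq]
    split_ifs <;> omega

theorem gap_eq_zero_of_ne {x y : ℕ} {l : List ℕ} (h : 0 < gap x l) (hxy : y ≠ x) :
    gap y l = 0 := by
  have := count_add_count_le hxy l
  unfold gap at *
  omega

theorem mem_of_gap_pos {x : ℕ} {l : List ℕ} (h : 0 < gap x l) : x ∈ l := by
  rw [← List.count_pos_iff]
  unfold gap at h
  omega

theorem vote_of_gap_pos {x : ℕ} {l : List ℕ} (h : 0 < gap x l) : vote l = (x, gap x l) := by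
  have hx := mem_of_gap_pos h
  have key : ∀ (l' : List ℕ) (s : ℕ × ℕ), (s = (x, gap x l) ∨ s = (0, 0) ∧ x ∈ l') →
      l'.foldl (fun s x => if s.2 < gap x l then (x, gap x l) else s) s = (x, gap x l) := by
    intro l'
    induction l' with
    | nil =>
      rintro s (hs | hs)
      · exact hs
      · simp at hs
    | cons y l' ih =>
      intro s hs
      rw [List.foldl_cons]
      by_cases hy : y = x
      · subst hy
        refine ih _ (Or.inl ?_)
        rcases hs with rfl | ⟨rfl, -⟩
        · simp
        · simp [h]
      · rw [gap_eq_zero_of_ne h hy, if_neg (Nat.not_lt_zero _)]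
        refine ih _ (hs.imp_right fun hs => ⟨hs.1, ?_⟩)
        exact (List.mem_cons.1 hs.2).resolve_left (Ne.symm hy)
  exact key l (0, 0) (Or.inr ⟨rfl, hx⟩)

theorem vote_of_gap_eq_zero {l : List ℕ} (h : ∀ x, gap x l = 0) : vote l = (0, 0) := by
  have key : ∀ l' : List ℕ,
      l'.foldl (fun s x => if s.2 < gap x l then (x, gap x l) else s) (0, 0) = (0, 0) := by
    intro l'
    induction l' with
    | nil => rfl
    | cons y l' ih => rw [List.foldl_cons, h, if_neg (Nat.not_lt_zero _), ih]
  exact key l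

theorem vote_cases (l : List ℕ) :
    vote l = (0, 0) ∨ 0 < gap (vote l).1 l ∧ (vote l).2 = gap (vote l).1 l := by
  by_cases h : ∀ x, gap x l = 0
  · exact Or.inl (vote_of_gap_eq_zero h)
  · push Not at h
    obtain ⟨x, hx⟩ := h
    rw [vote_of_gap_pos (Nat.pos_of_ne_zero hx)]
    exact Or.inr ⟨Nat.pos_of_ne_zero hx, rfl⟩

/-- One of the lists arises from the other by the removal of one element, up to the order. -/
def Adjacent (l l' : List ℕ) : Prop := ∃ y, l.Perm (y :: l') ∨ l'.Perm (y :: l)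

theorem Adjacent.symm {l l' : List ℕ} (h : Adjacent l l') : Adjacent l' l := by
  obtain ⟨y, h⟩ := h
  exact ⟨y, h.symm⟩

theorem Adjacent.gap_le {l l' : List ℕ} (h : Adjacent l l') (x : ℕ) : gap x l ≤ gap x l' + 1 := by
  have h3 := l'.count_le_length (a := x)
  have h4 := l.count_le_length (a := x)
  unfold gap
  obtain ⟨y, h | h⟩ := h <;>
  · have h1 := h.length_eq
    have h2 := h.count_eq x
    simp only [List.count_cons, List.length_cons] at h1 h2
    split_ifs at h2 <;> omega

/-- The majority element does not jump, since its gap changes by at most one. -/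
theorem Adjacent.gap_eq_zero {l l' : List ℕ} (h : Adjacent l l') {x y : ℕ} (hx : 0 < gap x l)
    (hxy : y ≠ x) : gap y l' = 0 := by
  have h3 := count_add_count_le hxy l
  have h4 := count_add_count_le hxy l'
  unfold gap at *
  obtain ⟨z, h | h⟩ := h <;>
  · have h1 := h.length_eq
    have h2 := h.count_eq x
    have h5 := h.count_eq y
    simp only [List.count_cons, List.length_cons] at h1 h2 h5
    split_ifs at h2 h5 <;> omega

/-- A function that does not depend on the element if the gap is `0` cannot tell the majority element
from any other candidate `x` without competitor. -/
theorem apply_vote {β : Type*} {f : ℕ → ℕ → β} (hf : ∀ x y, f x 0 = f y 0) {l : List ℕ} {x : ℕ}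
    (h : ∀ y ≠ x, gap y l = 0) : f (vote l).1 (vote l).2 = f x (gap x l) := by
  by_cases hx : 0 < gap x l
  · rw [vote_of_gap_pos hx]
  · have hx' : gap x l = 0 := by omega
    rw [vote_of_gap_eq_zero fun y => ?_, hx']
    · exact hf _ _
    · by_cases hy : y = x
      · rw [hy, hx']
      · exact h y hy

/-- Adjacent lists have the same majority element, and gaps that differ by at most one; the majority
element is immaterial if the gap is `0`. -/
theorem Adjacent.exists_vote_eq {β : Type*} {f : ℕ → ℕ → β} (hf : ∀ x y, f x 0 = f y 0)
    {l l' : List ℕ} (h : Adjacent l l') : ∃ x g g', (x = 0 ∨ x ∈ l ∨ x ∈ l') ∧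
      f (vote l).1 (vote l).2 = f x g ∧ f (vote l').1 (vote l').2 = f x g' ∧
      g ≤ g' + 1 ∧ g' ≤ g + 1 := by
  obtain ⟨x, hmem, hx, hx'⟩ : ∃ x, (x = 0 ∨ x ∈ l ∨ x ∈ l') ∧ (∀ y ≠ x, gap y l = 0) ∧
      ∀ y ≠ x, gap y l' = 0 := by
    by_cases h1 : ∃ x, 0 < gap x l
    · obtain ⟨x, hx⟩ := h1
      exact ⟨x, Or.inr (Or.inl (mem_of_gap_pos hx)), fun y hy => gap_eq_zero_of_ne hx hy, fun y hy => h.gap_eq_zero hx hy⟩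
    · push Not at h1
      by_cases h2 : ∃ x, 0 < gap x l'
      · obtain ⟨x, hx⟩ := h2
        exact ⟨x, Or.inr (Or.inr (mem_of_gap_pos hx)), fun y hy => h.symm.gap_eq_zero hx hy, fun y hy => gap_eq_zero_of_ne hx hy⟩
      · push Not at h2
        exact ⟨0, Or.inl rfl, fun y _ => Nat.le_zero.1 (h1 y), fun y _ => Nat.le_zero.1 (h2 y)⟩
  exact ⟨x, _, _, hmem, apply_vote hf hx, apply_vote hf hx', h.gap_le x, h.symm.gap_le x⟩

/-- The parameters of the mechanism that releases a majority element with gap `g` with probability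
`amp g / M`, and a uniform element of a set with `2 ^ w` elements otherwise.  From one gap to the
next, probabilities change by a factor of at most `1 + 1 / E` and an additive term of order `d / M`;
`1 / N` is a lower bound for the probability that the uniform choice hits a given element, and any
`N > M` stands for the bound `0`. -/
structure AmpParams where
  M : ℕ
  N : ℕ
  E : ℕ
  d : ℕ
  w : ℕ

/-- The increment from `amp g` to `amp (g + 1)`.  It is as large as privacy admits: the two terms of
the inner minimum are lower bounds, up to the factor `M`, for the probability that the majority
element is released and for the probability that this element is not chosen. -/
def AmpParams.next (P : AmpParams) (a : ℕ) : ℕ :=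
  a + min (P.M - a) (min (a + (P.M - a) / P.N) (P.M - a) / (P.E + 1) + P.d)

/-- The numerator of the release probability: the recursion of `next`, started at `0`. -/
def AmpParams.amp (P : AmpParams) (g : ℕ) : ℕ := P.next^[g] 0

namespace AmpParams

variable (P : AmpParams)

theorem amp_zero : P.amp 0 = 0 := rfl

theorem amp_succ (g : ℕ) : P.amp (g + 1) = P.next (P.amp g) :=
  Function.iterate_succ_apply' _ _ _

theorem next_le {a : ℕ} (h : a ≤ P.M) : P.next a ≤ P.M := by
  unfold next
  omega

theorem amp_le (g : ℕ) : P.amp g ≤ P.M := by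
  induction g with
  | zero => exact Nat.zero_le _
  | succ g ih => rw [amp_succ]; exact P.next_le ih

theorem amp_le_amp {g g' : ℕ} (h : g ≤ g') : P.amp g ≤ P.amp g' := by
  induction h with
  | refl => exact le_rfl
  | step _ ih => exact ih.trans (by rw [Nat.succ_eq_add_one, amp_succ]; exact Nat.le_add_right _ _)

/-- The weight of an event under the mechanism: `i` is `1` if the event contains the majority
element, and the uniform choice hits the event in `u` of `2 ^ w` cases. -/
def weight (i u g : ℕ) : ℕ := P.amp g * i * 2 ^ P.w + (P.M - P.amp g) * u

/-- Privacy in integer arithmetic: `E` times the weight of an event at one gap is at most `E + 1` times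
its weight at a neighbouring gap, up to the additive term. -/
theorem weight_succ_le {i u g : ℕ} (hi : i ≤ 1) (hu : u ≤ 2 ^ P.w)
    (hN : P.M < P.N ∨ (i = 1 → 2 ^ P.w ≤ P.N * u)) :
    P.E * P.weight i u (g + 1) ≤ (P.E + 1) * P.weight i u g + (P.E + 1) * P.d * 2 ^ P.w ∧
    P.E * P.weight i u g ≤ (P.E + 1) * P.weight i u (g + 1) + (P.E + 1) * P.d * 2 ^ P.w := by
  have ha := P.amp_le g
  simp only [weight, amp_succ]
  unfold next
  generalize P.amp g = a at *
  obtain ⟨c, hc⟩ : ∃ c, P.M - a = c := ⟨_, rfl⟩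
  have hM : P.M < P.N → c / P.N = 0 := fun h => Nat.div_eq_of_lt (by omega)
  rw [hc]
  have hyx := Nat.mul_div_le (min (a + c / P.N) c) (P.E + 1)
  have hxc : min (a + c / P.N) c ≤ c := min_le_right _ _
  have hxa : min (a + c / P.N) c ≤ a + c / P.N := min_le_left _ _
  generalize min (a + c / P.N) c = x at *
  generalize x / (P.E + 1) = y at *
  have hδc : min c (y + P.d) ≤ c := min_le_left _ _
  have hδy : min c (y + P.d) ≤ y + P.d := min_le_right _ _
  generalize min c (y + P.d) = δ at *
  rw [show P.M - (a + δ) = c - δ by omega]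
  obtain ⟨c', rfl⟩ : ∃ c', c = δ + c' := ⟨c - δ, by omega⟩
  rw [Nat.add_sub_cancel_left]
  generalize 2 ^ P.w = D at *
  have hδE : (P.E + 1) * δ ≤ x + (P.E + 1) * P.d := by
    have := Nat.mul_le_mul_left (P.E + 1) hδy
    rw [mul_add] at this
    omega
  have hδu : δ * u ≤ δ * D := Nat.mul_le_mul_left _ hu
  have hi' : i = 0 ∨ i = 1 := by omega
  rcases hi' with rfl | rfl
  · simp only [mul_zero, zero_mul, zero_add]
    constructor
    · have h1 : P.E * (c' * u) ≤ (P.E + 1) * ((δ + c') * u) :=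
        Nat.mul_le_mul (by omega) (Nat.mul_le_mul_right _ (by omega))
      exact h1.trans (Nat.le_add_right _ _)
    · -- the weight drops by `δ * u`
      have h1 : (P.E + 1) * δ * u ≤ (x + (P.E + 1) * P.d) * u := Nat.mul_le_mul_right _ hδE
      have h2 : x * u ≤ (δ + c') * u := Nat.mul_le_mul_right _ hxc
      have h3 : (P.E + 1) * P.d * u ≤ (P.E + 1) * P.d * D := Nat.mul_le_mul_left _ hu
      linarith
  · simp only [mul_one]
    constructor
    · -- the weight grows at most by `δ * D`
      have h1 : (P.E + 1) * δ * D ≤ (x + (P.E + 1) * P.d) * D := Nat.mul_le_mul_right _ hδE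
      have h2 : x * D ≤ a * D + (δ + c') * u := by
        have h3 : x * D ≤ (a + (δ + c') / P.N) * D := Nat.mul_le_mul_right _ hxa
        rcases hN with hN | hN
        · rw [hM hN] at h3
          linarith [Nat.zero_le ((δ + c') * u)]
        · have h4 : (δ + c') / P.N * D ≤ (δ + c') / P.N * (P.N * u) :=
            Nat.mul_le_mul_left _ (hN rfl)
          have h5 : (δ + c') / P.N * P.N * u ≤ (δ + c') * u :=
            Nat.mul_le_mul_right _ (Nat.div_mul_le_self _ _)
          linarith
      have h6 : P.E * (δ * D) ≤ (P.E + 1) * (δ * D) := Nat.mul_le_mul_right _ (by omega)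
      have h7 : 0 ≤ P.E * (δ * u) := Nat.zero_le _
      linarith
    · have h2 : P.E * (δ * u) ≤ P.E * (δ * D) := Nat.mul_le_mul_left _ hδu
      have h3 : 0 ≤ (P.E + 1) * P.d * D := Nat.zero_le _
      have h4 : 0 ≤ a * D + δ * D + c' * u := Nat.zero_le _
      linarith

end AmpParams


/-! ### Privacy and accuracy of the amplification -/

theorem two_mul_pow_le {n F : ℕ} (h : n ≤ F) (hF : 0 < F) : 2 * n ^ F ≤ (n + 1) ^ F := by
  obtain rfl | hn := Nat.eq_zero_or_pos n
  · simp [hF.ne']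
  have hn' : (0 : ℝ) < n := by exact_mod_cast hn
  have h1 := one_add_mul_le_pow (a := 1 / (n : ℝ)) (by have : 0 < 1 / (n : ℝ) := by positivity
                                                       linarith) F
  have h2 : 1 ≤ (F : ℝ) * (1 / n) := by
    rw [mul_one_div, one_le_div hn']
    exact_mod_cast h
  have h3 : (2 : ℝ) * n ^ F ≤ (1 + 1 / n) ^ F * n ^ F := by gcongr; linarith
  rw [← mul_pow, add_mul, one_div_mul_cancel hn'.ne', one_mul] at h3
  exact_mod_cast h3

theorem two_pow_mul_pow_le {n F : ℕ} (h : n ≤ F) (hF : 0 < F) (k : ℕ) :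
    2 ^ k * n ^ (F * k) ≤ (n + 1) ^ (F * k) := by
  rw [pow_mul, pow_mul, ← mul_pow]
  exact Nat.pow_le_pow_left (two_mul_pow_le h hF) k

namespace AmpParams

variable (P : AmpParams)

/-- The release probability `amp g / M` first doubles every `F` steps, until it reaches about `1/2`,
and then its distance to `1` is halved every `F` steps, down to the resolution `θ / M`. -/
theorem sub_amp_le {F c θ k₁ k₂ g : ℕ} (hF : 0 < F) (hc : P.M ≤ 2 ^ k₁ * c)
    (h : ∀ a, a ≤ P.M → θ ≤ P.M - a →
      min (a + c) (P.M - a) ≤ F * (P.next a - a)) (hg : F * (k₁ + k₂) ≤ g) :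
    P.M - P.amp g < θ ∨ 2 ^ k₂ * (P.M - P.amp g) ≤ P.M := by
  obtain ⟨n, rfl⟩ : ∃ n, F = n + 1 := ⟨F - 1, by omega⟩
  set F := n + 1 with hFn
  have hnext : ∀ a, a ≤ P.next a := fun a => Nat.le_add_right _ _
  -- as long as `amp` is below one half, `amp + c` grows by the factor `1 + 1 / F` in every step
  have h1 : ∀ j, P.M - P.amp j < θ ∨ P.M ≤ 2 * P.amp j + c ∨
      c * (F + 1) ^ j ≤ (P.amp j + c) * F ^ j := by
    intro j
    induction j with
    | zero => simp [amp_zero]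
    | succ j ih =>
      have ha := P.amp_le j
      have ha' := P.amp_le_amp (Nat.le_succ j)
      rw [Nat.succ_eq_add_one] at ha'
      rcases ih with ih | ih | ih
      · left; omega
      · right; left; omega
      · by_cases hθ' : θ ≤ P.M - P.amp j
        · by_cases hM : P.M ≤ 2 * P.amp j + c
          · right; left; omega
          · right; right
            have h2 := h _ ha hθ'
            rw [amp_succ] at ha' ⊢
            rw [min_eq_left (by omega)] at h2
            obtain ⟨Δ, hΔ⟩ : ∃ Δ, P.next (P.amp j) = P.amp j + Δ :=
              ⟨P.next (P.amp j) - P.amp j, by omega⟩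
            rw [hΔ, Nat.add_sub_cancel_left] at h2
            rw [hΔ]
            have h3 := Nat.mul_le_mul_right (F ^ j) h2
            have h4 := Nat.mul_le_mul_right (F + 1) ih
            rw [pow_succ, pow_succ]
            linarith
        · left; omega
  have h2 : P.M - P.amp (F * k₁) < θ ∨ P.M ≤ 2 * P.amp (F * k₁) + c := by
    rcases h1 (F * k₁) with h | h | h
    · exact Or.inl h
    · exact Or.inr h
    · right
      have h3 := two_pow_mul_pow_le (le_refl F) hF k₁
      have h4 : 2 ^ k₁ * c * F ^ (F * k₁) ≤ (P.amp (F * k₁) + c) * F ^ (F * k₁) := by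
        have := Nat.mul_le_mul_left c h3
        linarith
      have h5 := Nat.le_of_mul_le_mul_right h4 (by positivity)
      omega
  -- afterwards the distance to `M` shrinks by the factor `1 - 1 / F` in every step
  have h3 : ∀ j, P.M - P.amp (F * k₁ + j) < θ ∨ P.M ≤ 2 * P.amp (F * k₁ + j) + c ∧
      F ^ j * (P.M - P.amp (F * k₁ + j)) ≤ n ^ j * P.M := by
    intro j
    induction j with
    | zero =>
      refine h2.imp_right fun h => ⟨h, by simp⟩
    | succ j ih =>
      have ha := P.amp_le (F * k₁ + j)
      have ha' := P.amp_le_amp (Nat.le_succ (F * k₁ + j))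
      rw [Nat.succ_eq_add_one] at ha'
      rw [← add_assoc]
      rcases ih with ih | ⟨ih, ih'⟩
      · left; omega
      · by_cases hθ' : θ ≤ P.M - P.amp (F * k₁ + j)
        · right
          refine ⟨by omega, ?_⟩
          have h2 := h _ ha hθ'
          have hM := P.next_le ha
          rw [amp_succ] at ha' ⊢
          rw [min_eq_right (by omega)] at h2
          generalize P.next (P.amp (F * k₁ + j)) = a' at *
          generalize P.amp (F * k₁ + j) = a at *
          obtain ⟨Δ, rfl⟩ : ∃ Δ, a' = a + Δ := ⟨a' - a, by omega⟩
          obtain ⟨r, hr⟩ : ∃ r, P.M - a = Δ + r := ⟨P.M - a - Δ, by omega⟩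
          rw [Nat.add_sub_cancel_left] at h2
          rw [hr] at h2 ih'
          rw [show P.M - (a + Δ) = r by omega]
          have h3 : F * r ≤ n * (Δ + r) := by rw [hFn] at h2 ⊢; linarith
          have h4 := Nat.mul_le_mul_left (F ^ j) h3
          have h5 := Nat.mul_le_mul_left n ih'
          rw [pow_succ, pow_succ]
          linarith
        · left; omega
  have hmono := P.amp_le_amp hg
  rw [mul_add] at hmono
  rcases h3 (F * k₂) with h | ⟨-, h⟩
  · left; omega
  · right
    refine le_trans (Nat.mul_le_mul_left _ (Nat.sub_le_sub_left hmono _)) ?_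
    have h4 := two_pow_mul_pow_le (show n ≤ F by omega) hF k₂
    rw [← hFn] at h4
    have h5 := Nat.mul_le_mul_right P.M h4
    refine le_of_mul_le_mul_left ?_ (show 0 < F ^ (F * k₂) by positivity)
    have h6 := Nat.mul_le_mul_left (2 ^ k₂) h
    linarith

end AmpParams

theorem sum_range_ite {a M : ℕ} (h : a ≤ M) (A B : ℝ≥0∞) :
    ∑ z ∈ Finset.range M, (if z < a then A else B) = a * A + (M - a : ℕ) * B := by
  obtain ⟨c, rfl⟩ : ∃ c, M = a + c := ⟨M - a, by omega⟩
  rw [Finset.sum_range_add, Finset.sum_congr rfl fun z hz => if_pos (Finset.mem_range.1 hz)]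
  simp

/-- Release the majority element with probability `amp g / M`, where `M = 2 ^ L`, and a uniform
element otherwise. -/
noncomputable def AmpParams.mech (P : AmpParams) (L x g : ℕ) : PMF Val :=
  (unif L).bind fun z => (unif P.w).map fun d => if z < P.amp g then .num x else .num d

namespace AmpParams

variable (P : AmpParams) {L : ℕ}

theorem ex_mech (hL : P.M = 2 ^ L) (x g : ℕ) (f : Val → ℝ≥0∞) :
    ex (P.mech L x g) f = (P.M : ℝ≥0∞)⁻¹ *
      (P.amp g * f (.num x) + (P.M - P.amp g : ℕ) * ex (unif P.w) fun d => f (.num d)) := by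
  rw [mech, ex_bind, ex_unif, ← hL, ← sum_range_ite (P.amp_le g)]
  congr 1
  · rw [hL]; simp
  · refine Finset.sum_congr rfl fun z _ => ?_
    rw [ex_map]
    split_ifs <;> simp

theorem mech_zero (hL : P.M = 2 ^ L) (x y : ℕ) : P.mech L x 0 = P.mech L y 0 :=
  PMF.ext_of_ex fun f => by simp [P.ex_mech hL, amp_zero]

/-- The probability of an event under the mechanism in terms of `weight`. -/
theorem exists_weight (hL : P.M = 2 ^ L) (x : ℕ) (O : Set Val) : ∃ i u : ℕ, i ≤ 1 ∧ u ≤ 2 ^ P.w ∧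
    (i = 1 → x < 2 ^ P.w → 1 ≤ u) ∧
    ∀ g, (P.mech L x g).toOuterMeasure O =
      ENNReal.ofReal (P.weight i u g / (P.M * 2 ^ P.w)) := by
  classical
  set s := (Finset.range (2 ^ P.w)).filter fun d => Val.num d ∈ O with hs
  refine ⟨if Val.num x ∈ O then 1 else 0, s.card, by split_ifs <;> simp, ?_, ?_, fun g => ?_⟩
  · exact (Finset.card_filter_le _ _).trans (by simp)
  · intro h1 h2
    rw [Nat.succ_le_iff, Finset.card_pos]
    refine ⟨x, ?_⟩
    have : Val.num x ∈ O := by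
      by_contra h
      simp [h] at h1
    simp [hs, h2, this]
  · rw [toOuterMeasure_eq_ex, P.ex_mech hL, ex_unif]
    have h1 : ∑ d ∈ Finset.range (2 ^ P.w), ind (Val.num d ∈ O) = (s.card : ℝ≥0∞) := by
      rw [hs, Finset.card_filter]
      push_cast
      exact Finset.sum_congr rfl fun d _ => by unfold ind; congr
    have h2 : ind (Val.num x ∈ O) = ((if Val.num x ∈ O then 1 else 0 : ℕ) : ℝ≥0∞) := by
      unfold ind; split_ifs <;> simp
    rw [h1, h2]
    generalize (if Val.num x ∈ O then 1 else 0 : ℕ) = i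
    have hM : (0 : ℝ) < P.M := by rw [hL]; positivity
    have hw : (0 : ℝ) < 2 ^ P.w := by positivity
    have e1 : ((2 : ℝ≥0∞) ^ P.w)⁻¹ = ENNReal.ofReal ((2 ^ P.w)⁻¹) := by
      rw [ENNReal.ofReal_inv_of_pos hw, ENNReal.ofReal_pow (by norm_num)]
      simp
    have e2 : (P.M : ℝ≥0∞)⁻¹ = ENNReal.ofReal ((P.M : ℝ)⁻¹) := by
      rw [ENNReal.ofReal_inv_of_pos hM]
      simp
    rw [e1, e2, ← ENNReal.ofReal_natCast (P.amp g), ← ENNReal.ofReal_natCast i,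
      ← ENNReal.ofReal_natCast (P.M - P.amp g), ← ENNReal.ofReal_natCast s.card,
      ← ENNReal.ofReal_mul (by positivity), ← ENNReal.ofReal_mul (by positivity),
      ← ENNReal.ofReal_mul (by positivity), ← ENNReal.ofReal_add (by positivity) (by positivity),
      ← ENNReal.ofReal_mul (by positivity)]
    congr 1
    unfold weight
    push_cast
    field_simp

/-- Privacy of the amplification. -/
theorem close_mech (hL : P.M = 2 ^ L) {ε δ : ℝ} (hδ : 0 ≤ δ) (hE : 1 ≤ P.E) (hε : 1 ≤ ε * P.E)
    (hd : 2 * P.d ≤ δ * P.M) {x : ℕ} (hN : P.M < P.N ∨ 2 ^ P.w ≤ P.N ∧ x < 2 ^ P.w) {g g' : ℕ}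
    (h1 : g ≤ g' + 1) (h2 : g' ≤ g + 1) : Close ε δ (P.mech L x g) (P.mech L x g') := by
  intro O
  obtain ⟨i, u, hi, hu, hiu, h⟩ := P.exists_weight hL x O
  have hstep := fun g => P.weight_succ_le (g := g) hi hu (hN.imp_right fun h hi1 =>
    h.1.trans (Nat.le_mul_of_pos_right _ (hiu hi1 h.2)))
  have hkey : P.E * P.weight i u g ≤ (P.E + 1) * P.weight i u g' + (P.E + 1) * P.d * 2 ^ P.w := by
    obtain hgg | hgg | hgg : g = g' ∨ g = g' + 1 ∨ g' = g + 1 := by omega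
    · rw [hgg]
      exact (Nat.mul_le_mul_right _ (Nat.le_succ _)).trans (Nat.le_add_right _ _)
    · rw [hgg]; exact (hstep g').1
    · rw [hgg]; exact (hstep g).2
  rw [h g, h g', ← ENNReal.ofReal_mul (Real.exp_pos _).le,
    ← ENNReal.ofReal_add (by positivity) hδ]
  refine ENNReal.ofReal_le_ofReal ?_
  generalize P.weight i u g = F at hkey
  generalize P.weight i u g' = F' at hkey
  have hM : (0 : ℝ) < P.M := by rw [hL]; positivity
  have hw : (0 : ℝ) < 2 ^ P.w := by positivity
  have hE' : (1 : ℝ) ≤ P.E := by exact_mod_cast hE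
  have hkey' : (P.E : ℝ) * F ≤ (P.E + 1) * F' + (P.E + 1) * P.d * 2 ^ P.w := by exact_mod_cast hkey
  have h3 : (P.E + 1 : ℝ) ≤ Real.exp ε * P.E := by
    have := Real.add_one_le_exp ε
    nlinarith
  have h4 : (F : ℝ) ≤ Real.exp ε * F' + δ * (P.M * 2 ^ P.w) := by
    refine le_of_mul_le_mul_left ?_ (by linarith : (0 : ℝ) < P.E)
    have h5 : (P.E + 1 : ℝ) * F' ≤ Real.exp ε * P.E * F' := by gcongr
    have h6 : (P.E + 1 : ℝ) * P.d ≤ P.E * (δ * P.M) := by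
      have : (P.E + 1 : ℝ) * P.d ≤ (2 * P.E) * P.d := by gcongr; linarith
      nlinarith
    have h7 := mul_le_mul_of_nonneg_right h6 hw.le
    linarith
  rw [div_le_iff₀ (by positivity), add_mul, mul_div_assoc', div_mul_cancel₀ _ (by positivity)]
  exact h4

/-- The probability that the majority element is not released. -/
theorem ex_mech_le (hL : P.M = 2 ^ L) (x g : ℕ) (f : Val → ℝ≥0∞) (hf : ∀ v, f v ≤ 1)
    (hx : f (.num x) = 0) : ex (P.mech L x g) f ≤ (P.M - P.amp g : ℕ) * (P.M : ℝ≥0∞)⁻¹ := by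
  rw [P.ex_mech hL, hx, mul_zero, zero_add, mul_comm]
  gcongr
  calc _ ≤ ((P.M - P.amp g : ℕ) : ℝ≥0∞) * 1 := by
        gcongr
        exact (ex_mono fun d _ => hf _).trans (ex_const _ _).le
    _ = _ := mul_one _

end AmpParams


/-! ### The program of the central learners -/

namespace Comb

theorem cond_cost_le (c f g : Comb) (v : Val) :
    (cond c f g).cost v ≤ c.cost v + max (f.cost v) (g.cost v) + 1 := by
  rw [cond_cost]
  by_cases h : (c.fn v).isTrue = true
  · rw [if_pos h]; omega
  · rw [if_neg h]; omega

/-- Are two numbers equal? -/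
def eq : Comb := cond sub (const 0) (cond ((snd.pair fst).seq sub) (const 0) (const 1))

theorem eq_fn (x y : ℕ) : eq.fn (.pair (.num x) (.num y)) = .num (if x = y then 1 else 0) := by
  simp only [eq, cond_fn, sub_fn, Val.arith_pair_num, Val.isTrue_num, seq_fn, pair_fn, snd_fn,
    fst_fn, Val.fst_pair, Val.snd_pair, const_fn, decide_eq_true_eq]
  split_ifs <;> first | rfl | omega

theorem eq_cost_le (v : Val) : eq.cost v ≤ 15 := by
  have h1 := cond_cost_le sub (const 0) (cond ((snd.pair fst).seq sub) (const 0) (const 1)) v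
  have h2 := cond_cost_le ((snd.pair fst).seq sub) (const 0) (const 1) v
  rw [eq]
  simp only [seq_cost, pair_cost, const_cost, fst_cost, snd_cost, sub_cost] at h1 h2
  omega

/-- The smaller one of two numbers. -/
def min : Comb := (fst.pair sub).seq sub

theorem min_fn (x y : ℕ) : min.fn (.pair (.num x) (.num y)) = .num (Min.min x y) := by
  simp [min]
  omega

/-- One round of `gap`: on `(x, (y, (c, o)))`, one of the counters `c` and `o` is increased. -/
def gapStep : Comb :=
  cond ((fst.pair (snd.seq fst)).seq eq)
    ((((snd.seq (snd.seq fst)).pair (const 1)).seq add).pair (snd.seq (snd.seq snd)))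
    ((snd.seq (snd.seq fst)).pair (((snd.seq (snd.seq snd)).pair (const 1)).seq add))

/-- The gap of the number `x` in the list `l`, on input `(x, l)`. -/
def gap : Comb :=
  (fst.pair (snd.pair ((const 0).pair (const 0)))).seq ((fold gapStep).seq sub)

theorem gap_fn (x : ℕ) (l : List ℕ) :
    gap.fn (.pair (.num x) (.ofList (l.map .num))) = .num (UserDP.gap x l) := by
  have h := fold_fn_ofList gapStep (.num x) l .num (fun s : ℕ × ℕ => .pair (.num s.1) (.num s.2))
    (fun s y => if x = y then (s.1 + 1, s.2) else (s.1, s.2 + 1)) (fun y _ s => by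
      simp only [gapStep, cond_fn, seq_fn, pair_fn, fst_fn, snd_fn, Val.fst_pair, Val.snd_pair, eq_fn]
      split_ifs with h1 h2 h2 <;> simp_all) (0, 0)
  have h2 : ∀ (l : List ℕ) (s : ℕ × ℕ),
      l.foldl (fun s y => if x = y then (s.1 + 1, s.2) else (s.1, s.2 + 1)) s =
      (s.1 + l.count x, s.2 + (l.length - l.count x)) := by
    intro l
    induction l with
    | nil => simp
    | cons y l ih =>
      intro s
      have := l.count_le_length (a := x)
      rw [List.foldl_cons, ih, List.count_cons]
      by_cases hy : x = y
      · subst hy; simp; omega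
      · simp [hy, Ne.symm hy]; omega
  rw [h2] at h
  simp only [gap, seq_fn, pair_fn, fst_fn, snd_fn, const_fn, Val.fst_pair, Val.snd_pair]
  simp only [zero_add] at h
  rw [h]
  simp [UserDP.gap]

theorem gapStep_cost_le (v : Val) : gapStep.cost v ≤ 40 := by
  have := eq_cost_le (.pair v.fst v.snd.fst)
  refine (cond_cost_le _ _ _ _).trans ?_
  simp
  omega

theorem gap_cost_le (x : Val) (l : List Val) :
    gap.cost (.pair x (.ofList l)) ≤ l.length * 80 + 50 := by
  have h := fold_cost_le' gapStep x l (.pair (.num 0) (.num 0)) 40 fun _ _ _ => gapStep_cost_le _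
  simp only [gap, seq_cost, pair_cost, fst_cost, snd_cost, const_cost, sub_cost, pair_fn,
    fst_fn, snd_fn, const_fn, Val.fst_pair, Val.snd_pair]
  omega

/-- One round of `vote`: on `(l, (x, (h, g)))`, replace `(h, g)` by `x` and its gap, if this gap is
larger. -/
def voteStep : Comb :=
  (((snd.seq fst).pair fst).seq gap).pair snd |>.seq
    (cond ((fst.pair (snd.seq (snd.seq snd))).seq sub) ((snd.seq fst).pair fst) (snd.seq snd))

/-- The majority element of a list and its gap. -/
def vote : Comb := (id.pair (id.pair ((const 0).pair (const 0)))).seq (fold voteStep)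

theorem vote_fn (l : List ℕ) : vote.fn (.ofList (l.map .num)) =
    .pair (.num (UserDP.vote l).1) (.num (UserDP.vote l).2) := by
  have h := fold_fn_ofList voteStep (.ofList (l.map .num)) l .num
    (fun s : ℕ × ℕ => .pair (.num s.1) (.num s.2))
    (fun s x => if s.2 < UserDP.gap x l then (x, UserDP.gap x l) else s) (fun y _ s => by
      simp only [voteStep, cond_fn, seq_fn, pair_fn, fst_fn, snd_fn, Val.fst_pair, Val.snd_pair,
        gap_fn, sub_fn, Val.arith_pair_num, Val.isTrue_num, decide_eq_true_eq]
      split_ifs <;> first | rfl | omega) (0, 0)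
  exact h

theorem vote_cost_le (l : List Val) :
    vote.cost (.ofList l) ≤ l.length * (l.length * 80 + 120) + 50 := by
  have h := fold_cost_le' voteStep (.ofList l) l (.pair (.num 0) (.num 0)) (l.length * 80 + 80)
    fun x _ s => by
      have := gap_cost_le x l
      refine (Nat.add_le_add_right (Nat.add_le_add_left (cond_cost_le _ _ _ _) _) 1).trans ?_
      simp
      omega
  simp only [vote, seq_cost, pair_cost, id_cost, const_cost, pair_fn, id_fn, const_fn]
  rw [show l.length * 80 + 80 + 40 = l.length * 80 + 120 by omega] at h
  omega

/-- The function `AmpParams.next`, on input `(e, a)`; the first component is ignored. -/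
def ampStep (P : AmpParams) : Comb :=
  snd.seq ((id.pair (((const P.M).pair id).seq sub)).seq
    ((fst.pair ((snd.pair
      ((((((fst.pair ((snd.pair (const P.N)).seq div)).seq add).pair snd).seq min).pair
        (const (P.E + 1))).seq div |>.pair (const P.d) |>.seq add)).seq min)).seq add))

theorem ampStep_fn (P : AmpParams) (e : Val) (a : ℕ) :
    (ampStep P).fn (.pair e (.num a)) = .num (P.next a) := by
  simp [ampStep, min_fn, AmpParams.next]

theorem ampStep_cost_le (P : AmpParams) (v : Val) : (ampStep P).cost v ≤ 70 := by
  simp [ampStep, min]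

/-- The function `AmpParams.amp`. -/
def amp (P : AmpParams) : Comb := (id.pair (id.pair (const 0))).seq (iter (ampStep P))

theorem amp_fn (P : AmpParams) (g : ℕ) : (amp P).fn (.num g) = .num (P.amp g) := by
  have := iter_fn_typed (ampStep P) (.num g) g .num P.next (fun s => ampStep_fn P _ s) 0
  simp only [amp, seq_fn, pair_fn, id_fn, const_fn]
  exact this

theorem amp_cost_le (P : AmpParams) (g : ℕ) : (amp P).cost (.num g) ≤ g * 110 + 40 := by
  have h := iter_cost_le' (ampStep P) (.num g) g (.num 0) 70 fun s => ampStep_cost_le P _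
  simp only [amp, seq_cost, pair_cost, id_cost, const_cost, pair_fn, id_fn, const_fn]
  omega

/-- The list of the hypotheses of all users, in reversed order, on input `(tape, data)`. -/
def users (c : Comb) : Comb :=
  (fst.pair (snd.pair (const 0))).seq
    (fold (((fst.pair (snd.seq fst)).seq c).pair (snd.seq snd)))

theorem users_fn {U : Type*} (c : Comb) (e : Val) (enc : U → Val) (out : U → ℕ)
    (h : ∀ u, c.fn (.pair e (enc u)) = .num (out u)) (S : List U) :
    (users c).fn (.pair e (.ofList (S.map enc))) = .ofList ((S.map out).reverse.map .num) := by
  have h1 := fold_fn_ofList (((fst.pair (snd.seq fst)).seq c).pair (snd.seq snd)) e S enc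
    (fun l : List ℕ => .ofList (l.map .num)) (fun l u => out u :: l) (fun u _ l => by simp [h]) []
  simp only [users, seq_fn, pair_fn, fst_fn, snd_fn, const_fn, Val.fst_pair, Val.snd_pair]
  refine h1.trans ?_
  congr 2
  have : ∀ (S : List U) (l : List ℕ),
      S.foldl (fun l u => out u :: l) l = (S.map out).reverse ++ l := by
    intro S
    induction S with
    | nil => simp
    | cons u S ih => intro l; simp [ih]
  rw [this, List.append_nil]

theorem users_cost_le {U : Type*} (c : Comb) (e : Val) (enc : U → Val) (T : ℕ)
    (h : ∀ u, c.cost (.pair e (enc u)) ≤ T) (S : List U) :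
    (users c).cost (.pair e (.ofList (S.map enc))) ≤ S.length * (T + 60) + 50 := by
  have h1 := fold_cost_le' (((fst.pair (snd.seq fst)).seq c).pair (snd.seq snd)) e (S.map enc)
    (.num 0) (T + 20) fun x hx s => by
      obtain ⟨u, -, rfl⟩ := List.mem_map.1 hx
      have := h u
      simp
      omega
  simp only [users, seq_cost, pair_cost, fst_cost, snd_cost, const_cost, pair_fn,
    fst_fn, snd_fn, const_fn, Val.fst_pair, Val.snd_pair]
  rw [List.length_map, show T + 20 + 40 = T + 60 by omega] at h1
  omega

/-- On input `((tape, (z, d)), data)`: if `z` is smaller than `amp g`, where `g` is the gap of the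
majority element, then return the majority element, else return `d`. -/
def central (c : Comb) (P : AmpParams) : Comb :=
  ((((fst.seq fst).pair snd).seq (users c)).seq vote).pair (fst.seq snd) |>.seq
    (cond ((((fst.seq snd).seq (amp P)).pair (snd.seq fst)).seq sub) (fst.seq fst) (snd.seq snd))

theorem central_fn {U : Type*} (c : Comb) (P : AmpParams) (e : Val) (z d : ℕ) (enc : U → Val)
    (out : U → ℕ) (h : ∀ u, c.fn (.pair e (enc u)) = .num (out u)) (S : List U) :
    (central c P).fn (.pair (.pair e (.pair (.num z) (.num d))) (.ofList (S.map enc))) =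
      if z < P.amp (UserDP.vote (S.map out).reverse).2
        then .num (UserDP.vote (S.map out).reverse).1 else .num d := by
  simp only [central, cond_fn, seq_fn, pair_fn, fst_fn, snd_fn, Val.fst_pair, Val.snd_pair,
    users_fn c e enc out h, vote_fn, amp_fn, sub_fn, Val.arith_pair_num, Val.isTrue_num,
    decide_eq_true_eq]
  split_ifs <;> first | rfl | omega

theorem vote_snd_le (l : List ℕ) : (UserDP.vote l).2 ≤ l.length := by
  rcases vote_cases l with h | ⟨-, h⟩
  · rw [h]; exact Nat.zero_le _
  · rw [h]
    have := l.count_le_length (a := (UserDP.vote l).1)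
    unfold UserDP.gap
    omega

theorem central_cost_le {U : Type*} (c : Comb) (P : AmpParams) (e : Val) (z d : ℕ) (enc : U → Val)
    (out : U → ℕ) (h : ∀ u, c.fn (.pair e (enc u)) = .num (out u)) (T : ℕ)
    (hT : ∀ u, c.cost (.pair e (enc u)) ≤ T) (S : List U) :
    (central c P).cost (.pair (.pair e (.pair (.num z) (.num d))) (.ofList (S.map enc))) ≤
      S.length * (T + S.length * 80 + 300) + 200 := by
  have h1 := users_cost_le c e enc T hT S
  have h2 := vote_cost_le ((S.map out).reverse.map .num)
  have h3 := vote_snd_le (S.map out).reverse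
  have h4 := amp_cost_le P (UserDP.vote (S.map out).reverse).2
  simp only [List.length_map, List.length_reverse] at h2 h3
  refine (Nat.add_le_add_right (Nat.add_le_add_left (cond_cost_le _ _ _ _) _) 1).trans ?_
  simp only [seq_cost, pair_cost, fst_cost, snd_cost, sub_cost, seq_fn, pair_fn,
    fst_fn, snd_fn, Val.fst_pair, Val.snd_pair, users_fn c e enc out h, vote_fn]
  generalize S.length = N at *
  simp only [mul_add] at *
  omega

theorem central_size_le (c : Comb) (P : AmpParams) : (central c P).size ≤
    c.size + P.M.size + P.N.size + (P.E + 1).size + P.d.size + 500 := by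
  simp [central, users, vote, voteStep, gap, gapStep, eq, amp, ampStep, min]
  omega

end Comb


/-! ### Central learners from stable learners -/

section Central

/-- How many entries of a tuple differ from `x`. -/
def numWrong {n : ℕ} (f : Fin n → ℕ) (x : ℕ) : ℕ := (Finset.univ.filter fun i => f i ≠ x).card

theorem count_ofFn {n : ℕ} (f : Fin n → ℕ) (x : ℕ) :
    (List.ofFn f).count x + numWrong f x = n := by
  induction n with
  | zero => simp [numWrong]
  | succ n ih =>
    have h := ih fun i => f i.succ
    unfold numWrong at h ⊢
    rw [List.ofFn_succ, List.count_cons, Fin.card_filter_univ_succ]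
    simp only [beq_iff_eq]
    by_cases h0 : f 0 = x
    · simp only [h0, if_true, ne_eq, not_true_eq_false, if_false] at h ⊢
      omega
    · simp only [h0, if_false, ne_eq, not_false_eq_true, if_true] at h ⊢
      omega

theorem numWrong_eq_sum {n : ℕ} (f : Fin n → ℕ) (x : ℕ) :
    (numWrong f x : ℝ≥0∞) = ∑ i, ind (f i ≠ x) := by
  classical
  rw [numWrong, Finset.card_filter]
  push_cast
  exact Finset.sum_congr rfl fun i _ => by unfold ind; congr

/-- By Markov's inequality, it suffices to consider the case that at least nine tenths of the users
compute the reference hypothesis. -/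
theorem ex_ex_le_of_numWrong {U R : Type*} [Fintype U] {n : ℕ} (hn : 0 < n) (p : PMF U) (μ : PMF R)
    (out : R → U → ℕ) (ref : R → ℕ) {B θ : ℝ≥0∞}
    (h : ex p (fun u => ex μ fun r => ind (out r u ≠ ref r)) ≤ B)
    (F : R → (Fin n → U) → ℝ≥0∞) (hF1 : ∀ r S, F r S ≤ 1)
    (hF : ∀ r ∈ μ.support, ∀ S, 10 * numWrong (fun i => out r (S i)) (ref r) ≤ n → F r S ≤ θ) :
    ex (iid n p) (fun S => ex μ fun r => F r S) ≤ 10 * B + θ := by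
  have hn' : (n : ℝ≥0∞) ≠ 0 := by exact_mod_cast hn.ne'
  have h1 : ∀ r ∈ μ.support, ∀ S, F r S ≤
      10 * (n : ℝ≥0∞)⁻¹ * (numWrong (fun i => out r (S i)) (ref r) : ℝ≥0∞) + θ := by
    intro r hr S
    by_cases hw : 10 * numWrong (fun i => out r (S i)) (ref r) ≤ n
    · exact (hF r hr S hw).trans le_add_self
    · refine (hF1 r S).trans (le_add_right ?_)
      push Not at hw
      have h2 : (n : ℝ≥0∞) ≤ 10 * (numWrong (fun i => out r (S i)) (ref r) : ℝ≥0∞) := by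
        exact_mod_cast hw.le
      calc (1 : ℝ≥0∞) = (n : ℝ≥0∞)⁻¹ * n := (ENNReal.inv_mul_cancel hn' (by simp)).symm
        _ ≤ (n : ℝ≥0∞)⁻¹ * (10 * (numWrong (fun i => out r (S i)) (ref r) : ℝ≥0∞)) := by gcongr
        _ = _ := by ring
  calc ex (iid n p) (fun S => ex μ fun r => F r S)
      ≤ ex (iid n p) fun S => ex μ fun r =>
        10 * (n : ℝ≥0∞)⁻¹ * (numWrong (fun i => out r (S i)) (ref r) : ℝ≥0∞) + θ :=
        ex_mono fun S _ => ex_mono fun r hr => h1 r hr S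
    _ = 10 * (n : ℝ≥0∞)⁻¹ * (∑ i : Fin n, ex (iid n p) fun S => ex μ fun r =>
          ind (out r (S i) ≠ ref r)) + θ := by
        simp only [numWrong_eq_sum, ex_add, ex_const, ex_mul_left, ex_finset_sum]
    _ = 10 * (n : ℝ≥0∞)⁻¹ * (∑ i : Fin n, ex p fun u => ex μ fun r =>
          ind (out r u ≠ ref r)) + θ := by
        rw [Finset.sum_congr rfl fun i _ =>
          ex_iid_apply n p i fun u => ex μ fun r => ind (out r u ≠ ref r)]
    _ ≤ 10 * (n : ℝ≥0∞)⁻¹ * (n * B) + θ := by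
        gcongr
        rw [Finset.sum_const, Finset.card_univ, Fintype.card_fin, nsmul_eq_mul]
        gcongr
    _ = 10 * ((n : ℝ≥0∞)⁻¹ * n) * B + θ := by ring
    _ = _ := by rw [ENNReal.inv_mul_cancel hn' (by simp), mul_one]

theorem close_bind {Ω R : Type*} {ε δ : ℝ} (μ : PMF R) (f g : R → PMF Ω)
    (h : ∀ r, Close ε δ (f r) (g r)) : Close ε δ (μ.bind f) (μ.bind g) := by
  intro O
  rw [toOuterMeasure_eq_ex, toOuterMeasure_eq_ex, ex_bind, ex_bind, ← ex_mul_left,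
    ← ex_const μ (ENNReal.ofReal δ), ← ex_add]
  refine ex_mono fun r _ => ?_
  have := h r O
  rwa [toOuterMeasure_eq_ex, toOuterMeasure_eq_ex] at this

/-- The program collects the hypotheses in reversed order, which is immaterial here. -/
theorem Adjacent.map {U : Type*} {S S' : List U} (h : Neighboring S S') (f : U → ℕ) :
    Adjacent (S.map f).reverse (S'.map f).reverse := by
  have key : ∀ (S : List U) (i : ℕ), i < S.length →
      ∃ y, (S.map f).reverse.Perm (y :: ((S.eraseIdx i).map f).reverse) := by
    intro S i hi
    refine ⟨f S[i], (List.reverse_perm _).trans ?_⟩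
    have h1 : S.Perm (S[i] :: S.eraseIdx i) := (List.getElem_cons_eraseIdx_perm hi).symm
    exact (h1.map f).trans (List.Perm.cons _ (List.reverse_perm _).symm)
  rcases h with ⟨i, hi, rfl⟩ | ⟨i, hi, rfl⟩
  · obtain ⟨y, hy⟩ := key S i hi
    exact ⟨y, Or.inl hy⟩
  · obtain ⟨y, hy⟩ := key S' i hi
    exact ⟨y, Or.inr hy⟩

variable {X : Type*} [Fintype X]

/-- Accuracy in terms of the probability of failure. -/
theorem isAccurate_of_ex_le {C : Set (X → Bool)} {b : ℕ} {hyp : Fin (2 ^ b) → X → Bool}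
    {n m : ℕ} {α β : ℝ} (hβ : 0 ≤ β) {M : List (Fin m → X × Bool) → PMF Val}
    (h : ∀ D, Realizable C D → ex (iid n (iid m D)) (fun S => ex (M (List.ofFn S)) fun v =>
      ind (¬Good hyp D α v)) ≤ ENNReal.ofReal β) : IsAccurate C hyp n m α β M := by
  intro D hD
  have h1 : ∑ S : Fin n → Fin m → X × Bool,
      (∏ i, ∏ j, D (S i j)) * (M (List.ofFn S)).toOuterMeasure {v | Good hyp D α v} =
      ex (iid n (iid m D)) fun S => ex (M (List.ofFn S)) fun v => ind (Good hyp D α v) := by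
    rw [ex_fintype]
    refine Finset.sum_congr rfl fun S _ => ?_
    rw [toOuterMeasure_eq_ex]
    rfl
  have h2 : ∀ p, ind p + ind (¬p) = 1 := fun p => by
    by_cases hp : p
    · rw [ind_of_true hp, ind_of_false (not_not.2 hp), add_zero]
    · rw [ind_of_false hp, ind_of_true hp, zero_add]
  have h3 : (ex (iid n (iid m D)) fun S => ex (M (List.ofFn S)) fun v => ind (Good hyp D α v)) +
      (ex (iid n (iid m D)) fun S => ex (M (List.ofFn S)) fun v => ind (¬Good hyp D α v)) = 1 := by
    simp only [← ex_add, h2, ex_const]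
  rw [h1, ENNReal.ofReal_sub _ hβ, ENNReal.ofReal_one, tsub_le_iff_right, ← h3]
  gcongr
  exact h D hD

/-- A stable learner, whose output is with high probability the same for almost all users who share
the tape, and an amplification yield a private learner: the majority element is released. -/
theorem centralLearner_of_stable (enc : X → Val) (C : Set (X → Bool)) {b : ℕ}
    (hyp : Fin (2 ^ b) → X → Bool) {α β ε δ : ℝ} (hβ : 0 < β) (hδ : 0 ≤ δ) {m w T Tc n : ℕ}
    (c : Comb) (out : List ℕ → (Fin m → X × Bool) → ℕ)
    (hcost : ∀ r (u : Fin m → X × Bool), c.cost (.pair (encTape r) (encUser enc u)) ≤ Tc)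
    (hfn : ∀ r (u : Fin m → X × Bool), c.fn (.pair (encTape r) (encUser enc u)) = .num (out r u))
    (hlt : ∀ r (u : Fin m → X × Bool), out r u < 2 ^ b)
    (hstable : ∀ D, Realizable C D → ∃ ref : List ℕ → ℕ,
      (∀ r ∈ (tapes w T).support, Good hyp D α (.num (ref r))) ∧
      ex (iid m D) (fun u => ex (tapes w T) fun r => ind (out r u ≠ ref r)) ≤
        ENNReal.ofReal (β / 20))
    (P : AmpParams) (L : ℕ) (hL : P.M = 2 ^ L) (hE : 1 ≤ P.E) (hε : 1 ≤ ε * P.E)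
    (hd : 2 * P.d ≤ δ * P.M) (hN : P.M < P.N ∨ P.w = b ∧ 2 ^ P.w ≤ P.N) (hn : 0 < n)
    (hamp : ∀ g, 8 * n ≤ 10 * g → ((P.M - P.amp g : ℕ) : ℝ) ≤ β / 2 * P.M) :
    CentralLearner enc C hyp α β ε δ n m
      (c.size + (P.M.size + P.N.size + (P.E + 1).size + P.d.size) +
        (20 * w + 3) * T + 20 * L + 20 * P.w + 600 : ℕ)
      (fun N => (N * (Tc + N * 80 + 300) + (20 * w + 2) * T + 20 * L + 20 * P.w + 300 : ℕ)) := by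
  set out' : List ℕ → List (Fin m → X × Bool) → List ℕ := fun r S => (S.map (out r)).reverse
    with hout'
  refine ⟨.seq (.pair (.pair (drawTape w T) (.pair (drawNum L) (drawNum P.w))) .skip)
    (Comb.central c P).prog, fun S => (tapes w T).bind fun r =>
      P.mech L (vote (out' r S)).1 (vote (out' r S)).2, ?_, fun S => ?_, fun S S' hS => ?_, ?_⟩
  · have h1 := randSize_drawTape w T
    have h2 := randSize_drawNum L
    have h3 := randSize_drawNum P.w
    have h4 := Comb.central_size_le c P
    rw [randSize_draw_comb]
    simp only [randSize, Prog.size] at h1 h2 h3 ⊢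
    exact Nat.cast_le.2 (by omega)
  · have hlaw := law_draw_comb (v := encData enc S) (Comb.central c P)
      (Prog.law_pair (law_drawTape w T _) (Prog.law_pair (law_drawNum L _) (law_drawNum P.w _)))
      (T' := S.length * (Tc + S.length * 80 + 300) + 200) (fun d hd => by
        rw [PMF.mem_support_bind_iff] at hd
        obtain ⟨r, hr, hd⟩ := hd
        rw [PMF.support_map] at hr hd
        obtain ⟨r, -, rfl⟩ := hr
        obtain ⟨x, hx, rfl⟩ := hd
        rw [PMF.mem_support_bind_iff] at hx
        obtain ⟨z, hz, hx⟩ := hx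
        rw [PMF.support_map] at hz hx
        obtain ⟨z, -, rfl⟩ := hz
        obtain ⟨y, hy, rfl⟩ := hx
        rw [PMF.support_map] at hy
        obtain ⟨y, -, rfl⟩ := hy
        exact Comb.central_cost_le c P _ _ _ (encUser enc) (out r) (hfn r) Tc (hcost r) S)
    refine Timed.Law.computes ((congrArg (fun μ => Timed.Law _ μ _) ?_).mp hlaw) ?_
    · refine PMF.ext_of_ex fun f => ?_
      simp only [ex_map, ex_bind, AmpParams.mech]
      refine ex_congr fun r _ => ex_congr fun z _ => ex_congr fun d _ => ?_
      rw [encData, Comb.central_fn c P _ _ _ (encUser enc) (out r) (hfn r) S]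
    · exact Nat.cast_le.2 (by omega)
  · refine close_bind _ _ _ fun r => ?_
    obtain ⟨x, g, g', hx, h1, h2, h3, h4⟩ := (Adjacent.map hS (out r)).exists_vote_eq
      (f := P.mech L) (P.mech_zero hL)
    rw [hout']
    simp only
    rw [h1, h2]
    refine P.close_mech hL hδ hE hε hd (hN.imp_right fun h => ⟨h.2, ?_⟩) h3 h4
    rw [h.1]
    simp only [List.mem_reverse, List.mem_map] at hx
    rcases hx with rfl | ⟨u, -, rfl⟩ | ⟨u, -, rfl⟩
    · positivity
    · exact hlt _ _
    · exact hlt _ _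
  · refine isAccurate_of_ex_le hβ.le fun D hD => ?_
    obtain ⟨ref, hgood, href⟩ := hstable D hD
    simp only [ex_bind]
    refine (ex_ex_le_of_numWrong hn (iid m D) (tapes w T) out ref (θ := ENNReal.ofReal (β / 2))
      href _ (fun r S => ?_) fun r hr S hS => ?_).trans ?_
    · exact (ex_mono fun v _ => ind_le_one _).trans (ex_const _ _).le
    · have hcount := count_ofFn (fun i => out r (S i)) (ref r)
      have hgap : gap (ref r) (out' r (List.ofFn S)) = n - 2 * numWrong (fun i => out r (S i)) (ref r) := by
        simp only [hout', gap, List.count_reverse, List.length_reverse,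
          List.length_ofFn, List.map_ofFn, Function.comp_def]
        omega
      rw [vote_of_gap_pos (by omega : 0 < gap (ref r) (out' r (List.ofFn S)))]
      refine (P.ex_mech_le hL _ _ _ (fun v => ind_le_one _) (ind_of_false ?_)).trans ?_
      · rw [not_not]
        exact hgood r hr
      · have h1 := hamp (gap (ref r) (out' r (List.ofFn S))) (by omega)
        have hM : (0 : ℝ) < P.M := by rw [hL]; positivity
        rw [← ENNReal.ofReal_natCast, ← ENNReal.ofReal_natCast, ← ENNReal.ofReal_inv_of_pos hM,
          ← ENNReal.ofReal_mul (by positivity)]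
        refine ENNReal.ofReal_le_ofReal ?_
        rw [← div_eq_mul_inv, div_le_iff₀ hM]
        exact h1
    · rw [← ENNReal.ofReal_ofNat 10, ← ENNReal.ofReal_mul (by norm_num),
        ← ENNReal.ofReal_add (by positivity) (by positivity)]
      exact ENNReal.ofReal_le_ofReal (by linarith)

end Central


/-! ### Bounds for the parameters -/

section Parameters

theorem size_le_of_le_two_pow {n k : ℕ} (h : n ≤ 2 ^ k) : n.size ≤ k + 1 :=
  Nat.size_le.2 (h.trans_lt (Nat.pow_lt_pow_right (by norm_num) (Nat.lt_succ_self k)))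

theorem size_le_self (n : ℕ) : n.size ≤ n := Nat.size_le.2 Nat.lt_two_pow_self

theorem clog_ceil_le {x : ℝ} (hx : 1 < x) :
    x ≤ 2 ^ Nat.clog 2 ⌈x⌉₊ ∧ (Nat.clog 2 ⌈x⌉₊ : ℝ) ≤ 2 + 2 * Real.log x := by
  have hx1 : 1 < ⌈x⌉₊ := Nat.lt_ceil.2 (by simpa using hx)
  constructor
  · refine (Nat.le_ceil x).trans ?_
    exact_mod_cast Nat.le_pow_clog (by norm_num) _
  · have h1 := Nat.pow_pred_clog_lt_self (b := 2) (by norm_num) hx1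
    set l := Nat.clog 2 ⌈x⌉₊ with hl
    have hl0 : 1 ≤ l := Nat.clog_pos (by norm_num) hx1
    obtain ⟨j, hj⟩ : ∃ j, l = j + 1 := ⟨l - 1, by omega⟩
    have h2 : (2 : ℝ) ^ j ≤ 2 * x := by
      have h3 : ((2 ^ j : ℕ) : ℝ) ≤ ⌈x⌉₊ := by
        have : l.pred = j := by rw [hj]; rfl
        rw [this] at h1
        exact_mod_cast h1.le
      have h4 := Nat.ceil_lt_add_one (show 0 ≤ x by linarith)
      push_cast at h3
      linarith
    have h5 := Real.log_le_log (by positivity) h2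
    rw [Real.log_pow, Real.log_mul (by norm_num) (by linarith)] at h5
    have h6 := Real.log_two_gt_d9
    have h7 := Real.log_two_lt_d9
    have h8 := Real.log_nonneg hx.le
    rw [hj]
    push_cast
    have hj0 : (0 : ℝ) ≤ j := Nat.cast_nonneg _
    nlinarith

/-- The passage from the explicit bounds to the constants of the theorem. -/
theorem bound_mono {x : ℝ} (hx : 1 ≤ x) {c : ℝ} {K k j : ℕ} (hc : c ≤ K) (hj : j ≤ k) :
    c * x ^ j ≤ K * x ^ k := by
  have h1 : x ^ j ≤ x ^ k := pow_le_pow_right₀ hx hj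
  have h2 : 0 ≤ x ^ j := by positivity
  have h3 : (0 : ℝ) ≤ K := Nat.cast_nonneg _
  nlinarith [mul_le_mul_of_nonneg_right hc h2, mul_le_mul_of_nonneg_left h1 h3]

variable {X : Type*} [Fintype X]

theorem CentralLearner.mono {enc : X → Val} {C : Set (X → Bool)} {b : ℕ}
    {hyp : Fin (2 ^ b) → X → Bool} {α β ε δ : ℝ} {n m : ℕ} {L L' : ℝ} {B B' : ℕ → ℝ}
    (h : CentralLearner enc C hyp α β ε δ n m L B) (hL : L ≤ L') (hB : ∀ N, B N ≤ B' N) :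
    CentralLearner enc C hyp α β ε δ n m L' B' := by
  obtain ⟨p, M, h1, h2, h3⟩ := h
  refine ⟨p, M, h1.trans hL, fun S => ?_, h3⟩
  obtain ⟨t, ht, h4⟩ := h2 S
  exact ⟨t, ht.trans (hB _), h4⟩

/-- The stable learner in the form that the private learners use. -/
theorem exists_stable (enc : X ↪ Val) (C : Set (X → Bool)) {b : ℕ}
    (hyp : Fin (2 ^ b) → X → Bool) {α τ β : ℝ} (hτ : 0 < τ) (hβ : 0 < β) (hβ1 : β < 1) {q T : ℕ}
    {A : Prog SQOp} (hA : SQLearns enc C hyp α τ q T A) :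
    ∃ (m w Y : ℕ) (c : Comb) (out : List ℕ → (Fin m → X × Bool) → ℕ),
      (m : ℝ) ≤ 500000 * (1 + q / (β * τ)) ^ 2 ∧ T ≤ Y ∧ 1 / β ≤ Y ∧ 20 ≤ Y ∧
      (Y : ℝ) ≤ 20 * (1 + T + 1 / τ + 1 / β) ∧ w ≤ 16 * Y ^ 2 ∧
      c.size ≤ 500000 * Y ^ 6 * (sqSize A + b + 1) ∧
      (∀ r (u : Fin m → X × Bool),
        c.cost (.pair (encTape r) (encUser enc u)) ≤ 1000000 * Y ^ 10) ∧
      (∀ r (u : Fin m → X × Bool), c.fn (.pair (encTape r) (encUser enc u)) = .num (out r u)) ∧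
      (∀ r (u : Fin m → X × Bool), out r u < 2 ^ b) ∧
      ∀ D, Realizable C D → ∃ ref : List ℕ → ℕ,
        (∀ r ∈ (tapes w T).support, Good hyp D α (.num (ref r))) ∧
        ex (iid m D) (fun u => ex (tapes w T) fun r => ind (out r u ≠ ref r)) ≤
          ENNReal.ofReal (β / 20) := by
  have hβi : 1 < 1 / β := by rw [lt_div_iff₀ hβ]; linarith
  have h20 : 20 / β = 20 * (1 / β) := by ring
  have h8 : 8 / τ = 8 * (1 / τ) := by ring
  have hτi : 0 < 1 / τ := by positivity
  have hB1 := Nat.le_ceil (20 / β)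
  have hB2 := Nat.ceil_lt_add_one (show 0 ≤ 20 / β by positivity)
  have hτ1 := Nat.le_ceil (8 / τ)
  have hτ2 := Nat.ceil_lt_add_one (show 0 ≤ 8 / τ by positivity)
  set B := ⌈20 / β⌉₊ with hB
  have hB20 : 20 ≤ B := by
    have : (20 : ℝ) ≤ B := by linarith
    exact_mod_cast this
  set Y := T + ⌈8 / τ⌉₊ + B + 2 with hY
  have hYr : (Y : ℝ) = T + ⌈8 / τ⌉₊ + B + 2 := by rw [hY]; push_cast; rfl
  have hT0 : (0 : ℝ) ≤ T := Nat.cast_nonneg _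
  have hc0 : (0 : ℝ) ≤ ⌈8 / τ⌉₊ := Nat.cast_nonneg _
  obtain ⟨m, w, c, out, hm, hw, h1, h2, h3, h4, h5⟩ := exists_userLearner enc C hyp hτ hA B Y
    (by omega) (by omega) (by omega) (by rw [hYr]; linarith)
  refine ⟨m, w, Y, c, out, hm.trans ?_, by omega, by rw [hYr]; linarith, by omega,
    by rw [hYr]; linarith, hw, h1, h2, h3, h4, fun D hD => ?_⟩
  · have h6 : 32 * (B : ℝ) * q / τ ≤ 672 * (q / (β * τ)) := by
      have : 32 * (B : ℝ) ≤ 672 * (1 / β) := by linarith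
      calc 32 * (B : ℝ) * q / τ = 32 * (B : ℝ) * (q / τ) := by ring
        _ ≤ 672 * (1 / β) * (q / τ) := by gcongr
        _ = 672 * (q / (β * τ)) := by field_simp
    have h7 : 0 ≤ q / (β * τ) := by positivity
    calc (32 * (B : ℝ) * q / τ + 1) ^ 2 ≤ (672 * (1 + q / (β * τ))) ^ 2 := by
          gcongr; linarith
      _ = 451584 * (1 + q / (β * τ)) ^ 2 := by ring
      _ ≤ _ := by gcongr; norm_num
  · obtain ⟨ref, h6, h7⟩ := h5 D hD
    refine ⟨ref, h6, h7.trans ?_⟩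
    have hB0 : (0 : ℝ) < B := by linarith
    rw [← ENNReal.ofReal_natCast, ← ENNReal.ofReal_inv_of_pos hB0]
    refine ENNReal.ofReal_le_ofReal ?_
    rw [inv_le_comm₀ hB0 (by positivity), inv_div]
    exact hB1

/-- The length of the central learners, if `V` bounds all parameters. -/
theorem central_length_le {V Y s w T L W x : ℕ} (hw : w ≤ 16 * Y ^ 2) (hT : T ≤ Y) (hY : Y ≤ V)
    (hV : 1 ≤ V) (hs : s ≤ 500000 * Y ^ 6 * V) (hL : L ≤ V) (hW : W ≤ V) (hx : x ≤ 5 * V) :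
    s + x + (20 * w + 3) * T + 20 * L + 20 * W + 600 ≤ 600000 * V ^ 7 := by
  have h1 : s ≤ 500000 * V ^ 7 := hs.trans (by
    calc 500000 * Y ^ 6 * V ≤ 500000 * V ^ 6 * V := by gcongr
      _ = _ := by ring)
  have h2 : (20 * w + 3) * T ≤ 323 * V ^ 7 := by
    calc (20 * w + 3) * T ≤ (20 * (16 * V ^ 2) + 3 * V ^ 2) * V := by
          gcongr
          · exact hw.trans (by gcongr)
          · have := Nat.one_le_pow 2 V hV; omega
          · exact hT.trans hY
      _ = 323 * V ^ 3 := by ring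
      _ ≤ 323 * V ^ 7 := by gcongr; omega
  have h3 : V ≤ V ^ 7 := Nat.le_self_pow (by norm_num) _
  omega

/-- The running time of the central learners, if `V` bounds all parameters. -/
theorem central_time_le {V Y w T L W N : ℕ} (hw : w ≤ 16 * Y ^ 2) (hT : T ≤ Y) (hY : Y ≤ V)
    (hV : 1 ≤ V) (hL : L ≤ V) (hW : W ≤ V) (hN : N ≤ V) :
    N * (1000000 * Y ^ 10 + N * 80 + 300) + (20 * w + 2) * T + 20 * L + 20 * W + 300 ≤
      2000000 * V ^ 11 := by
  have h1 : N * (1000000 * Y ^ 10 + N * 80 + 300) ≤ 1000380 * V ^ 11 := by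
    have h10 : 1 ≤ V ^ 10 := Nat.one_le_pow _ _ hV
    have h11 : V ≤ V ^ 10 := Nat.le_self_pow (by norm_num) _
    calc N * (1000000 * Y ^ 10 + N * 80 + 300)
        ≤ V * (1000000 * V ^ 10 + V ^ 10 * 80 + 300 * V ^ 10) := by
          gcongr
          · omega
          · omega
      _ = _ := by ring
  have h2 : (20 * w + 2) * T ≤ 322 * V ^ 11 := by
    calc (20 * w + 2) * T ≤ (20 * (16 * V ^ 2) + 2 * V ^ 2) * V := by
          gcongr
          · exact hw.trans (by gcongr)
          · have := Nat.one_le_pow 2 V hV; omega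
          · exact hT.trans hY
      _ = 322 * V ^ 3 := by ring
      _ ≤ 322 * V ^ 11 := by gcongr; omega
  have h3 : V ≤ V ^ 11 := Nat.le_self_pow (by norm_num) _
  generalize V ^ 11 = Z at *
  generalize N * (1000000 * Y ^ 10 + N * 80 + 300) = a at *
  omega

end Parameters


/-! ### The parameters of the central learners -/

section Central

variable {X : Type*} [Fintype X]

/-- The bounds on length and time of `centralLearner_of_stable` in terms of the quantities of the
theorem. -/
theorem CentralLearner.of_bounds {enc : X → Val} {C : Set (X → Bool)} {b : ℕ}
    {hyp : Fin (2 ^ b) → X → Bool} {α τ β ε δ : ℝ} (hτ : 0 < τ) (hβ : 0 < β)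
    {m w T n Y cs s L W x K k : ℕ} (hK : (10 : ℝ) ^ 40 ≤ K) (hk : 11 ≤ k) (hTY : T ≤ Y) (hY1 : 1 ≤ Y)
    (hY : (Y : ℝ) ≤ 20 * (1 + T + 1 / τ + 1 / β)) (hw : w ≤ 16 * Y ^ 2)
    (hcs : cs ≤ 500000 * Y ^ 6 * (s + b + 1)) (hL : L ≤ 4 * n) (hW : W ≤ 4 * n) (hx : x ≤ 20 * n)
    (h : CentralLearner enc C hyp α β ε δ n m
      (cs + x + (20 * w + 3) * T + 20 * L + 20 * W + 600 : ℕ)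
      (fun N => (N * (1000000 * Y ^ 10 + N * 80 + 300) + (20 * w + 2) * T + 20 * L + 20 * W +
        300 : ℕ))) :
    CentralLearner enc C hyp α β ε δ n m (K * (1 + s + b + T + 1 / τ + 1 / β + n) ^ k)
      (fun N => K * (1 + T + 1 / τ + 1 / β + n + N) ^ k) := by
  have hτi : 0 < 1 / τ := by positivity
  have hβi : 0 < 1 / β := by positivity
  have hT0 : (0 : ℝ) ≤ T := Nat.cast_nonneg _
  have hs0 : (0 : ℝ) ≤ s := Nat.cast_nonneg _
  have hb0 : (0 : ℝ) ≤ b := Nat.cast_nonneg _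
  have hn0 : (0 : ℝ) ≤ n := Nat.cast_nonneg _
  refine h.mono ?_ fun N => ?_
  · obtain ⟨V, hV⟩ : ∃ V, V = Y + 4 * n + s + b := ⟨_, rfl⟩
    have h1 := central_length_le (V := V) (x := x) hw hTY (by omega) (by omega)
      (hcs.trans (Nat.mul_le_mul_left _ (by omega))) (by omega : L ≤ V) (by omega : W ≤ V)
      (by omega)
    obtain ⟨Z, hZ⟩ : ∃ Z, Z = 1 + (s : ℝ) + b + T + 1 / τ + 1 / β + n := ⟨_, rfl⟩
    rw [← hZ]
    have h2 : (V : ℝ) ≤ 20 * Z := by rw [hV]; push_cast; linarith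
    calc ((cs + x + (20 * w + 3) * T + 20 * L + 20 * W + 600 : ℕ) : ℝ)
        ≤ ((600000 * V ^ 7 : ℕ) : ℝ) := Nat.cast_le.2 h1
      _ = 600000 * (V : ℝ) ^ 7 := by push_cast; rfl
      _ ≤ 600000 * (20 * Z) ^ 7 := by gcongr
      _ = 600000 * 20 ^ 7 * Z ^ 7 := by ring
      _ ≤ _ := bound_mono (by linarith) (le_trans (by norm_num) hK) (by omega)
  · obtain ⟨V, hV⟩ : ∃ V, V = Y + 4 * n + N := ⟨_, rfl⟩
    have h1 := central_time_le (V := V) hw hTY (by omega) (by omega) (by omega : L ≤ V)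
      (by omega : W ≤ V) (by omega : N ≤ V)
    have hN0 : (0 : ℝ) ≤ N := Nat.cast_nonneg _
    obtain ⟨Z, hZ⟩ : ∃ Z, Z = 1 + (T : ℝ) + 1 / τ + 1 / β + n + N := ⟨_, rfl⟩
    rw [← hZ]
    have h2 : (V : ℝ) ≤ 20 * Z := by rw [hV]; push_cast; linarith
    refine (Nat.cast_le.2 h1).trans ?_
    calc ((2000000 * V ^ 11 : ℕ) : ℝ) = 2000000 * (V : ℝ) ^ 11 := by push_cast; rfl
      _ ≤ 2000000 * (20 * Z) ^ 11 := by gcongr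
      _ = 2000000 * 20 ^ 11 * Z ^ 11 := by ring
      _ ≤ _ := bound_mono (by linarith) (le_trans (by norm_num) hK) (by omega)

/-- The number of samples of a user, in terms of the constants of the theorem. -/
theorem samples_le {β τ : ℝ} (hβ : 0 < β) (hτ : 0 < τ) {m q K k : ℕ} (hK : (10 : ℝ) ^ 40 ≤ K) (hk : 11 ≤ k)
    (hm : (m : ℝ) ≤ 500000 * (1 + q / (β * τ)) ^ 2) : (m : ℝ) ≤ K * (1 + q / (β * τ)) ^ k := by
  refine hm.trans (bound_mono ?_ (le_trans (by norm_num) hK) (by omega))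
  have : 0 ≤ q / (β * τ) := by positivity
  linarith

theorem ceil_inv_bounds {ε : ℝ} (hε : 0 < ε) (hε1 : ε < 1) : 1 ≤ ⌈1 / ε⌉₊ ∧
    1 ≤ ε * (⌈1 / ε⌉₊ : ℝ) ∧ ((⌈1 / ε⌉₊ + 1 : ℕ) : ℝ) ≤ 3 * (1 / ε) := by
  have h1 := Nat.le_ceil (1 / ε)
  have h2 := Nat.ceil_lt_add_one (show 0 ≤ 1 / ε by positivity)
  have h3 : 1 < 1 / ε := by rw [lt_div_iff₀ hε]; linarith
  refine ⟨Nat.ceil_pos.2 (by linarith), ?_, by push_cast; linarith⟩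
  have h4 := mul_le_mul_of_nonneg_left h1 hε.le
  rwa [mul_one_div_cancel hε.ne'] at h4

/-- Approximate privacy: the release probability starts at `1 / M`, where `M ≥ 2 / δ`, and reaches
`1` after `O(log M / ε)` steps. -/
theorem exists_approx_central (enc : X ↪ Val) (C : Set (X → Bool)) {b : ℕ}
    (hyp : Fin (2 ^ b) → X → Bool) {α τ β ε δ : ℝ} (hτ : 0 < τ) (hβ : 0 < β) (hβ1 : β < 1)
    (hε : 0 < ε) (hε1 : ε < 1) (hδ : 0 < δ) (hδ1 : δ < 1) {q T : ℕ}
    {A : Prog SQOp} (hA : SQLearns enc C hyp α τ q T A) {K k : ℕ} (hK : (10 : ℝ) ^ 40 ≤ K)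
    (hk : 11 ≤ k) : ∃ n m : ℕ,
      (n : ℝ) ≤ K * (Real.log (2 / δ) / ε) ∧ (m : ℝ) ≤ K * (1 + q / (β * τ)) ^ k ∧
      CentralLearner enc C hyp α β ε δ n m
        (K * (1 + sqSize A + b + T + 1 / τ + 1 / β + n) ^ k)
        (fun N => K * (1 + T + 1 / τ + 1 / β + n + N) ^ k) := by
  obtain ⟨m, w, Y, c, out, hm, hTY, hβY, hY20, hY, hw, hsize, hcost, hfn, hlt, hstable⟩ :=
    exists_stable enc C hyp hτ hβ hβ1 hA
  have h2δ : 1 < 2 / δ := by rw [lt_div_iff₀ hδ]; linarith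
  obtain ⟨hE1, hE2, hE3⟩ := ceil_inv_bounds hε hε1
  obtain ⟨hL1, hL2⟩ := clog_ceil_le h2δ
  set E := ⌈1 / ε⌉₊ with hE
  set L := Nat.clog 2 ⌈2 / δ⌉₊ with hL
  obtain ⟨P, hPM, hPN, hPE, hPd, hPw⟩ : ∃ P : AmpParams, P.M = 2 ^ L ∧ P.N = 2 ^ L + 1 ∧ P.E = E ∧
    P.d = 1 ∧ P.w = 0 := ⟨⟨2 ^ L, 2 ^ L + 1, E, 1, 0⟩, rfl, rfl, rfl, rfl, rfl⟩
  set n := 2 * ((E + 1) * (L + (L + 1))) with hn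
  have hEL : E + L ≤ n := by rw [hn]; nlinarith
  have hd : 2 * ((1 : ℕ) : ℝ) ≤ δ * ((2 ^ L : ℕ) : ℝ) := by
    rw [div_le_iff₀ hδ] at hL1
    push_cast
    linarith
  have hamp : ∀ g, 8 * n ≤ 10 * g → P.M - P.amp g = 0 := by
    intro g hg
    have h1 := P.sub_amp_le (F := E + 1) (c := 1) (θ := 1) (k₁ := L) (k₂ := L + 1) (g := g)
      (by omega) (by rw [hPM]; omega) (fun a _ hθ => by
        have hdiv : (P.M - a) / P.N = 0 := Nat.div_eq_of_lt (by omega)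
        have h1 := Nat.lt_mul_div_succ (min a (P.M - a)) (show 0 < E + 1 by omega)
        have h2 : P.M - a ≤ (E + 1) * (P.M - a) := Nat.le_mul_of_pos_left _ (by omega)
        simp only [AmpParams.next, hdiv, add_zero, Nat.add_sub_cancel_left, hPE, hPd]
        have h3 : (E + 1) * min (P.M - a) (min a (P.M - a) / (E + 1) + 1) =
            min ((E + 1) * (P.M - a)) ((E + 1) * (min a (P.M - a) / (E + 1) + 1)) :=
          Nat.mul_min_mul_left _ _ _ |>.symm
        omega) (by omega)
    rcases h1 with h1 | h1
    · omega
    · by_contra h0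
      have h2 : 2 ^ (L + 1) * 1 ≤ 2 ^ (L + 1) * (P.M - P.amp g) :=
        Nat.mul_le_mul_left _ (Nat.pos_of_ne_zero h0)
      have h3 : P.M < 2 ^ (L + 1) := hPM ▸ Nat.pow_lt_pow_right (by norm_num) (by omega)
      omega
  have h := centralLearner_of_stable enc C hyp (β := β) (ε := ε) (δ := δ) hβ hδ.le c out hcost hfn
    hlt hstable P L hPM (by omega) (by rw [hPE]; exact hE2) (by rw [hPd, hPM]; exact hd)
    (Or.inl (by omega)) (n := n) (by omega)
    fun g hg => by rw [hamp g hg]; simp only [Nat.cast_zero]; positivity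
  refine ⟨n, m, ?_, samples_le hβ hτ hK hk hm, ?_⟩
  · have h6 := Real.log_two_gt_d9
    have h7 : Real.log 2 ≤ Real.log (2 / δ) := by
      refine Real.log_le_log (by norm_num) ?_
      rw [le_div_iff₀ hδ]
      linarith
    have hε' : 0 < 1 / ε := by positivity
    have hlog : 0 < Real.log (2 / δ) := by linarith
    have h9 : (((L + (L + 1) : ℕ)) : ℝ) ≤ 20 * Real.log (2 / δ) := by push_cast; linarith
    calc (n : ℝ) = 2 * (((E + 1 : ℕ) : ℝ) * ((L + (L + 1) : ℕ) : ℝ)) := by rw [hn]; push_cast; ring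
      _ ≤ 2 * (3 * (1 / ε) * (20 * Real.log (2 / δ))) := by gcongr
      _ = 120 * (Real.log (2 / δ) / ε) := by ring
      _ ≤ _ := by
        gcongr
        exact le_trans (by norm_num) hK
  · refine CentralLearner.of_bounds (x := P.M.size + P.N.size + (P.E + 1).size + P.d.size) (L := L)
      (W := P.w) hτ hβ hK hk hTY (by omega) hY hw hsize (by omega) (by omega) ?_ ?_
    · have h1 := size_le_of_le_two_pow (le_refl (2 ^ L))
      have h2 : (2 ^ L + 1).size ≤ L + 1 + 1 := size_le_of_le_two_pow (by
        rw [pow_succ]; have := Nat.one_le_two_pow (n := L); omega)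
      have h3 := size_le_self (E + 1)
      have h4 := size_le_self 1
      rw [hPM, hPN, hPE, hPd]
      omega
    · exact h

/-- Pure privacy: the release probability starts at about `2 ^ (-b)`, which is the probability that
a uniform choice hits the majority hypothesis, and it reaches `1 - β / 2` after
`O((b + log (1 / β)) / ε)` steps. -/
theorem exists_pure_central (enc : X ↪ Val) (C : Set (X → Bool)) {b : ℕ} (hb : 0 < b)
    (hyp : Fin (2 ^ b) → X → Bool) {α τ β ε : ℝ} (hτ : 0 < τ) (hβ : 0 < β) (hβ1 : β < 1)
    (hε : 0 < ε) (hε1 : ε < 1) {q T : ℕ}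
    {A : Prog SQOp} (hA : SQLearns enc C hyp α τ q T A) {K k : ℕ} (hK : (10 : ℝ) ^ 40 ≤ K)
    (hk : 11 ≤ k) : ∃ n m : ℕ,
      (n : ℝ) ≤ K * ((b + Real.log (1 / β)) / ε) ∧ (m : ℝ) ≤ K * (1 + q / (β * τ)) ^ k ∧
      CentralLearner enc C hyp α β ε 0 n m
        (K * (1 + sqSize A + b + T + 1 / τ + 1 / β + n) ^ k)
        (fun N => K * (1 + T + 1 / τ + 1 / β + n + N) ^ k) := by
  obtain ⟨m, w, Y, c, out, hm, hTY, hβY, hY20, hY, hw, hsize, hcost, hfn, hlt, hstable⟩ :=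
    exists_stable enc C hyp hτ hβ hβ1 hA
  have h2β : 1 < 2 / β := by rw [lt_div_iff₀ hβ]; linarith
  obtain ⟨hE1, hE2, hE3⟩ := ceil_inv_bounds hε hε1
  obtain ⟨hk1, hk2⟩ := clog_ceil_le h2β
  set E := ⌈1 / ε⌉₊ with hE
  set k₂ := Nat.clog 2 ⌈2 / β⌉₊ with hk₂
  set e := Nat.clog 2 (E + 1) with he
  have he1 : E + 1 ≤ 2 ^ e := Nat.le_pow_clog (by norm_num) _
  have he2 : e ≤ E + 1 := Nat.clog_le_of_le_pow Nat.lt_two_pow_self.le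
  set L := 1 + b + (e + k₂) with hL
  obtain ⟨P, hPM, hPN, hPE, hPd, hPw⟩ : ∃ P : AmpParams, P.M = 2 ^ L ∧ P.N = 2 ^ b ∧ P.E = E ∧
    P.d = 0 ∧ P.w = b := ⟨⟨2 ^ L, 2 ^ b, E, 0, b⟩, rfl, rfl, rfl, rfl, rfl⟩
  set n := 2 * ((2 * (E + 1)) * (b + 1 + k₂)) with hn
  have hEb : E + 1 + (b + 1 + k₂) ≤ n := by rw [hn]; nlinarith
  have hc : 2 ^ L = 2 ^ (b + 1) * 2 ^ (e + k₂) := by rw [← pow_add, hL]; congr 1; omega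
  have hcF : E + 1 ≤ 2 ^ (e + k₂) :=
    he1.trans (Nat.pow_le_pow_right (by norm_num) (Nat.le_add_right _ _))
  have hk1' : 1 ≤ β / 2 * 2 ^ k₂ := by
    rw [div_le_iff₀ hβ] at hk1
    linarith
  have hamp : ∀ g, 8 * n ≤ 10 * g → ((P.M - P.amp g : ℕ) : ℝ) ≤ β / 2 * P.M := by
    intro g hg
    have h1 := P.sub_amp_le (F := 2 * (E + 1)) (c := 2 ^ (e + k₂)) (θ := E + 1) (k₁ := b + 1)
      (k₂ := k₂) (g := g) (by omega) (by rw [hPM, hc]) (fun a ha hθ => by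
        have h2 : P.M - a ≤ 2 * (E + 1) * (P.M - a) := Nat.le_mul_of_pos_left _ (by omega)
        have h0 : min (a + 2 ^ (e + k₂)) (P.M - a) ≤ min (a + (P.M - a) / P.N) (P.M - a) := by
          by_cases hM : P.M ≤ 2 * a
          · have : min (a + (P.M - a) / P.N) (P.M - a) = P.M - a :=
              min_eq_right ((by omega : P.M - a ≤ a).trans (Nat.le_add_right _ _))
            rw [this]
            exact min_le_right _ _
          · have : 2 ^ (e + k₂) ≤ (P.M - a) / P.N := by
              rw [Nat.le_div_iff_mul_le (by rw [hPN]; positivity)]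
              have : 2 * (2 ^ (e + k₂) * 2 ^ b) = P.M := by
                rw [hPM, hc, pow_succ]
                ring
              rw [hPN]
              omega
            omega
        have hx : E + 1 ≤ min (a + 2 ^ (e + k₂)) (P.M - a) := by omega
        simp only [AmpParams.next, Nat.add_sub_cancel_left]
        rw [hPE, hPd, add_zero]
        generalize min (a + (P.M - a) / P.N) (P.M - a) = x at *
        have h1 := Nat.lt_mul_div_succ x (show 0 < E + 1 by omega)
        have h3 : 1 ≤ x / (E + 1) := by
          rw [Nat.le_div_iff_mul_le (by omega)]
          omega
        have h4 : E + 1 ≤ (E + 1) * (x / (E + 1)) := Nat.le_mul_of_pos_right _ (by omega)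
        rw [mul_add] at h1
        rw [← Nat.mul_min_mul_left, mul_assoc 2 (E + 1) (x / (E + 1))]
        omega) (by omega)
    have hMr : (P.M : ℝ) = 2 ^ L := by simp [hPM]
    rcases h1 with h1 | h1
    · have h2 : (2 : ℝ) ^ L = 2 ^ k₂ * (2 ^ (b + 1) * 2 ^ e) := by
        rw [← pow_add, ← pow_add, hL]
        congr 1
        omega
      have h3 : ((P.M - P.amp g : ℕ) : ℝ) ≤ 2 ^ e := by exact_mod_cast h1.le.trans he1
      have h4 : (1 : ℝ) ≤ 2 ^ (b + 1) := one_le_pow₀ (by norm_num)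
      rw [hMr, h2, ← mul_assoc]
      have h5 : (2 : ℝ) ^ e ≤ 2 ^ (b + 1) * 2 ^ e := le_mul_of_one_le_left (by positivity) h4
      exact (h3.trans h5).trans (le_mul_of_one_le_left (by positivity) hk1')
    · have h2 : (2 : ℝ) ^ k₂ * ((P.M - P.amp g : ℕ) : ℝ) ≤ P.M := by exact_mod_cast h1
      have h3 := mul_le_mul_of_nonneg_left h2 (show 0 ≤ β / 2 by linarith)
      rw [← mul_assoc] at h3
      exact (le_mul_of_one_le_left (Nat.cast_nonneg _) hk1').trans h3
  have h := centralLearner_of_stable enc C hyp (β := β) (ε := ε) (δ := 0) hβ le_rfl c out hcost hfn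
    hlt hstable P L hPM (by omega) (by rw [hPE]; exact hE2) (by simp [hPd])
    (Or.inr ⟨hPw, by rw [hPw, hPN]⟩) (n := n) (by omega) hamp
  refine ⟨n, m, ?_, samples_le hβ hτ hK hk hm, ?_⟩
  · have h6 := Real.log_two_lt_d9
    have h7 : Real.log (2 / β) = Real.log 2 + Real.log (1 / β) := by
      rw [← Real.log_mul (by norm_num) (by positivity)]
      congr 1
      ring
    have h8 : 0 ≤ Real.log (1 / β) := Real.log_nonneg (by rw [le_div_iff₀ hβ]; linarith)
    have hb1 : (1 : ℝ) ≤ b := by exact_mod_cast hb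
    have hε' : 0 < 1 / ε := by positivity
    have h9 : ((b + 1 + k₂ : ℕ) : ℝ) ≤ 6 * (b + Real.log (1 / β)) := by
      rw [h7] at hk2
      push_cast
      linarith
    calc (n : ℝ) = 4 * (((E + 1 : ℕ) : ℝ) * ((b + 1 + k₂ : ℕ) : ℝ)) := by rw [hn]; push_cast; ring
      _ ≤ 4 * (3 * (1 / ε) * (6 * (b + Real.log (1 / β)))) := by gcongr
      _ = 72 * ((b + Real.log (1 / β)) / ε) := by ring
      _ ≤ _ := by
        have : 0 ≤ (b + Real.log (1 / β)) / ε := by positivity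
        gcongr
        exact le_trans (by norm_num) hK
  · refine CentralLearner.of_bounds (x := P.M.size + P.N.size + (P.E + 1).size + P.d.size) (L := L)
      (W := P.w) hτ hβ hK hk hTY (by omega) hY hw hsize (by omega) (by omega) ?_ ?_
    · have h1 := size_le_of_le_two_pow (le_refl (2 ^ L))
      have h2 := size_le_of_le_two_pow (le_refl (2 ^ b))
      have h3 := size_le_self (E + 1)
      have h4 := size_le_self 0
      rw [hPM, hPN, hPE, hPd]
      omega
    · exact h

/-- If there is only one hypothesis, no data is needed. -/
theorem good_zero (enc : X ↪ Val) (C : Set (X → Bool))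
    (hyp : Fin (2 ^ 0) → X → Bool) {α τ : ℝ} (hτ : 0 < τ) {q T : ℕ}
    {A : Prog SQOp} (hA : SQLearns enc C hyp α τ q T A) {D : PMF (X × Bool)} (hD : Realizable C D) :
    Good hyp D α (.num 0) := by
  obtain ⟨m, w, Y, c, out, -, -, -, -, -, -, -, -, -, -, h⟩ :=
    exists_stable (β := 1 / 2) enc C hyp hτ (by norm_num) (by norm_num) hA
  obtain ⟨ref, h1, -⟩ := h D hD
  obtain ⟨r, hr⟩ := (tapes w T).support_nonempty
  obtain ⟨c, hc, h2⟩ := h1 r hr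
  have := c.2
  exact ⟨c, by congr 1; omega, h2⟩

theorem close_self {Ω : Type*} {ε : ℝ} (hε : 0 ≤ ε) (μ : PMF Ω) : Close ε 0 μ μ := fun O => by
  refine le_add_right (le_mul_of_one_le_left zero_le ?_)
  rw [← ENNReal.ofReal_one]
  exact ENNReal.ofReal_le_ofReal (Real.one_le_exp hε)

theorem centralLearner_const (enc : X → Val) (C : Set (X → Bool))
    (hyp : Fin (2 ^ 0) → X → Bool) {α β ε : ℝ} (hβ : 0 ≤ β) (hε : 0 ≤ ε)
    (h : ∀ D, Realizable C D → Good hyp D α (.num 0)) {L : ℝ} {B : ℕ → ℝ} (hL : 1 ≤ L)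
    (hB : ∀ N, 1 ≤ B N) : CentralLearner enc C hyp α β ε 0 0 0 L B := by
  refine ⟨.const 0, fun _ => PMF.pure (.num 0), by simpa [randSize, Prog.size] using hL,
    fun S => Prog.Runs.const.law.computes (by simpa using hB _), fun S S' _ => close_self hε _,
    isAccurate_of_ex_le hβ fun D hD => ?_⟩
  simp [ind_of_false (not_not.2 (h D hD))]

end Central


/-! ### The local randomizer -/

section Randomizer

/-- The inner product of a list of bits with the bits of `y`, up to a multiple of `2`: the summand of
the `i`-th bit is `y / 2 ^ i`, which has the parity of the `i`-th bit of `y`. -/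
def hashSum : List ℕ → ℕ → ℕ
  | [], _ => 0
  | a :: l, y => (if a = 0 then 0 else y) + hashSum l (y / 2)

/-- The one-bit hash function with the seed `a`: the inner product over the field with two elements
of `a` and the bits of `y`. -/
def hash (a : List ℕ) (y : ℕ) : ℕ := hashSum a y % 2

theorem hash_lt (a : List ℕ) (y : ℕ) : hash a y < 2 := Nat.mod_lt _ (by norm_num)

theorem ex_unif_one (f : ℕ → ℝ≥0∞) : ex (unif 1) f = 2⁻¹ * (f 0 + f 1) := by
  rw [ex_unif]
  simp [Finset.sum_range_succ]

/-- Two different numbers collide with probability one half. -/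
theorem ex_hash_ne {b x y : ℕ} (hx : x < 2 ^ b) (hy : y < 2 ^ b) (hxy : y ≠ x) :
    ex (tapes 1 b) (fun a => ind (hash a y ≠ hash a x)) = 2⁻¹ := by
  induction b generalizing x y with
  | zero => simp at hx hy; omega
  | succ b ih =>
    rw [ex_tapes_succ]
    simp only [ex_unif_one]
    by_cases h : y % 2 = x % 2
    · have ih' := ih (x := x / 2) (y := y / 2) (by rw [pow_succ] at hx; omega)
        (by rw [pow_succ] at hy; omega) (by omega)
      have h1 : ∀ a : List ℕ, ∀ c : ℕ, ind (hash (c :: a) y ≠ hash (c :: a) x) =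
          ind (hash a (y / 2) ≠ hash a (x / 2)) := by
        intro a c
        have : (hash (c :: a) y ≠ hash (c :: a) x) ↔ (hash a (y / 2) ≠ hash a (x / 2)) := by
          simp only [hash, hashSum]
          split_ifs <;> omega
        exact le_antisymm (ind_mono this.1) (ind_mono this.2)
      simp only [h1, ih']
      rw [← two_mul, ← mul_assoc, ENNReal.inv_mul_cancel (by norm_num) (by norm_num), one_mul]
    · have h1 : ∀ a : List ℕ, ind (hash (0 :: a) y ≠ hash (0 :: a) x) +
          ind (hash (1 :: a) y ≠ hash (1 :: a) x) = 1 := by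
        intro a
        have h2 : (hash (0 :: a) y ≠ hash (0 :: a) x) ↔ ¬(hash (1 :: a) y ≠ hash (1 :: a) x) := by
          simp only [hash, hashSum, if_true, one_ne_zero, if_false]
          omega
        by_cases h3 : hash (1 :: a) y ≠ hash (1 :: a) x
        · rw [ind_of_true h3, ind_of_false (fun h => h2.1 h h3), zero_add]
        · rw [ind_of_false h3, ind_of_true (h2.2 h3), add_zero]
      rw [← ex_add]
      simp only [h1, ex_const, mul_one]

/-- The message of a user: a level, the seed of a hash function, and a noisy bit. -/
structure Msg where
  level : ℕ
  seed : List ℕ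
  bit : ℕ

/-- The parameters of the local randomizer: hypotheses have `b` bits, levels are drawn with `l` coins,
and the bit is the true one with probability `2 ^ (-g)` and a fair coin otherwise. -/
structure LocalParams where
  b : ℕ
  l : ℕ
  g : ℕ

namespace LocalParams

variable (P : LocalParams)

/-- Most levels are the numbers of low-order bits that are removed from a hypothesis; the surplus
among the `2 ^ l` outcomes of the draw is assigned to level `0`. -/
def levelOf (j : ℕ) : ℕ := P.b - 1 - j

/-- The message of a user with hypothesis `h`, who has drawn `j`, `a`, `z` and `c`. -/
def msgOf (h j : ℕ) (a : List ℕ) (z c : ℕ) : Msg :=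
  ⟨P.levelOf j, a, if z = 0 then hash a (h / 2 ^ P.levelOf j) else c⟩

/-- The distribution of the message of a user with hypothesis `h`. -/
noncomputable def msgLaw (h : ℕ) : PMF Msg :=
  (unif P.l).bind fun j => (tapes 1 P.b).bind fun a => (unif P.g).bind fun z =>
    (unif 1).map fun c => P.msgOf h j a z c

/-- The expectation of `f` at the noisy version of the bit `t`. -/
noncomputable def noisy (t : ℕ) (f : ℕ → ℝ≥0∞) : ℝ≥0∞ :=
  (2 ^ P.g)⁻¹ * (f t + (2 ^ P.g - 1 : ℕ) * (2⁻¹ * (f 0 + f 1)))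

theorem ex_msgLaw (h : ℕ) (f : Msg → ℝ≥0∞) : ex (P.msgLaw h) f =
    ex (unif P.l) fun j => ex (tapes 1 P.b) fun a =>
      P.noisy (hash a (h / 2 ^ P.levelOf j)) fun t => f ⟨P.levelOf j, a, t⟩ := by
  simp only [msgLaw, ex_bind, ex_map]
  refine ex_congr fun j _ => ex_congr fun a _ => ?_
  rw [ex_unif, noisy]
  congr 1
  have h1 : ∀ z, (ex (unif 1) fun c => f (P.msgOf h j a z c)) =
      if z < 1 then f ⟨P.levelOf j, a, hash a (h / 2 ^ P.levelOf j)⟩ else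
        2⁻¹ * (f ⟨P.levelOf j, a, 0⟩ + f ⟨P.levelOf j, a, 1⟩) := by
    intro z
    rw [ex_unif_one]
    by_cases hz : z = 0
    · simp only [hz, msgOf, if_true, zero_lt_one, ← two_mul, ← mul_assoc]
      rw [ENNReal.inv_mul_cancel (by norm_num) (by norm_num), one_mul]
    · rw [if_neg (by omega)]
      simp only [msgOf, hz, if_false]
  simp only [h1]
  rw [sum_range_ite Nat.one_le_two_pow]
  simp

/-- The distribution `μ` is dominated by a multiple of `ν`. -/
def _root_.UserDP.Dom {Ω : Type*} (c : ℝ≥0∞) (μ ν : PMF Ω) : Prop := ∀ f, ex μ f ≤ c * ex ν f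

/-- Randomized response is private. -/
theorem dom_msgLaw {c : ℝ≥0∞} (hc : (2 ^ P.g + 1 : ℕ) ≤ c * (2 ^ P.g - 1 : ℕ)) (h h' : ℕ) :
    Dom c (P.msgLaw h) (P.msgLaw h') := by
  intro f
  rw [ex_msgLaw, ex_msgLaw, ← ex_mul_left]
  refine ex_mono fun j _ => ?_
  rw [← ex_mul_left]
  refine ex_mono fun a _ => ?_
  have h1 : f ⟨P.levelOf j, a, hash a (h / 2 ^ P.levelOf j)⟩ ≤
      f ⟨P.levelOf j, a, 0⟩ + f ⟨P.levelOf j, a, 1⟩ := by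
    have h2 := hash_lt a (h / 2 ^ P.levelOf j)
    generalize hash a (h / 2 ^ P.levelOf j) = t at *
    interval_cases t
    · exact le_self_add
    · exact le_add_self
  simp only [noisy]
  generalize f ⟨P.levelOf j, a, 0⟩ + f ⟨P.levelOf j, a, 1⟩ = B at *
  have h3 : 2 * (2⁻¹ * B) = B := by
    rw [← mul_assoc, ENNReal.mul_inv_cancel (by norm_num) (by norm_num), one_mul]
  rw [← h3] at h1
  rw [mul_left_comm c]
  gcongr
  calc _ ≤ 2 * (2⁻¹ * B) + (2 ^ P.g - 1 : ℕ) * (2⁻¹ * B) := by gcongr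
    _ = ((2 + (2 ^ P.g - 1) : ℕ) : ℝ≥0∞) * (2⁻¹ * B) := by push_cast; ring
    _ = (2 ^ P.g + 1 : ℕ) * (2⁻¹ * B) := by
        have := Nat.one_le_two_pow (n := P.g)
        congr 2
        omega
    _ ≤ c * (2 ^ P.g - 1 : ℕ) * (2⁻¹ * B) := by gcongr
    _ ≤ _ := by
        rw [mul_assoc]
        gcongr
        exact le_add_self

end LocalParams

theorem Dom.map {Ω Ω' : Type*} {c : ℝ≥0∞} {μ ν : PMF Ω} (h : Dom c μ ν) (g : Ω → Ω') :
    Dom c (μ.map g) (ν.map g) := fun f => by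
  rw [ex_map, ex_map]
  exact h _

theorem Dom.close {Ω : Type*} {ε : ℝ} {μ ν : PMF Ω} (h : Dom (ENNReal.ofReal (Real.exp ε)) μ ν) :
    Close ε 0 μ ν := fun O => by
  rw [toOuterMeasure_eq_ex, toOuterMeasure_eq_ex]
  exact (h _).trans le_self_add

theorem dom_messages {U : Type*} {c : ℝ≥0∞} {R : U → PMF Val} (hR : ∀ u u', Dom c (R u) (R u'))
    (S : List U) (i : ℕ) (u : U) (hi : i < S.length) :
    Dom c (messages R S) (messages R (S.set i u)) := by
  induction S generalizing i with
  | nil => simp at hi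
  | cons v S ih =>
    intro f
    cases i with
    | zero =>
      simp only [List.set_cons_zero, messages, ex_bind]
      exact hR v u _
    | succ i =>
      simp only [List.set_cons_succ, messages, ex_bind]
      rw [← ex_mul_left]
      refine ex_mono fun w _ => ?_
      simp only [ex_map]
      exact ih i (by simpa using hi) _

theorem isLocalDP_of_dom {U : Type*} {ε : ℝ} {G : PMF Val} {R : Val → U → PMF Val}
    (hR : ∀ r u u', Dom (ENNReal.ofReal (Real.exp ε)) (R r u) (R r u')) : IsLocalDP ε G R := by
  intro S i u hi
  refine Dom.close fun f => ?_
  simp only [transcript, ex_bind]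
  rw [← ex_mul_left]
  refine ex_mono fun r _ => ?_
  simp only [ex_map]
  exact dom_messages (hR r) S i u hi _

end Randomizer


/-! ### Scores of prefixes -/

section Scores

/-- Does the message support the number `y` of high-order bits that remain after the removal of `k`
low-order bits?  Only messages of level at least `k` are taken into account; they refer to prefixes
of `y`. -/
def support (k y : ℕ) (m : Msg) : ℕ :=
  if k ≤ m.level ∧ hash m.seed (y / 2 ^ (m.level - k)) = m.bit then 1 else 0

/-- The number of messages that support `y`. -/
def score (k y : ℕ) (ms : List Msg) : ℕ := (ms.map (support k y)).sum

namespace LocalParams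

variable (P : LocalParams)

/-- The distribution of the messages of users with the hypotheses `hs`. -/
noncomputable def msgs : List ℕ → PMF (List Msg)
  | [] => PMF.pure []
  | h :: hs => (P.msgLaw h).bind fun m => (msgs hs).map (m :: ·)

theorem ex_msgs_prod (hs : List ℕ) (f : Msg → ℝ≥0∞) :
    ex (P.msgs hs) (fun ms => (ms.map f).prod) = (hs.map fun h => ex (P.msgLaw h) f).prod := by
  induction hs with
  | nil => simp [msgs]
  | cons h hs ih =>
    simp only [msgs, ex_bind, ex_map, List.map_cons, List.prod_cons, ex_mul_left, ih]
    rw [mul_comm, ← ex_mul_left]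
    exact ex_congr fun m _ => mul_comm _ _

/-- The base of the exponential moments of score differences. -/
noncomputable def zeta : ℝ := 1 + 1 / (2 * 2 ^ P.g)

/-- The gain in the exponential moments that one level yields. -/
noncomputable def gain : ℝ := 1 / (8 * (2 ^ P.g) ^ 2)

theorem zeta_pos : 0 < P.zeta := by unfold zeta; positivity

theorem one_le_zeta : 1 ≤ P.zeta := by
  unfold zeta
  have : 0 < 1 / (2 * (2 : ℝ) ^ P.g) := by positivity
  linarith

theorem gain_pos : 0 < P.gain := by unfold gain; positivity

theorem gain_le : P.gain ≤ 1 / 8 := by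
  unfold gain
  have h1 : (1 : ℝ) ≤ (2 ^ P.g) ^ 2 := one_le_pow₀ (one_le_pow₀ (by norm_num))
  gcongr
  linarith

/-- The exponential moment of one noisy bit; here `z` and `z'` are the values of the two outcomes. -/
theorem noisy_le {z z' : ℝ} (hz : 0 ≤ z) (hz' : 0 ≤ z') {t : ℕ} {f : ℕ → ℝ≥0∞} {B : ℝ}
    (ht : f t ≤ ENNReal.ofReal z) (hf : f 0 + f 1 = ENNReal.ofReal z')
    (hB : z + (2 ^ P.g - 1) * (z' / 2) ≤ 2 ^ P.g * B) : P.noisy t f ≤ ENNReal.ofReal B := by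
  have h2 : (0 : ℝ) < 2 ^ P.g := by positivity
  have h21 : (1 : ℝ) ≤ 2 ^ P.g := one_le_pow₀ (by norm_num)
  have h3 : ((2 : ℝ≥0∞) ^ P.g)⁻¹ = ENNReal.ofReal ((2 ^ P.g)⁻¹) := by
    rw [ENNReal.ofReal_inv_of_pos h2, ENNReal.ofReal_pow (by norm_num)]
    simp
  have h4 : ((2 ^ P.g - 1 : ℕ) : ℝ≥0∞) = ENNReal.ofReal (2 ^ P.g - 1) := by
    rw [← ENNReal.ofReal_natCast, Nat.cast_sub Nat.one_le_two_pow]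
    simp
  have h5 : (2 : ℝ≥0∞)⁻¹ = ENNReal.ofReal 2⁻¹ := by
    rw [ENNReal.ofReal_inv_of_pos (by norm_num)]
    simp
  unfold noisy
  calc _ ≤ (2 ^ P.g)⁻¹ * (ENNReal.ofReal z + (2 ^ P.g - 1 : ℕ) * (2⁻¹ * ENNReal.ofReal z')) := by
        rw [hf]; gcongr
    _ = ENNReal.ofReal ((2 ^ P.g)⁻¹ * (z + (2 ^ P.g - 1) * (2⁻¹ * z'))) := by
        rw [h3, h4, h5, ← ENNReal.ofReal_mul (by norm_num), ← ENNReal.ofReal_mul (by linarith),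
          ← ENNReal.ofReal_add hz (mul_nonneg (by linarith) (by positivity)),
          ← ENNReal.ofReal_mul (by positivity)]
    _ ≤ _ := by
        refine ENNReal.ofReal_le_ofReal ?_
        rw [inv_mul_le_iff₀ h2]
        linarith

theorem zeta_inv_le : P.zeta⁻¹ ≤ 1 - 1 / (2 * 2 ^ P.g) + 2 * P.gain := by
  rw [inv_le_iff_one_le_mul₀' P.zeta_pos]
  have h : 2 * P.gain = (1 / (2 * 2 ^ P.g)) ^ 2 := by unfold gain; field_simp; norm_num
  have h0 : 0 < 1 / (2 * (2 : ℝ) ^ P.g) := by positivity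
  rw [h, zeta]
  nlinarith [pow_pos h0 3]

/-- A reliable bit favours the truth. -/
theorem zeta_right : P.zeta⁻¹ + (2 ^ P.g - 1) * ((P.zeta + P.zeta⁻¹) / 2) ≤
    2 ^ P.g * (1 - 2 * P.gain) := by
  have h1 := P.zeta_inv_le
  have h21 : (1 : ℝ) ≤ 2 ^ P.g := one_le_pow₀ (by norm_num)
  have h2 : P.zeta = 1 + 1 / (2 * 2 ^ P.g) := rfl
  have h3 : 1 / (2 * 2 ^ P.g) = 4 * 2 ^ P.g * P.gain := by unfold gain; field_simp; norm_num
  have h4 := P.gain_pos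
  rw [h3] at h1 h2
  rw [h2] at h1 ⊢
  generalize (1 + 4 * 2 ^ P.g * P.gain)⁻¹ = y at *
  generalize (2 : ℝ) ^ P.g = G at *
  generalize P.gain = d at *
  nlinarith [mul_nonneg (sub_nonneg.2 h21) (sub_nonneg.2 h1), mul_nonneg (sub_nonneg.2 h21) h4.le]

/-- A bit of a user who does not hold the truth may favour a competitor. -/
theorem zeta_wrong : P.zeta + (2 ^ P.g - 1) * ((P.zeta + P.zeta⁻¹) / 2) ≤
    2 ^ P.g * (1 + 6 * P.gain) := by
  have h1 := P.zeta_inv_le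
  have h21 : (1 : ℝ) ≤ 2 ^ P.g := one_le_pow₀ (by norm_num)
  have h2 : P.zeta = 1 + 1 / (2 * 2 ^ P.g) := rfl
  have h3 : 1 / (2 * 2 ^ P.g) = 4 * 2 ^ P.g * P.gain := by unfold gain; field_simp; norm_num
  have h4 := P.gain_pos
  rw [h3] at h1 h2
  rw [h2] at h1 ⊢
  generalize (1 + 4 * 2 ^ P.g * P.gain)⁻¹ = y at *
  generalize (2 : ℝ) ^ P.g = G at *
  generalize P.gain = d at *
  nlinarith [mul_nonneg (sub_nonneg.2 h21) (sub_nonneg.2 h1), mul_nonneg (sub_nonneg.2 h21) h4.le]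

/-- The exponential of the difference of the support of `y` and the support of `x`. -/
noncomputable def weightOf (k x y : ℕ) (m : Msg) : ℝ≥0∞ :=
  ENNReal.ofReal P.zeta ^ support k y m * ENNReal.ofReal P.zeta⁻¹ ^ support k x m

theorem ofReal_zeta_mul_inv : ENNReal.ofReal P.zeta * ENNReal.ofReal P.zeta⁻¹ = 1 := by
  rw [← ENNReal.ofReal_mul P.zeta_pos.le, mul_inv_cancel₀ P.zeta_pos.ne', ENNReal.ofReal_one]

theorem weightOf_eq_one {k x y : ℕ} {m : Msg} (h : support k y m = support k x m) :
    P.weightOf k x y m = 1 := by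
  rw [weightOf, h, ← mul_pow, ofReal_zeta_mul_inv, one_pow]

/-- The exponential form of Markov's inequality. -/
theorem ind_score_le (k x y : ℕ) (ms : List Msg) :
    ind (score k x ms ≤ score k y ms) ≤ (ms.map (P.weightOf k x y)).prod := by
  have h1 : (ms.map (P.weightOf k x y)).prod =
      ENNReal.ofReal P.zeta ^ score k y ms * ENNReal.ofReal P.zeta⁻¹ ^ score k x ms := by
    induction ms with
    | nil => simp [score]
    | cons m ms ih =>
      simp only [score, List.map_cons, List.prod_cons, List.sum_cons, pow_add] at ih ⊢
      rw [ih, weightOf]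
      ring
  by_cases h : score k x ms ≤ score k y ms
  · rw [ind_of_true h, h1]
    obtain ⟨d, hd⟩ := Nat.exists_eq_add_of_le h
    rw [hd, pow_add, mul_right_comm, ← mul_pow, ofReal_zeta_mul_inv, one_pow, one_mul]
    refine one_le_pow₀ ?_
    rw [← ENNReal.ofReal_one]
    exact ENNReal.ofReal_le_ofReal P.one_le_zeta
  · rw [ind_of_false h]
    exact zero_le

theorem noisy_one (t : ℕ) : P.noisy t (fun _ => 1) = 1 := by
  have h := Nat.one_le_two_pow (n := P.g)
  have h1 : (1 : ℝ≥0∞) + (2 ^ P.g - 1 : ℕ) = 2 ^ P.g := by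
    have : 1 + (2 ^ P.g - 1) = 2 ^ P.g := by omega
    exact_mod_cast congrArg (Nat.cast : ℕ → ℝ≥0∞) this
  rw [noisy, one_add_one_eq_two, ENNReal.inv_mul_cancel (by norm_num) (by norm_num), mul_one, h1,
    ENNReal.inv_mul_cancel (by simp) (by simp)]

/-- The expected weight of a message of a fixed level at which `x` and `y` have different
prefixes. -/
theorem ex_noisy_weightOf_le {k x y j t' : ℕ} {B : ℝ} (hB : 0 ≤ 1 + 2 * B)
    (hk : k ≤ P.levelOf j) (hx : x < 2 ^ P.b) (hy : y < 2 ^ P.b)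
    (hxy : y / 2 ^ (P.levelOf j - k) ≠ x / 2 ^ (P.levelOf j - k))
    (h : ∀ (a : List ℕ) (f : ℕ → ℝ≥0∞),
      f (hash a (y / 2 ^ (P.levelOf j - k))) = ENNReal.ofReal P.zeta →
      f (hash a (x / 2 ^ (P.levelOf j - k))) = ENNReal.ofReal P.zeta⁻¹ →
      f 0 + f 1 = ENNReal.ofReal (P.zeta + P.zeta⁻¹) →
      P.noisy (hash a t') f ≤ ENNReal.ofReal (1 + 2 * B)) :
    ex (tapes 1 P.b) (fun a => P.noisy (hash a t') fun t => P.weightOf k x y ⟨P.levelOf j, a, t⟩) ≤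
      ENNReal.ofReal (1 + B) := by
  set x' := x / 2 ^ (P.levelOf j - k) with hx'
  set y' := y / 2 ^ (P.levelOf j - k) with hy'
  have hne := ex_hash_ne ((Nat.div_le_self _ _).trans_lt hx : x' < 2 ^ P.b)
    ((Nat.div_le_self _ _).trans_lt hy : y' < 2 ^ P.b) hxy
  have heq : ex (tapes 1 P.b) (fun a => ind (hash a y' = hash a x')) = 2⁻¹ := by
    have h1 : ex (tapes 1 P.b) (fun a => ind (hash a y' = hash a x')) + 2⁻¹ = 2⁻¹ + 2⁻¹ := by
      rw [← hne, ← ex_add, hne, ENNReal.inv_two_add_inv_two, ← ex_const (tapes 1 P.b) 1]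
      refine ex_congr fun a _ => ?_
      by_cases hc : hash a y' = hash a x'
      · rw [ind_of_true hc, ind_of_false (not_not.2 hc), add_zero]
      · rw [ind_of_false hc, ind_of_true hc, zero_add]
    exact (ENNReal.add_left_inj (by norm_num)).1 h1
  calc _ ≤ ex (tapes 1 P.b) fun a => ind (hash a y' = hash a x') +
        ENNReal.ofReal (1 + 2 * B) * ind (hash a y' ≠ hash a x') := by
        refine ex_mono fun a _ => ?_
        by_cases hc : hash a y' = hash a x'
        · have h1 : ∀ t, P.weightOf k x y ⟨P.levelOf j, a, t⟩ = 1 := fun t =>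
            P.weightOf_eq_one (by simp only [support, ← hx', ← hy', hc])
          simp only [h1, noisy_one, ind_of_true hc]
          exact le_self_add
        · rw [ind_of_false hc, ind_of_true hc, mul_one, zero_add]
          have hyx : P.weightOf k x y ⟨P.levelOf j, a, hash a y'⟩ = ENNReal.ofReal P.zeta := by
            simp [weightOf, support, hk, ← hx', ← hy', Ne.symm hc]
          have hxy : P.weightOf k x y ⟨P.levelOf j, a, hash a x'⟩ = ENNReal.ofReal P.zeta⁻¹ := by
            simp [weightOf, support, hk, ← hx', ← hy', hc]
          refine h a _ hyx hxy ?_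
          rw [ENNReal.ofReal_add P.zeta_pos.le (inv_nonneg.2 P.zeta_pos.le), ← hyx, ← hxy]
          have h1 := hash_lt a x'
          have h2 := hash_lt a y'
          generalize hash a x' = u at *
          generalize hash a y' = v at *
          interval_cases u <;> interval_cases v
          · exact absurd rfl hc
          · exact add_comm _ _
          · rfl
          · exact absurd rfl hc
    _ = 2⁻¹ + ENNReal.ofReal (1 + 2 * B) * 2⁻¹ := by rw [ex_add, ex_mul_left, heq, hne]
    _ = ENNReal.ofReal (1 + B) := by
        have h5 : (2 : ℝ≥0∞)⁻¹ = ENNReal.ofReal 2⁻¹ := by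
          rw [ENNReal.ofReal_inv_of_pos (by norm_num)]
          simp
        rw [h5, ← ENNReal.ofReal_mul hB, ← ENNReal.ofReal_add (by norm_num) (by positivity)]
        congr 1
        ring

/-- The draws whose levels distinguish `x` and `y`. -/
def diverging (k x y : ℕ) : Finset ℕ := (Finset.range (2 ^ P.l)).filter fun j =>
  k ≤ P.levelOf j ∧ y / 2 ^ (P.levelOf j - k) ≠ x / 2 ^ (P.levelOf j - k)

/-- The expected weight of a message, if `1 + B` bounds it for every level that distinguishes `x`
and `y`. -/
theorem ex_msgLaw_weightOf_le {k x y h : ℕ} {B : ℝ} (hB : -1 ≤ B)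
    (hj : ∀ j ∈ P.diverging k x y, ex (tapes 1 P.b) (fun a =>
      P.noisy (hash a (h / 2 ^ P.levelOf j)) fun t => P.weightOf k x y ⟨P.levelOf j, a, t⟩) ≤
        ENNReal.ofReal (1 + B)) :
    ex (P.msgLaw h) (P.weightOf k x y) ≤
      ENNReal.ofReal ((1 + B / 2 ^ P.l) ^ (P.diverging k x y).card) := by
  classical
  have h1 : ∀ j ∈ Finset.range (2 ^ P.l), ex (tapes 1 P.b) (fun a =>
      P.noisy (hash a (h / 2 ^ P.levelOf j)) fun t => P.weightOf k x y ⟨P.levelOf j, a, t⟩) ≤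
      ENNReal.ofReal (1 + if j ∈ P.diverging k x y then B else 0) := by
    intro j hjr
    by_cases hd : j ∈ P.diverging k x y
    · rw [if_pos hd]
      exact hj j hd
    · rw [if_neg hd]
      have h2 : ∀ a t, P.weightOf k x y ⟨P.levelOf j, a, t⟩ = 1 := by
        intro a t
        refine P.weightOf_eq_one ?_
        simp only [diverging, Finset.mem_filter, hjr, true_and, not_and, not_not] at hd
        simp only [support]
        by_cases hk : k ≤ P.levelOf j
        · rw [hd hk]
        · simp [hk]
      simp [h2, noisy_one]
  have hl : (0 : ℝ) < 2 ^ P.l := by positivity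
  have hl1 : (1 : ℝ) ≤ 2 ^ P.l := one_le_pow₀ (by norm_num)
  have h3 : ((2 : ℝ≥0∞) ^ P.l)⁻¹ = ENNReal.ofReal ((2 ^ P.l)⁻¹) := by
    rw [ENNReal.ofReal_inv_of_pos hl, ENNReal.ofReal_pow (by norm_num)]
    simp
  have h4 : -1 ≤ B / 2 ^ P.l := by
    rw [le_div_iff₀ hl]
    linarith
  rw [ex_msgLaw, ex_unif]
  calc _ ≤ (2 ^ P.l)⁻¹ * ∑ j ∈ Finset.range (2 ^ P.l),
        ENNReal.ofReal (1 + if j ∈ P.diverging k x y then B else 0) := by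
        gcongr with j hj
        exact h1 j hj
    _ = ENNReal.ofReal (1 + (P.diverging k x y).card * (B / 2 ^ P.l)) := by
        rw [← ENNReal.ofReal_sum_of_nonneg (fun j _ => by split_ifs <;> linarith), h3,
          ← ENNReal.ofReal_mul (by positivity), Finset.sum_add_distrib, ← Finset.sum_filter,
          Finset.filter_mem_eq_inter, Finset.inter_eq_right.2 (show P.diverging k x y ⊆ _ from Finset.filter_subset _ _)]
        simp only [Finset.sum_const, Finset.card_range, nsmul_eq_mul, mul_one]
        congr 1
        push_cast
        field_simp
    _ ≤ _ := ENNReal.ofReal_le_ofReal (one_add_mul_le_pow (by linarith) _)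

/-- A user who holds the truth favours it on average. -/
theorem ex_msgLaw_right {ref k y : ℕ} (href : ref < 2 ^ P.b) (hy : y < 2 ^ P.b) :
    ex (P.msgLaw ref) (P.weightOf k (ref / 2 ^ k) y) ≤
      ENNReal.ofReal ((1 - P.gain / 2 ^ P.l) ^ (P.diverging k (ref / 2 ^ k) y).card) := by
  have hg := P.gain_le
  have hg0 := P.gain_pos
  refine (P.ex_msgLaw_weightOf_le (B := -P.gain) (by linarith) fun j hj => ?_).trans
    (by rw [neg_div, ← sub_eq_add_neg])
  simp only [diverging, Finset.mem_filter] at hj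
  refine P.ex_noisy_weightOf_le (by linarith) hj.2.1 ((Nat.div_le_self _ _).trans_lt href) hy hj.2.2
    fun a f _ h2 h3 => ?_
  have h4 : ref / 2 ^ P.levelOf j = ref / 2 ^ k / 2 ^ (P.levelOf j - k) := by
    rw [Nat.div_div_eq_div_mul, ← pow_add, Nat.add_sub_cancel' hj.2.1]
  rw [h4]
  refine P.noisy_le (inv_nonneg.2 P.zeta_pos.le)
    (add_nonneg P.zeta_pos.le (inv_nonneg.2 P.zeta_pos.le)) h2.le h3 ?_
  have := P.zeta_right
  linarith

/-- A user who holds another hypothesis does limited harm. -/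
theorem ex_msgLaw_wrong {x k y : ℕ} (h : ℕ) (hx : x < 2 ^ P.b) (hy : y < 2 ^ P.b) :
    ex (P.msgLaw h) (P.weightOf k x y) ≤
      ENNReal.ofReal ((1 + 3 * (P.gain / 2 ^ P.l)) ^ (P.diverging k x y).card) := by
  have hg0 := P.gain_pos
  refine (P.ex_msgLaw_weightOf_le (B := 3 * P.gain) (by linarith) fun j hj => ?_).trans
    (by rw [mul_div_assoc])
  simp only [diverging, Finset.mem_filter] at hj
  refine P.ex_noisy_weightOf_le (by linarith) hj.2.1 hx hy hj.2.2 fun a f h1 h2 h3 => ?_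
  have h5 : f (hash a (h / 2 ^ P.levelOf j)) ≤ ENNReal.ofReal P.zeta := by
    have hz : ENNReal.ofReal P.zeta⁻¹ ≤ ENNReal.ofReal P.zeta :=
      ENNReal.ofReal_le_ofReal ((inv_le_one_of_one_le₀ P.one_le_zeta).trans P.one_le_zeta)
    rw [ENNReal.ofReal_add P.zeta_pos.le (inv_nonneg.2 P.zeta_pos.le)] at h3
    have hu := hash_lt a (h / 2 ^ P.levelOf j)
    have hv := hash_lt a (y / 2 ^ (P.levelOf j - k))
    generalize hash a (h / 2 ^ P.levelOf j) = u at *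
    generalize hash a (y / 2 ^ (P.levelOf j - k)) = v at *
    interval_cases u <;> interval_cases v
    · exact h1.le
    · rw [h1, add_comm, ENNReal.add_right_inj (by simp)] at h3
      rw [h3]
      exact hz
    · rw [h1, ENNReal.add_right_inj (by simp)] at h3
      rw [h3]
      exact hz
    · exact h1.le
  refine P.noisy_le P.zeta_pos.le
    (add_nonneg P.zeta_pos.le (inv_nonneg.2 P.zeta_pos.le)) h5 h3 ?_
  have := P.zeta_wrong
  linarith

end LocalParams

/-- If nine tenths of the factors are `1 - η` and the others are `1 + 3 * η`, then the product
decreases exponentially. -/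
theorem pow_mul_pow_le {η : ℝ} (h0 : 0 < η) (h1 : η ≤ 1) {c w : ℕ} (hw : 9 * w ≤ c)
    (hη : 3 ≤ (c - 3 * w : ℕ) * η) : (1 - η) ^ c * (1 + 3 * η) ^ w ≤ 1 / 4 := by
  obtain ⟨d, rfl⟩ : ∃ d, c = d + 3 * w := ⟨c - 3 * w, by omega⟩
  rw [Nat.add_sub_cancel] at hη
  have h2 : (1 - η) ^ 3 * (1 + 3 * η) ≤ 1 := by nlinarith [sq_nonneg η, pow_pos h0 3, sq_nonneg (η ^ 2)]
  have h3 : 0 ≤ 1 - η := by linarith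
  have h4 : (1 - η) ^ d * (1 + d * η) ≤ 1 := by
    calc (1 - η) ^ d * (1 + d * η) ≤ (1 - η) ^ d * (1 + η) ^ d := by
          gcongr
          exact one_add_mul_le_pow (by linarith) d
      _ = ((1 - η) * (1 + η)) ^ d := (mul_pow _ _ _).symm
      _ ≤ 1 := pow_le_one₀ (mul_nonneg h3 (by linarith)) (by nlinarith)
  calc (1 - η) ^ (d + 3 * w) * (1 + 3 * η) ^ w =
        (1 - η) ^ d * ((1 - η) ^ 3 * (1 + 3 * η)) ^ w := by rw [pow_add, mul_pow, pow_mul]; ring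
    _ ≤ (1 - η) ^ d * 1 := by
        gcongr
        exact pow_le_one₀ (by positivity) h2
    _ ≤ 1 / 4 := by
        rw [mul_one]
        have h5 := pow_nonneg h3 d
        nlinarith

namespace LocalParams

variable (P : LocalParams)

/-- It is exponentially unlikely that `y` has at least the score of the truth, in the number of draws
of a level that distinguish `y` from the truth. -/
theorem ex_score_le {ref k y : ℕ} (href : ref < 2 ^ P.b) (hy : y < 2 ^ P.b) {hs : List ℕ}
    (hn : hs.length = 40 * 2 ^ P.l * (2 ^ P.g) ^ 2)
    (hw : 10 * (hs.length - hs.count ref) ≤ hs.length) :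
    ex (P.msgs hs) (fun ms => ind (score k (ref / 2 ^ k) ms ≤ score k y ms)) ≤
      4⁻¹ ^ (P.diverging k (ref / 2 ^ k) y).card := by
  set N := (P.diverging k (ref / 2 ^ k) y).card with hN
  set η := P.gain / 2 ^ P.l with hη
  have hη0 : 0 < η := div_pos P.gain_pos (by positivity)
  have hη1 : η ≤ 1 := (div_le_self P.gain_pos.le (one_le_pow₀ (by norm_num))).trans
    (P.gain_le.trans (by norm_num))
  have h1 : ∀ hs : List ℕ, (hs.map fun h => ex (P.msgLaw h) (P.weightOf k (ref / 2 ^ k) y)).prod ≤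
      ENNReal.ofReal ((1 - η) ^ N) ^ hs.count ref *
        ENNReal.ofReal ((1 + 3 * η) ^ N) ^ (hs.length - hs.count ref) := by
    intro hs
    induction hs with
    | nil => simp
    | cons h hs ih =>
      have hc := hs.count_le_length (a := ref)
      rw [List.map_cons, List.prod_cons, List.count_cons, List.length_cons]
      by_cases hh : h = ref
      · subst hh
        simp only [beq_self_eq_true, if_true, Nat.add_sub_add_right]
        rw [pow_succ', mul_assoc]
        exact mul_le_mul' (P.ex_msgLaw_right href hy) ih
      · simp only [beq_iff_eq, hh, if_false, add_zero]
        rw [show hs.length + 1 - hs.count ref = hs.length - hs.count ref + 1 by omega, pow_succ',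
          mul_left_comm]
        exact mul_le_mul' (P.ex_msgLaw_wrong h ((Nat.div_le_self _ _).trans_lt href) hy) ih
  refine (ex_mono fun ms _ => P.ind_score_le k (ref / 2 ^ k) y ms).trans ?_
  rw [P.ex_msgs_prod]
  refine (h1 hs).trans ?_
  have hc := hs.count_le_length (a := ref)
  have h3 : (1 - η) ^ hs.count ref * (1 + 3 * η) ^ (hs.length - hs.count ref) ≤ 1 / 4 := by
    refine pow_mul_pow_le hη0 hη1 (by omega) ?_
    have h4 : 24 * 2 ^ P.l * (2 ^ P.g) ^ 2 ≤ hs.count ref - 3 * (hs.length - hs.count ref) := by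
      rw [mul_assoc] at hn ⊢
      omega
    have h5 : ((24 * 2 ^ P.l * (2 ^ P.g) ^ 2 : ℕ) : ℝ) * η = 3 := by
      rw [hη, gain]
      push_cast
      field_simp
      norm_num
    rw [← h5]
    gcongr
  rw [← ENNReal.ofReal_pow (pow_nonneg (by linarith) _), ← ENNReal.ofReal_pow (by positivity),
    ← ENNReal.ofReal_mul (by have : 0 ≤ 1 - η := by linarith
                             positivity), ← pow_mul, ← pow_mul, mul_comm N, mul_comm N, pow_mul,
    pow_mul, ← mul_pow]
  have h6 : (4⁻¹ : ℝ≥0∞) = ENNReal.ofReal (1 / 4) := by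
    rw [one_div, ENNReal.ofReal_inv_of_pos (by norm_num)]
    simp
  rw [h6, ← ENNReal.ofReal_pow (by norm_num)]
  refine ENNReal.ofReal_le_ofReal (pow_le_pow_left₀ ?_ h3 N)
  have : 0 ≤ 1 - η := by linarith
  positivity

end LocalParams

end Scores


/-! ### Decoding by a search through the prefixes -/

section Decoding

/-- The number of messages of level `k` that support `y`. -/
def levelCount (k y : ℕ) (ms : List Msg) : ℕ :=
  (ms.map fun m => if m.level = k ∧ hash m.seed y = m.bit then 1 else 0).sum

theorem score_eq_add (k y : ℕ) (ms : List Msg) :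
    score k y ms = score (k + 1) (y / 2) ms + levelCount k y ms := by
  induction ms with
  | nil => rfl
  | cons m ms ih =>
    have h1 : support k y m = support (k + 1) (y / 2) m +
        if m.level = k ∧ hash m.seed y = m.bit then 1 else 0 := by
      obtain h | h | h : m.level < k ∨ m.level = k ∨ k + 1 ≤ m.level := by omega
      · simp [support, show ¬k ≤ m.level by omega, show ¬k + 1 ≤ m.level by omega,
          show m.level ≠ k by omega]
      · simp [support, h]
      · have h2 : y / 2 ^ (m.level - k) = y / 2 / 2 ^ (m.level - (k + 1)) := by
          rw [Nat.div_div_eq_div_mul, ← pow_succ']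
          congr 2
          omega
        simp [support, h, h2, show k ≤ m.level by omega, show m.level ≠ k by omega]
    simp only [score, levelCount, List.map_cons, List.sum_cons] at ih ⊢
    rw [ih, h1]
    ring

theorem score_top {b : ℕ} {ms : List Msg} (h : ∀ m ∈ ms, m.level < b) (y : ℕ) :
    score b y ms = 0 := by
  refine List.sum_eq_zero fun n hn => ?_
  obtain ⟨m, hm, rfl⟩ := List.mem_map.1 hn
  simp [support, h m hm]

/-- Replace the candidates, which are prefixes with their scores, by their extensions by one bit. -/
def expand (ms : List Msg) (k : ℕ) (cs : List (ℕ × ℕ)) : List (ℕ × ℕ) :=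
  cs.foldl (fun acc c => (2 * c.1, c.2 + levelCount k (2 * c.1) ms) ::
    (2 * c.1 + 1, c.2 + levelCount k (2 * c.1 + 1) ms) :: acc) []

/-- The number of candidates with a score of at least `s`. -/
def rank (cs : List (ℕ × ℕ)) (s : ℕ) : ℕ := cs.countP fun c => s ≤ c.2

/-- Keep the candidates of rank at most `L`. -/
def prune (L : ℕ) (cs : List (ℕ × ℕ)) : List (ℕ × ℕ) :=
  cs.foldl (fun acc c => if rank cs c.2 ≤ L then c :: acc else acc) []

/-- One stage of the search; the state is the number of bits that are still missing, and the list of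
candidates. -/
def stage (ms : List Msg) (L : ℕ) (s : ℕ × List (ℕ × ℕ)) : ℕ × List (ℕ × ℕ) :=
  (s.1 - 1, prune L (expand ms (s.1 - 1) s.2))

/-- A candidate of maximal score, with this score plus one. -/
def best (cs : List (ℕ × ℕ)) : ℕ × ℕ :=
  cs.foldl (fun s c => if s.2 < c.2 + 1 then (c.1, c.2 + 1) else s) (0, 0)

/-- The hypothesis that the search finds. -/
def decode (b L : ℕ) (ms : List Msg) : ℕ := (best ((stage ms L)^[b] (b, [(0, 0)])).2).1

theorem expand_eq (ms : List Msg) (k : ℕ) (cs : List (ℕ × ℕ)) : expand ms k cs =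
    (cs.reverse.flatMap fun c => [(2 * c.1, c.2 + levelCount k (2 * c.1) ms),
      (2 * c.1 + 1, c.2 + levelCount k (2 * c.1 + 1) ms)]) := by
  have : ∀ (cs acc : List (ℕ × ℕ)), cs.foldl (fun acc c =>
      (2 * c.1, c.2 + levelCount k (2 * c.1) ms) ::
      (2 * c.1 + 1, c.2 + levelCount k (2 * c.1 + 1) ms) :: acc) acc =
      (cs.reverse.flatMap fun c => [(2 * c.1, c.2 + levelCount k (2 * c.1) ms),
      (2 * c.1 + 1, c.2 + levelCount k (2 * c.1 + 1) ms)]) ++ acc := by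
    intro cs
    induction cs with
    | nil => simp
    | cons c cs ih => intro acc; simp [ih]
  rw [expand, this, List.append_nil]

theorem prune_eq (L : ℕ) (cs : List (ℕ × ℕ)) :
    prune L cs = (cs.filter fun c => rank cs c.2 ≤ L).reverse := by
  have : ∀ (p : ℕ × ℕ → Prop) [DecidablePred p] (cs acc : List (ℕ × ℕ)),
      cs.foldl (fun acc c => if p c then c :: acc else acc) acc =
      (cs.filter fun c => p c).reverse ++ acc := by
    intro p _ cs
    induction cs with
    | nil => simp
    | cons c cs ih =>
      intro acc
      rw [List.foldl_cons, ih, List.filter_cons]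
      by_cases h : p c <;> simp [h]
  rw [prune, this, List.append_nil]

/-- At most `L` candidates survive, since the candidate of lowest score among them has at least as large
a rank as there are survivors. -/
theorem length_prune_le (L : ℕ) (cs : List (ℕ × ℕ)) : (prune L cs).length ≤ L := by
  rw [prune_eq, List.length_reverse]
  by_cases h : (cs.filter fun c => rank cs c.2 ≤ L) = []
  · rw [h]
    exact Nat.zero_le _
  · set ks := cs.filter fun c => rank cs c.2 ≤ L with hks
    obtain ⟨c, hc, hmin⟩ : ∃ c ∈ ks, ∀ c' ∈ ks, c.2 ≤ c'.2 := by
      obtain ⟨c, hc, h⟩ := ks.toFinset.exists_min_image Prod.snd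
        (by simpa [Finset.nonempty_iff_ne_empty] using h)
      exact ⟨c, List.mem_toFinset.1 hc, fun c' hc' => h c' (List.mem_toFinset.2 hc')⟩
    have h1 : rank cs c.2 ≤ L := by
      have := List.mem_filter.1 hc
      simpa using this.2
    refine le_trans ?_ h1
    have h2 : ks.countP (fun c' => c.2 ≤ c'.2) = ks.length :=
      List.countP_eq_length.2 fun c' hc' => by simpa using hmin c' hc'
    rw [← h2]
    exact List.filter_sublist.countP_le

/-- The invariant of the search: the candidates are different prefixes of the right length with their correct scores. -/
def Valid (b : ℕ) (ms : List Msg) (k : ℕ) (cs : List (ℕ × ℕ)) : Prop :=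
  (cs.map Prod.fst).Nodup ∧ ∀ c ∈ cs, c.1 < 2 ^ (b - k) ∧ c.2 = score k c.1 ms

theorem Valid.expand {b k : ℕ} {ms : List Msg} {cs : List (ℕ × ℕ)} (h : Valid b ms (k + 1) cs)
    (hk : k < b) : Valid b ms k (expand ms k cs) := by
  rw [expand_eq]
  constructor
  · rw [List.map_flatMap, List.nodup_flatMap]
    refine ⟨fun c _ => by simp, ?_⟩
    have h1 : cs.reverse.Pairwise fun c c' => c.1 ≠ c'.1 := by
      rw [List.pairwise_reverse]
      exact (List.pairwise_map.1 h.1).imp Ne.symm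
    refine h1.imp fun {c c'} hne => ?_
    simp only [Function.onFun, List.map_cons, List.map_nil, List.disjoint_left, List.mem_cons,
      List.not_mem_nil, or_false]
    omega
  · intro c hc
    obtain ⟨c', hc', hc⟩ := List.mem_flatMap.1 hc
    obtain ⟨h1, h2⟩ := h.2 c' (List.mem_reverse.1 hc')
    have h3 : 2 ^ (b - k) = 2 * 2 ^ (b - (k + 1)) := by
      rw [← pow_succ']
      congr 1
      omega
    simp only [List.mem_cons, List.not_mem_nil, or_false] at hc
    rcases hc with rfl | rfl
    · refine ⟨by simp only; omega, ?_⟩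
      rw [score_eq_add, h2]
      simp only
      rw [show 2 * c'.1 / 2 = c'.1 by omega]
    · refine ⟨by simp only; omega, ?_⟩
      rw [score_eq_add, h2]
      simp only
      rw [show (2 * c'.1 + 1) / 2 = c'.1 by omega]

theorem Valid.prune {b k L : ℕ} {ms : List Msg} {cs : List (ℕ × ℕ)} (h : Valid b ms k cs) :
    Valid b ms k (prune L cs) := by
  rw [prune_eq]
  constructor
  · rw [List.map_reverse, List.nodup_reverse]
    exact h.1.sublist (List.filter_sublist.map _)
  · intro c hc
    exact h.2 c (List.mem_of_mem_filter (List.mem_reverse.1 hc))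

/-- The competitors of `x`. -/
def competitors (b k x : ℕ) (ms : List Msg) : Finset ℕ :=
  (Finset.range (2 ^ (b - k))).filter fun y => y ≠ x ∧ score k x ms ≤ score k y ms

theorem rank_le {b k x : ℕ} {ms : List Msg} {cs : List (ℕ × ℕ)} (h : Valid b ms k cs) :
    rank cs (score k x ms) ≤ (competitors b k x ms).card + 1 := by
  rw [rank, List.countP_eq_length_filter]
  set ks := cs.filter fun c => score k x ms ≤ c.2 with hks
  have h1 : (ks.map Prod.fst).Nodup := h.1.sublist (List.filter_sublist.map _)
  rw [← List.length_map (f := Prod.fst), ← List.toFinset_card_of_nodup h1]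
  refine (Finset.card_le_card ?_).trans (Finset.card_insert_le x _)
  intro y hy
  obtain ⟨c, hc, rfl⟩ := List.mem_map.1 (List.mem_toFinset.1 hy)
  obtain ⟨hc1, hc2⟩ := List.mem_filter.1 hc
  obtain ⟨h2, h3⟩ := h.2 c hc1
  simp only [decide_eq_true_eq, h3] at hc2
  by_cases hx : c.1 = x
  · simp [hx]
  · simp [competitors, hx, h2, hc2]

theorem best_eq {cs : List (ℕ × ℕ)} {x s : ℕ} (hx : (x, s) ∈ cs)
    (h : ∀ c ∈ cs, c = (x, s) ∨ c.2 < s) : (best cs).1 = x := by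
  have key : ∀ (l : List (ℕ × ℕ)) (r : ℕ × ℕ), (∀ c ∈ l, c = (x, s) ∨ c.2 < s) →
      (r = (x, s + 1) ∨ r.2 ≤ s ∧ (x, s) ∈ l) →
      l.foldl (fun s c => if s.2 < c.2 + 1 then (c.1, c.2 + 1) else s) r = (x, s + 1) := by
    intro l
    induction l with
    | nil =>
      rintro r - (h | h)
      · exact h
      · simp at h
    | cons c l ih =>
      intro r hl hr
      rw [List.foldl_cons]
      refine ih _ (fun c' hc' => hl c' (List.mem_cons_of_mem _ hc')) ?_
      rcases hl c List.mem_cons_self with rfl | hc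
      · left
        rcases hr with rfl | ⟨hr, -⟩
        · simp
        · rw [if_pos (by omega)]
      · rcases hr with rfl | ⟨hr, hmem⟩
        · left
          rw [if_neg (by simp only; omega)]
        · right
          refine ⟨by split_ifs <;> first | exact hc | exact hr, ?_⟩
          rcases List.mem_cons.1 hmem with rfl | h
          · simp only at hc; omega
          · exact h
  rw [best, key cs (0, 0) h (Or.inr ⟨Nat.zero_le _, hx⟩)]

/-- The search finds the truth if, at every stage, it has fewer than `L` competitors, and none in the
end. -/
theorem decode_eq {b L ref : ℕ} {ms : List Msg} (href : ref < 2 ^ b) (hms : ∀ m ∈ ms, m.level < b)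
    (h : ∀ k < b, (competitors b k (ref / 2 ^ k) ms).card < L)
    (h0 : (competitors b 0 ref ms).card = 0) : decode b L ms = ref := by
  have key : ∀ t ≤ b, ((stage ms L)^[t] (b, [(0, 0)])).1 = b - t ∧
      Valid b ms (b - t) ((stage ms L)^[t] (b, [(0, 0)])).2 ∧
      (ref / 2 ^ (b - t), score (b - t) (ref / 2 ^ (b - t)) ms) ∈
        ((stage ms L)^[t] (b, [(0, 0)])).2 := by
    intro t
    induction t with
    | zero =>
      intro _
      simp [Valid, score_top hms, Nat.div_eq_of_lt href]
    | succ t ih =>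
      intro ht
      obtain ⟨h1, h2, h3⟩ := ih (by omega)
      rw [Function.iterate_succ_apply']
      generalize (stage ms L)^[t] (b, [(0, 0)]) = s at *
      obtain ⟨k, hk⟩ : ∃ k, b - t = k + 1 := ⟨b - t - 1, by omega⟩
      rw [show b - (t + 1) = k by omega]
      rw [hk] at h1 h2 h3
      have hv := h2.expand (by omega : k < b)
      have hs1 : s.1 - 1 = k := by omega
      simp only [stage, hs1]
      refine ⟨trivial, hv.prune, ?_⟩
      rw [prune_eq, List.mem_reverse, List.mem_filter]
      constructor
      · rw [expand_eq, List.mem_flatMap]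
        refine ⟨_, List.mem_reverse.2 h3, ?_⟩
        have h4 : ref / 2 ^ (k + 1) = ref / 2 ^ k / 2 := by
          rw [Nat.div_div_eq_div_mul, pow_succ]
        simp only [h4, score_eq_add k (ref / 2 ^ k) ms]
        generalize ref / 2 ^ k = y
        obtain hy | hy : y = 2 * (y / 2) ∨ y = 2 * (y / 2) + 1 := by omega
        · rw [← hy]; exact List.mem_cons_self
        · rw [← hy]; exact List.mem_cons_of_mem _ List.mem_cons_self
      · have := rank_le (x := ref / 2 ^ k) hv
        have := h k (by omega)
        simp only [decide_eq_true_eq]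
        omega
  obtain ⟨-, h2, h3⟩ := key b le_rfl
  simp only [Nat.sub_self, pow_zero, Nat.div_one] at h2 h3
  refine best_eq h3 fun c hc => ?_
  obtain ⟨h4, h5⟩ := h2.2 c hc
  by_cases hcx : c.1 = ref
  · left
    rw [← hcx, ← h5]
  · right
    rw [h5]
    by_contra hlt
    rw [Finset.card_eq_zero] at h0
    have : c.1 ∈ competitors b 0 ref ms := by
      simp only [competitors, Finset.mem_filter, Finset.mem_range]
      exact ⟨h4, hcx, by omega⟩
    rw [h0] at this
    simp at this

/-! ### The probability of an error of the decoder -/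

/-- The number of different prefixes, among the `t` longest ones. -/
def distance (t x y : ℕ) : ℕ := ((Finset.range t).filter fun i => y / 2 ^ i ≠ x / 2 ^ i).card

theorem distance_succ (t x y : ℕ) :
    distance (t + 1) x y = distance t (x / 2) (y / 2) + if y = x then 0 else 1 := by
  have h : ∀ z i : ℕ, z / 2 ^ (i + 1) = z / 2 / 2 ^ i := fun z i => by
    rw [Nat.div_div_eq_div_mul, pow_succ']
  simp only [distance, Finset.card_filter, Finset.sum_range_succ', h, pow_zero, Nat.div_one, ne_eq,
    ite_not]

/-- Few numbers share many prefixes with `x`. -/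
theorem sum_distance_le (t : ℕ) {x : ℕ} (hx : x < 2 ^ t) : ∑ y ∈ Finset.range (2 ^ t),
    (if y = x then 0 else (4⁻¹ : ℝ≥0∞) ^ distance t x y) ≤ 2⁻¹ := by
  have h42 : (4⁻¹ : ℝ≥0∞) = 2⁻¹ * 2⁻¹ := by
    rw [← ENNReal.mul_inv (by norm_num) (by norm_num)]
    norm_num
  have h4 : (4⁻¹ : ℝ≥0∞) + 4⁻¹ = 2⁻¹ := by
    rw [h42, ← mul_add, ENNReal.inv_two_add_inv_two, mul_one]
  induction t generalizing x with
  | zero => simp [show x = 0 by simpa using hx]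
  | succ t ih =>
    rw [pow_succ', sum_range_two_mul]
    calc _ ≤ ∑ y ∈ Finset.range (2 ^ t), (2⁻¹ *
          (if y = x / 2 then 0 else (4⁻¹ : ℝ≥0∞) ^ distance t (x / 2) y) +
          if y = x / 2 then 4⁻¹ else 0) := by
          refine Finset.sum_le_sum fun y _ => ?_
          simp only [distance_succ, show 2 * y / 2 = y by omega, show (2 * y + 1) / 2 = y by omega]
          by_cases hy : y = x / 2
          · subst hy
            have h0 : distance t (x / 2) (x / 2) = 0 := by simp [distance]
            obtain h | h : x % 2 = 0 ∨ x % 2 = 1 := by omega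
            · simp [show 2 * (x / 2) = x by omega, h0]
            · simp [show 2 * (x / 2) + 1 = x by omega, show 2 * (x / 2) ≠ x by omega, h0]
          · rw [if_neg (show 2 * y ≠ x by omega), if_neg (show 2 * y + 1 ≠ x by omega), if_neg hy,
              if_neg hy, if_neg (show 2 * y ≠ x by omega), if_neg (show 2 * y + 1 ≠ x by omega),
              add_zero, pow_succ, ← mul_add, h4, mul_comm]
      _ ≤ 2⁻¹ * 2⁻¹ + 4⁻¹ := by
          rw [Finset.sum_add_distrib, ← Finset.mul_sum, Finset.sum_ite_eq']
          gcongr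
          · exact ih (by rw [pow_succ] at hx; omega)
          · split_ifs <;> simp
      _ = 2⁻¹ := by rw [← h42, h4]

namespace LocalParams

variable (P : LocalParams)

/-- Every level is drawn with at least one outcome. -/
theorem distance_le_card_diverging (hl : P.b ≤ 2 ^ P.l) (k x y : ℕ) :
    distance (P.b - k) x y ≤ (P.diverging k x y).card := by
  refine Finset.card_le_card_of_injOn (fun i => P.b - 1 - k - i) (fun i hi => ?_) ?_
  · simp only [Finset.coe_filter, Finset.mem_range, Set.mem_ofPred_eq] at hi
    have h1 : P.levelOf (P.b - 1 - k - i) = k + i := by unfold levelOf; omega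
    simp only [diverging, Finset.coe_filter, Finset.mem_range, Set.mem_ofPred_eq, h1,
      Nat.add_sub_cancel_left]
    exact ⟨by omega, by omega, hi.2⟩
  · intro i hi j hj hij
    simp only [Finset.coe_filter, Finset.mem_range, Set.mem_ofPred_eq] at hi hj hij
    omega

/-- The surplus draws reinforce level `0`. -/
theorem distance_add_le_card_diverging (hl : P.b ≤ 2 ^ P.l) {x y : ℕ} (h : y ≠ x) :
    distance P.b x y + (2 ^ P.l - P.b) ≤ (P.diverging 0 x y).card := by
  classical
  have hinj : Set.InjOn (fun i => P.b - 1 - i)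
      ((Finset.range P.b).filter fun i => y / 2 ^ i ≠ x / 2 ^ i) := by
    intro i hi j hj hij
    simp only [Finset.coe_filter, Finset.mem_range, Set.mem_ofPred_eq] at hi hj hij
    omega
  rw [distance, ← Finset.card_image_of_injOn hinj, ← Nat.card_Ico P.b,
    ← Finset.card_union_of_disjoint]
  · refine Finset.card_le_card fun j hj => ?_
    simp only [diverging, Finset.mem_filter, Finset.mem_range, Nat.sub_zero, Nat.zero_le, true_and]
    rcases Finset.mem_union.1 hj with hj | hj
    · obtain ⟨i, hi, rfl⟩ := Finset.mem_image.1 hj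
      simp only [Finset.mem_filter, Finset.mem_range] at hi
      have h1 : P.levelOf (P.b - 1 - i) = i := by unfold levelOf; omega
      rw [h1]
      exact ⟨by omega, hi.2⟩
    · rw [Finset.mem_Ico] at hj
      have h1 : P.levelOf j = 0 := by unfold levelOf; omega
      rw [h1]
      simpa [hj.2] using h
  · rw [Finset.disjoint_left]
    intro j hj hj'
    obtain ⟨i, hi, rfl⟩ := Finset.mem_image.1 hj
    simp only [Finset.mem_filter, Finset.mem_range] at hi
    rw [Finset.mem_Ico] at hj'
    omega

theorem mem_support_msgs {hs : List ℕ} {ms : List Msg} (h : ms ∈ (P.msgs hs).support) :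
    ∀ m ∈ ms, m.level ≤ P.b - 1 ∧ m.seed.length = P.b := by
  induction hs generalizing ms with
  | nil =>
    simp only [msgs, PMF.mem_support_pure_iff] at h
    simp [h]
  | cons x hs ih =>
    simp only [msgs, PMF.mem_support_bind_iff, PMF.support_map, Set.mem_image] at h
    obtain ⟨m, hm, ms', hms, rfl⟩ := h
    intro m' hm'
    rcases List.mem_cons.1 hm' with rfl | hm'
    · simp only [msgLaw, PMF.mem_support_bind_iff, PMF.support_map, Set.mem_image] at hm
      obtain ⟨j, -, a, ha, z, -, c, -, rfl⟩ := hm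
      exact ⟨Nat.sub_le _ _, (mem_support_tapes ha).1⟩
    · exact ih hms m' hm'

theorem ex_card_competitors (ref k : ℕ) (hs : List ℕ) :
    ex (P.msgs hs) (fun ms => ((competitors P.b k (ref / 2 ^ k) ms).card : ℝ≥0∞)) =
      ∑ y ∈ Finset.range (2 ^ (P.b - k)), if y = ref / 2 ^ k then 0 else
        ex (P.msgs hs) fun ms => ind (score k (ref / 2 ^ k) ms ≤ score k y ms) := by
  classical
  have h1 : ∀ ms, ((competitors P.b k (ref / 2 ^ k) ms).card : ℝ≥0∞) =
      ∑ y ∈ Finset.range (2 ^ (P.b - k)), if y = ref / 2 ^ k then 0 else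
        ind (score k (ref / 2 ^ k) ms ≤ score k y ms) := fun ms => by
    rw [competitors, Finset.card_filter]
    push_cast
    refine Finset.sum_congr rfl fun y _ => ?_
    by_cases hy : y = ref / 2 ^ k
    · simp [hy]
    · simp only [hy, ne_eq, not_false_eq_true, true_and, if_false]
      unfold ind
      congr
  simp only [h1, ex_finset_sum]
  refine Finset.sum_congr rfl fun y _ => ?_
  split_ifs
  · exact ex_const _ _
  · rfl

/-- The decoder finds the hypothesis that nine tenths of the users hold. -/
theorem ex_decode_ne_le (hl : P.b ≤ 2 ^ P.l) (hb : 0 < P.b) {ref : ℕ} (href : ref < 2 ^ P.b)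
    {hs : List ℕ} (hn : hs.length = 40 * 2 ^ P.l * (2 ^ P.g) ^ 2)
    (hw : 10 * (hs.length - hs.count ref) ≤ hs.length) {L : ℕ} (hL : 0 < L) :
    ex (P.msgs hs) (fun ms => ind (decode P.b L ms ≠ ref)) ≤
      P.b * (L : ℝ≥0∞)⁻¹ + 4⁻¹ ^ (2 ^ P.l - P.b) := by
  have hL0 : (L : ℝ≥0∞) ≠ 0 := by exact_mod_cast hL.ne'
  have hhalf : (2⁻¹ : ℝ≥0∞) ≤ 1 := by
    rw [ENNReal.inv_le_one]
    norm_num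
  have h4 : (4⁻¹ : ℝ≥0∞) ≤ 1 := by
    rw [ENNReal.inv_le_one]
    norm_num
  have hy : ∀ {k y}, y ∈ Finset.range (2 ^ (P.b - k)) → y < 2 ^ P.b := fun {k y} hy =>
    (Finset.mem_range.1 hy).trans_le (Nat.pow_le_pow_right (by norm_num) (Nat.sub_le _ _))
  have hk : ∀ k < P.b, ex (P.msgs hs) (fun ms =>
      ((competitors P.b k (ref / 2 ^ k) ms).card : ℝ≥0∞)) ≤ 1 := by
    intro k hkb
    have hx : ref / 2 ^ k < 2 ^ (P.b - k) := by
      rw [Nat.div_lt_iff_lt_mul (by positivity), ← pow_add, Nat.sub_add_cancel hkb.le]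
      exact href
    rw [P.ex_card_competitors]
    refine (Finset.sum_le_sum fun y hyr => ?_).trans
      ((sum_distance_le (P.b - k) hx).trans hhalf)
    split_ifs
    · exact le_rfl
    · exact (P.ex_score_le href (hy hyr) hn hw).trans
        (pow_le_pow_of_le_one zero_le h4 (P.distance_le_card_diverging hl _ _ _))
  have h0 : ex (P.msgs hs) (fun ms => ((competitors P.b 0 ref ms).card : ℝ≥0∞)) ≤
      4⁻¹ ^ (2 ^ P.l - P.b) := by
    have h1 := P.ex_card_competitors ref 0 hs
    have h2 : ∀ y ∈ Finset.range (2 ^ (P.b - 0)), (if y = ref / 2 ^ 0 then 0 else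
        ex (P.msgs hs) fun ms => ind (score 0 (ref / 2 ^ 0) ms ≤ score 0 y ms)) ≤
        4⁻¹ ^ (2 ^ P.l - P.b) * if y = ref then 0 else (4⁻¹ : ℝ≥0∞) ^ distance P.b ref y := by
      intro y hyr
      have h3 := P.ex_score_le (k := 0) href (hy hyr) hn hw
      simp only [pow_zero, Nat.div_one] at h3 ⊢
      split_ifs with h
      · exact zero_le
      · rw [← pow_add, add_comm]
        exact h3.trans (pow_le_pow_of_le_one zero_le h4 (P.distance_add_le_card_diverging hl h))
    simp only [pow_zero, Nat.div_one] at h1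
    rw [h1]
    simp only [pow_zero, Nat.div_one] at h2
    refine (Finset.sum_le_sum h2).trans ?_
    rw [← Finset.mul_sum]
    exact (mul_le_mul_right (((sum_distance_le P.b href).trans hhalf)) _).trans (mul_one _).le
  calc _ ≤ ex (P.msgs hs) fun ms =>
        (L : ℝ≥0∞)⁻¹ * (∑ k ∈ Finset.range P.b,
          ((competitors P.b k (ref / 2 ^ k) ms).card : ℝ≥0∞)) +
        ((competitors P.b 0 ref ms).card : ℝ≥0∞) := by
        refine ex_mono fun ms hms => ?_
        by_cases hd : decode P.b L ms = ref
        · rw [ind_of_false (not_not.2 hd)]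
          exact zero_le
        rw [ind_of_true hd]
        by_cases hc0 : (competitors P.b 0 ref ms).card = 0
        · have : ∃ k < P.b, L ≤ (competitors P.b k (ref / 2 ^ k) ms).card := by
            by_contra hno
            push Not at hno
            exact hd (decode_eq href (fun m hm => by
              have := (P.mem_support_msgs hms m hm).1
              omega) hno hc0)
          obtain ⟨k, hkb, hkL⟩ := this
          refine le_add_right ?_
          calc (1 : ℝ≥0∞) = (L : ℝ≥0∞)⁻¹ * L := (ENNReal.inv_mul_cancel hL0 (by simp)).symm
            _ ≤ (L : ℝ≥0∞)⁻¹ * ((competitors P.b k (ref / 2 ^ k) ms).card : ℝ≥0∞) := by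
                gcongr
            _ ≤ _ := by
                gcongr
                exact Finset.single_le_sum (f := fun k =>
                  ((competitors P.b k (ref / 2 ^ k) ms).card : ℝ≥0∞)) (fun _ _ => zero_le)
                  (Finset.mem_range.2 hkb)
        · refine le_add_left ?_
          exact_mod_cast Nat.one_le_iff_ne_zero.2 hc0
    _ = (L : ℝ≥0∞)⁻¹ * (∑ k ∈ Finset.range P.b, ex (P.msgs hs) fun ms =>
          ((competitors P.b k (ref / 2 ^ k) ms).card : ℝ≥0∞)) +
        ex (P.msgs hs) fun ms => ((competitors P.b 0 ref ms).card : ℝ≥0∞) := by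
        rw [ex_add, ex_mul_left, ex_finset_sum]
    _ ≤ (L : ℝ≥0∞)⁻¹ * (∑ k ∈ Finset.range P.b, 1) + 4⁻¹ ^ (2 ^ P.l - P.b) := by
        gcongr with k hkr
        exact hk k (Finset.mem_range.1 hkr)
    _ = _ := by
        rw [Finset.sum_const, Finset.card_range, nsmul_eq_mul, mul_one, mul_comm]

end LocalParams

end Decoding


/-! ### The programs of the local learner -/

section LocalPrograms

/-- The encoding of a message. -/
def encMsg (m : Msg) : Val := .pair (.num m.level) (.pair (encTape m.seed) (.num m.bit))

/-- The encoding of a list of messages. -/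
def encMsgs (ms : List Msg) : Val := .ofList (ms.map encMsg)

/-- The encoding of a candidate with its score. -/
def encCand (c : ℕ × ℕ) : Val := .pair (.num c.1) (.num c.2)

/-- The encoding of a list of candidates. -/
def encCands (cs : List (ℕ × ℕ)) : Val := .ofList (cs.map encCand)

namespace Comb

/-- Remainder modulo `2`. -/
def mod2 : Comb := (id.pair (((id.pair (const 2)).seq div).seq ((id.pair id).seq add))).seq sub

theorem mod2_fn (n : ℕ) : mod2.fn (.num n) = .num (n % 2) := by
  simp [mod2]
  omega

/-- One round of `hash`, on `(e, (a, (y, s)))`. -/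
def hashStep : Comb :=
  ((((snd.seq (snd.seq fst)).pair (const 2)).seq div)).pair
    (cond (snd.seq fst) ((snd.seq snd).seq add) (snd.seq (snd.seq snd)))

/-- The hash function, on input `(a, y)`. -/
def hash : Comb :=
  ((const 0).pair (fst.pair (snd.pair (const 0)))).seq ((fold hashStep).seq (snd.seq mod2))

theorem hash_fn (a : List ℕ) (y : ℕ) :
    hash.fn (.pair (encTape a) (.num y)) = .num (UserDP.hash a y) := by
  have h := fold_fn_ofList hashStep (.num 0) a .num encCand
    (fun s a => (s.1 / 2, if a = 0 then s.2 else s.1 + s.2)) (fun x _ s => by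
      simp only [hashStep, encCand, cond_fn, seq_fn, pair_fn, fst_fn, snd_fn, Val.fst_pair,
        Val.snd_pair, Val.isTrue_num, decide_eq_true_eq, const_fn, div_fn, add_fn,
        Val.arith_pair_num]
      split_ifs <;> first | rfl | omega) (y, 0)
  have h2 : ∀ (a : List ℕ) (s : ℕ × ℕ),
      (a.foldl (fun s a => (s.1 / 2, if a = 0 then s.2 else s.1 + s.2)) s).2 =
        s.2 + hashSum a s.1 := by
    intro a
    induction a with
    | nil => intro s; rfl
    | cons x a ih =>
      intro s
      rw [List.foldl_cons, ih]
      simp only [hashSum]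
      split_ifs <;> omega
  simp only [hash, seq_fn, pair_fn, fst_fn, snd_fn, const_fn, Val.fst_pair, Val.snd_pair]
  simp only [encCand] at h
  rw [encTape, h, Val.snd_pair, h2, mod2_fn, UserDP.hash, zero_add]

theorem hash_cost_le (a : List ℕ) (y : Val) :
    hash.cost (.pair (encTape a) y) ≤ a.length * 70 + 60 := by
  have h := fold_cost_le' hashStep (.num 0) (a.map .num) (.pair y (.num 0)) 30 fun x _ s => by
    refine (Nat.add_le_add_right (Nat.add_le_add_left (cond_cost_le _ _ _ _) _) 1).trans ?_
    simp
  rw [List.length_map] at h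
  simp only [hash, seq_cost, pair_cost, fst_cost, snd_cost, const_cost, pair_fn, fst_fn,
    snd_fn, const_fn, Val.fst_pair, Val.snd_pair, encTape]
  simp [mod2] at h ⊢
  omega

theorem mod2_size_le : mod2.size ≤ 20 := by
  have h := size_le_self 2
  simp only [mod2, seq_size, pair_size, const_size, sub_size, add_size, div_size, id_size]
  omega

theorem hashStep_size_le : hashStep.size ≤ 40 := by
  have h := size_le_self 2
  simp only [hashStep, seq_size, pair_size, cond_size, fst_size, snd_size, const_size, add_size,
    div_size]
  omega

theorem hash_size_le : hash.size ≤ 150 := by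
  have h1 := size_le_self 0
  have h2 := mod2_size_le
  have h3 := hashStep_size_le
  simp only [hash, seq_size, pair_size, fst_size, snd_size, const_size, fold_size]
  omega

/-- Removal of low-order bits, on input `(y, k)`. -/
def shift : Comb := ((const 0).pair (snd.pair fst)).seq (iter ((snd.pair (const 2)).seq div))

theorem shift_fn (y k : ℕ) : shift.fn (.pair (.num y) (.num k)) = .num (y / 2 ^ k) := by
  have h := iter_fn_typed ((snd.pair (const 2)).seq div) (.num 0) k .num (fun y => y / 2)
    (fun s => by simp) y
  simp only [shift, seq_fn, pair_fn, fst_fn, snd_fn, const_fn, Val.fst_pair, Val.snd_pair]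
  rw [h]
  congr 1
  induction k generalizing y with
  | zero => simp
  | succ k ih => rw [Function.iterate_succ_apply, ih, Nat.div_div_eq_div_mul, pow_succ']
                 exact iter_fn_typed _ _ k .num (fun y => y / 2) (fun s => by simp) _

theorem shift_cost_le (y : Val) (k : ℕ) : shift.cost (.pair y (.num k)) ≤ k * 50 + 40 := by
  have h := iter_cost_le' ((snd.pair (const 2)).seq div) (.num 0) k y 10 fun s => by simp
  simp only [shift, seq_cost, pair_cost, fst_cost, snd_cost, const_cost, pair_fn, fst_fn,
    snd_fn, const_fn, Val.fst_pair, Val.snd_pair]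
  omega

theorem shift_size_le : shift.size ≤ 100 := by
  have h1 := size_le_self 0
  have h2 := size_le_self 2
  simp only [shift, seq_size, pair_size, fst_size, snd_size, const_size, div_size, iter_size]
  omega

/-- The randomizer of a user, on input `((j, (a, (z, c))), (r, u))`. -/
def randomizer (c : Comb) (b : ℕ) : Comb :=
  ((((const (b - 1)).pair (fst.seq fst)).seq sub).pair (fst.pair (snd.seq c))).seq
    (fst.pair (((snd.seq fst).seq (snd.seq fst)).pair
      (cond ((snd.seq fst).seq (snd.seq (snd.seq fst))) ((snd.seq fst).seq (snd.seq (snd.seq snd)))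
        ((((snd.seq fst).seq (snd.seq fst)).pair (((snd.seq snd).pair fst).seq shift)).seq hash))))

theorem randomizer_fn (c : Comb) (P : LocalParams) (v : Val) (h j : ℕ) (a : List ℕ) (z t : ℕ)
    (hc : c.fn v = .num h) :
    (randomizer c P.b).fn
      (.pair (.pair (.num j) (.pair (encTape a) (.pair (.num z) (.num t)))) v) =
      encMsg (P.msgOf h j a z t) := by
  simp only [randomizer, cond_fn, seq_fn, pair_fn, fst_fn, snd_fn, Val.fst_pair, Val.snd_pair,
    const_fn, sub_fn, Val.arith_pair_num, hc, shift_fn, hash_fn, Val.isTrue_num, decide_eq_true_eq,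
    encMsg, LocalParams.msgOf, LocalParams.levelOf]
  by_cases hz : z = 0 <;> simp [hz]

theorem randomizer_cost_le (c : Comb) (b : ℕ) (v : Val) (h j : ℕ) (a : List ℕ) (z t : ℕ)
    (hc : c.fn v = .num h) (ha : a.length = b) :
    (randomizer c b).cost
      (.pair (.pair (.num j) (.pair (encTape a) (.pair (.num z) (.num t)))) v) ≤
      c.cost v + b * 120 + 200 := by
  have h1 := shift_cost_le (.num h) (b - 1 - j)
  have h2 := hash_cost_le a (.num (h / 2 ^ (b - 1 - j)))
  have h3 : (b - 1 - j) * 50 ≤ b * 50 := Nat.mul_le_mul_right _ (by omega)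
  rw [ha] at h2
  have h4 := cond_cost_le ((snd.seq fst).seq (snd.seq (snd.seq fst)))
    ((snd.seq fst).seq (snd.seq (snd.seq snd)))
    ((((snd.seq fst).seq (snd.seq fst)).pair (((snd.seq snd).pair fst).seq shift)).seq hash)
    (.pair (.num (b - 1 - j)) (.pair (.pair (.num j) (.pair (encTape a) (.pair (.num z) (.num t))))
      (.num h)))
  simp only [seq_cost, pair_cost, fst_cost, snd_cost, seq_fn, pair_fn, fst_fn, snd_fn,
    Val.fst_pair, Val.snd_pair, shift_fn] at h4
  simp only [randomizer, seq_cost, pair_cost, fst_cost, snd_cost, const_cost, sub_cost,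
    seq_fn, pair_fn, fst_fn, snd_fn, Val.fst_pair, Val.snd_pair,
    const_fn, sub_fn, Val.arith_pair_num, hc]
  generalize 2 ^ (b - 1 - j) = Z at *
  generalize hash.cost _ = c1 at *
  generalize shift.cost _ = c2 at *
  generalize (cond _ _ _).cost _ = c3 at *
  omega

theorem randomizer_size_le (c : Comb) (b : ℕ) : (randomizer c b).size ≤ c.size + b + 400 := by
  have h1 := size_le_self (b - 1)
  have h2 := hash_size_le
  have h3 := shift_size_le
  simp only [randomizer, seq_size, pair_size, cond_size, fst_size, snd_size, const_size, sub_size]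
  omega

/-- One round of `levelCount`, on `((k, y), (m, s))`. -/
def levelCountStep : Comb :=
  cond (((snd.seq (fst.seq fst)).pair (fst.seq fst)).seq eq)
    (cond (((((snd.seq (fst.seq (snd.seq fst))).pair (fst.seq snd)).seq hash).pair
      (snd.seq (fst.seq (snd.seq snd)))).seq eq)
      (((snd.seq snd).pair (const 1)).seq add) (snd.seq snd)) (snd.seq snd)

/-- The function `levelCount`, on input `(ms, (k, y))`. -/
def levelCount : Comb := (snd.pair (fst.pair (const 0))).seq (fold levelCountStep)

theorem levelCount_fn (ms : List Msg) (k y : ℕ) :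
    levelCount.fn (.pair (encMsgs ms) (.pair (.num k) (.num y))) =
      .num (UserDP.levelCount k y ms) := by
  have h := fold_fn_ofList levelCountStep (.pair (.num k) (.num y)) ms encMsg .num
    (fun s m => if m.level = k ∧ UserDP.hash m.seed y = m.bit then s + 1 else s) (fun m _ s => by
      simp only [levelCountStep, encMsg, cond_fn, seq_fn, pair_fn, fst_fn, snd_fn, Val.fst_pair,
        Val.snd_pair, Val.isTrue_num, const_fn, add_fn, eq_fn, hash_fn,
        Val.arith_pair_num]
      by_cases h1 : m.level = k <;> by_cases h2 : UserDP.hash m.seed y = m.bit <;> simp [h1, h2]) 0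
  simp only [levelCount, seq_fn, pair_fn, fst_fn, snd_fn, const_fn, Val.fst_pair, Val.snd_pair]
  rw [encMsgs, h]
  congr 1
  have h2 : ∀ (ms : List Msg) (s : ℕ), ms.foldl (fun s m =>
      if m.level = k ∧ UserDP.hash m.seed y = m.bit then s + 1 else s) s =
      s + UserDP.levelCount k y ms := by
    intro ms
    induction ms with
    | nil => intro s; rfl
    | cons m ms ih =>
      intro s
      rw [List.foldl_cons, ih]
      simp only [UserDP.levelCount, List.map_cons, List.sum_cons]
      split_ifs <;> omega
  rw [h2, zero_add]

theorem levelCount_cost_le {ms : List Msg} {b : ℕ} (hms : ∀ m ∈ ms, m.seed.length = b)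
    (v : Val) : levelCount.cost (.pair (encMsgs ms) v) ≤ ms.length * (b * 70 + 200) + 50 := by
  have h := fold_cost_le' levelCountStep v (ms.map encMsg) (.num 0) (b * 70 + 160)
    fun x hx s => by
      obtain ⟨m, hm, rfl⟩ := List.mem_map.1 hx
      have h1 := hash_cost_le m.seed v.snd
      rw [hms m hm] at h1
      have h2 := eq_cost_le
      refine (cond_cost_le _ _ _ _).trans ?_
      have h3 := cond_cost_le (((((snd.seq (fst.seq (snd.seq fst))).pair (fst.seq snd)).seq
        hash).pair (snd.seq (fst.seq (snd.seq snd)))).seq eq)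
        (((snd.seq snd).pair (const 1)).seq add) (snd.seq snd) (.pair v (.pair (encMsg m) s))
      have h4 := eq_cost_le (.pair (.num m.level) v.fst)
      have h5 := eq_cost_le (.pair (hash.fn (.pair (encTape m.seed) v.snd)) (.num m.bit))
      simp only [encMsg, seq_cost, pair_cost, fst_cost, snd_cost, const_cost, add_cost, seq_fn,
        pair_fn, fst_fn, snd_fn, Val.fst_pair, Val.snd_pair] at h3 ⊢
      omega
  rw [List.length_map, show b * 70 + 160 + 40 = b * 70 + 200 by omega] at h
  simp only [levelCount, seq_cost, pair_cost, fst_cost, snd_cost, const_cost, pair_fn, fst_fn,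
    snd_fn, const_fn, Val.fst_pair, Val.snd_pair, encMsgs]
  omega

theorem eq_size_le : eq.size ≤ 20 := by
  simp [eq]

theorem levelCountStep_size_le : levelCountStep.size ≤ 260 := by
  have h1 := eq_size_le
  have h2 := hash_size_le
  simp [levelCountStep]
  generalize eq.size = s at *
  generalize hash.size = t at *
  omega

theorem levelCount_size_le : levelCount.size ≤ 320 := by
  have h1 := size_le_self 0
  have h2 := levelCountStep_size_le
  simp [levelCount]
  omega

/-- The extension of a candidate, on input `((ms, k), (y, s))`: the score is updated. -/
def child : Comb :=
  (snd.seq fst).pair (((snd.seq snd).pair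
    (((fst.seq fst).pair ((fst.seq snd).pair (snd.seq fst))).seq levelCount)).seq add)

theorem child_fn (ms : List Msg) (k y s : ℕ) :
    child.fn (.pair (.pair (encMsgs ms) (.num k)) (.pair (.num y) (.num s))) =
      encCand (y, s + UserDP.levelCount k y ms) := by
  simp [child, levelCount_fn, encCand]

theorem child_cost_le {ms : List Msg} {b : ℕ} (hms : ∀ m ∈ ms, m.seed.length = b) (k v : Val) :
    child.cost (.pair (.pair (encMsgs ms) k) v) ≤ ms.length * (b * 70 + 200) + 80 := by
  have h := levelCount_cost_le hms (.pair k v.fst)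
  simp [child]
  omega

/-- One round of `expand`, on `((ms, k), (c, acc))`. -/
def expandStep : Comb :=
  ((fst.pair ((((snd.seq (fst.seq fst)).seq ((id.pair id).seq add))).pair
    (snd.seq (fst.seq snd)))).seq child).pair
  (((fst.pair (((((snd.seq (fst.seq fst)).seq ((id.pair id).seq add)).pair (const 1)).seq add).pair
    (snd.seq (fst.seq snd)))).seq child).pair (snd.seq snd))

/-- The function `expand`, on input `((ms, k), cs)`. -/
def expand : Comb := (fst.pair (snd.pair (const 0))).seq (fold expandStep)

theorem expand_fn (ms : List Msg) (k : ℕ) (cs : List (ℕ × ℕ)) :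
    expand.fn (.pair (.pair (encMsgs ms) (.num k)) (encCands cs)) =
      encCands (UserDP.expand ms k cs) := by
  have h := fold_fn_ofList expandStep (.pair (encMsgs ms) (.num k)) cs encCand encCands
    (fun acc c => (2 * c.1, c.2 + UserDP.levelCount k (2 * c.1) ms) ::
    (2 * c.1 + 1, c.2 + UserDP.levelCount k (2 * c.1 + 1) ms) :: acc) (fun c _ acc => by
      have h1 := child_fn ms k (2 * c.1) c.2
      have h2 := child_fn ms k (2 * c.1 + 1) c.2
      simp only [expandStep, encCand, seq_fn, pair_fn, fst_fn, snd_fn, Val.fst_pair,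
        Val.snd_pair, const_fn, add_fn, id_fn, Val.arith_pair_num, ← two_mul, h1, h2, encCands,
        List.map_cons, Val.ofList_cons]) []
  exact h

theorem expand_cost_le {ms : List Msg} {b : ℕ} (hms : ∀ m ∈ ms, m.seed.length = b) (k : Val)
    (cs : List (ℕ × ℕ)) : expand.cost (.pair (.pair (encMsgs ms) k) (encCands cs)) ≤
      cs.length * (ms.length * (b * 140 + 400) + 300) + 50 := by
  have h := fold_cost_le' expandStep (.pair (encMsgs ms) k) (cs.map encCand) (.num 0)
    (ms.length * (b * 140 + 400) + 260) fun x hx s => by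
      have h1 := child_cost_le hms k
      simp only [mul_add] at h1 ⊢
      have h2 := h1 (.pair (((id.pair id).seq add).fn x.fst) x.snd)
      have h3 := h1 (.pair (add.fn (.pair (((id.pair id).seq add).fn x.fst) (.num 1))) x.snd)
      simp only [expandStep, seq_cost, pair_cost, fst_cost, snd_cost, const_cost, add_cost,
        id_cost, seq_fn, pair_fn, fst_fn, snd_fn, id_fn, const_fn, add_fn, Val.fst_pair,
        Val.snd_pair] at h2 h3 ⊢
      have : ms.length * (b * 140) = 2 * (ms.length * (b * 70)) := by ring
      generalize ms.length * (b * 70) = A at *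
      omega
  rw [List.length_map, show ms.length * (b * 140 + 400) + 260 + 40 =
    ms.length * (b * 140 + 400) + 300 by omega] at h
  simp only [expand, seq_cost, pair_cost, fst_cost, snd_cost, const_cost, pair_fn, fst_fn,
    snd_fn, const_fn, Val.fst_pair, Val.snd_pair, encCands]
  omega

theorem child_size_le : child.size ≤ 350 := by
  have h1 := levelCount_size_le
  simp [child]
  omega

theorem expandStep_size_le : expandStep.size ≤ 760 := by
  have h1 := size_le_self 1
  have h2 := child_size_le
  simp [expandStep]
  omega

theorem expand_size_le : expand.size ≤ 820 := by
  have h1 := size_le_self 0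
  have h2 := expandStep_size_le
  simp [expand]
  omega

/-- One round of `rank`, on `(s, (c, n))`. -/
def rankStep : Comb :=
  cond ((fst.pair (snd.seq (fst.seq snd))).seq sub) (snd.seq snd)
    (((snd.seq snd).pair (const 1)).seq add)

/-- The function `rank`, on input `(s, cs)`. -/
def rank : Comb := (fst.pair (snd.pair (const 0))).seq (fold rankStep)

theorem rank_fn (cs : List (ℕ × ℕ)) (s : ℕ) :
    rank.fn (.pair (.num s) (encCands cs)) = .num (UserDP.rank cs s) := by
  have h := fold_fn_ofList rankStep (.num s) cs encCand .num
    (fun n c => if s ≤ c.2 then n + 1 else n) (fun c _ n => by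
      simp only [rankStep, encCand, cond_fn, seq_fn, pair_fn, fst_fn, snd_fn, Val.fst_pair,
        Val.snd_pair, Val.isTrue_num, const_fn, add_fn, sub_fn, decide_eq_true_eq,
        Val.arith_pair_num]
      split_ifs <;> first | rfl | omega) 0
  have h2 : ∀ (cs : List (ℕ × ℕ)) (n : ℕ), cs.foldl (fun n c => if s ≤ c.2 then n + 1 else n) n =
      n + UserDP.rank cs s := by
    intro cs
    induction cs with
    | nil => intro n; rfl
    | cons c cs ih =>
      intro n
      rw [List.foldl_cons, ih]
      simp only [UserDP.rank, List.countP_cons, decide_eq_true_eq]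
      split_ifs <;> omega
  rw [h2, zero_add] at h
  exact h

theorem rank_cost_le (cs : List (ℕ × ℕ)) (s : Val) :
    rank.cost (.pair s (encCands cs)) ≤ cs.length * 80 + 50 := by
  have h := fold_cost_le' rankStep s (cs.map encCand) (.num 0) 40 fun x hx s => by
    refine (cond_cost_le _ _ _ _).trans ?_
    simp
  rw [List.length_map] at h
  simp only [rank, seq_cost, pair_cost, fst_cost, snd_cost, const_cost, pair_fn, fst_fn,
    snd_fn, const_fn, Val.fst_pair, Val.snd_pair, encCands]
  omega

/-- One round of `prune`, on `(cs, (c, acc))`. -/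
def pruneStep (L : ℕ) : Comb :=
  cond ((((((snd.seq (fst.seq snd)).pair fst).seq rank)).pair (const L)).seq sub) (snd.seq snd) snd

/-- The function `prune`. -/
def prune (L : ℕ) : Comb := (id.pair (id.pair (const 0))).seq (fold (pruneStep L))

theorem prune_fn (L : ℕ) (cs : List (ℕ × ℕ)) :
    (prune L).fn (encCands cs) = encCands (UserDP.prune L cs) := by
  have h := fold_fn_ofList (pruneStep L) (encCands cs) cs encCand encCands
    (fun acc c => if UserDP.rank cs c.2 ≤ L then c :: acc else acc) (fun c _ acc => by
      simp only [pruneStep, encCand, cond_fn, seq_fn, pair_fn, fst_fn, snd_fn, Val.fst_pair,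
        Val.snd_pair, Val.isTrue_num, const_fn, sub_fn, decide_eq_true_eq, rank_fn,
        Val.arith_pair_num]
      split_ifs <;> first | rfl | omega) []
  exact h

theorem prune_cost_le (L : ℕ) (cs : List (ℕ × ℕ)) :
    (prune L).cost (encCands cs) ≤ cs.length * (cs.length * 80 + 150) + 50 := by
  have h := fold_cost_le' (pruneStep L) (encCands cs) (cs.map encCand) (.num 0)
    (cs.length * 80 + 110) fun x hx s => by
      refine (cond_cost_le _ _ _ _).trans ?_
      have := rank_cost_le cs x.snd
      simp
      omega
  rw [List.length_map, show cs.length * 80 + 110 + 40 = cs.length * 80 + 150 by omega] at h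
  simp only [prune, seq_cost, pair_cost, id_cost, const_cost, pair_fn, id_fn, const_fn, encCands]
    at h ⊢
  omega

theorem rank_size_le : rank.size ≤ 80 := by
  simp [rank, rankStep]

theorem prune_size_le (L : ℕ) : (prune L).size ≤ L + 170 := by
  have h1 := size_le_self 0
  have h2 := size_le_self L
  have h3 := rank_size_le
  simp [prune, pruneStep]
  omega

/-- The function `stage`, on input `(ms, (k, cs))`. -/
def stage (L : ℕ) : Comb :=
  ((((snd.seq fst).pair (const 1)).seq sub).pair id).seq
    (fst.pair ((((((snd.seq fst).pair fst)).pair (snd.seq (snd.seq snd))).seq expand).seq (prune L)))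

/-- The encoding of a state of the search. -/
def _root_.UserDP.encState (s : ℕ × List (ℕ × ℕ)) : Val := .pair (.num s.1) (encCands s.2)

theorem stage_fn (ms : List Msg) (L : ℕ) (s : ℕ × List (ℕ × ℕ)) :
    (stage L).fn (.pair (encMsgs ms) (encState s)) = encState (UserDP.stage ms L s) := by
  simp [stage, encState, expand_fn, prune_fn, UserDP.stage]

theorem length_expand (ms : List Msg) (k : ℕ) (cs : List (ℕ × ℕ)) :
    (UserDP.expand ms k cs).length = 2 * cs.length := by
  rw [expand_eq]
  induction cs with
  | nil => rfl
  | cons c cs ih =>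
    simp only [List.reverse_cons, List.flatMap_append, List.length_append, ih]
    simp
    omega

theorem stage_cost_le {ms : List Msg} {b L : ℕ} (hms : ∀ m ∈ ms, m.seed.length = b)
    {s : ℕ × List (ℕ × ℕ)} (hs : s.2.length ≤ L) :
    (stage L).cost (.pair (encMsgs ms) (encState s)) ≤
      L * (ms.length * (b * 140 + 400) + L * 320 + 600) + 200 := by
  have h1 := expand_cost_le hms (.num (s.1 - 1)) s.2
  have h2 := prune_cost_le L (UserDP.expand ms (s.1 - 1) s.2)
  rw [length_expand] at h2
  have h3 : s.2.length * (ms.length * (b * 140 + 400) + 300) ≤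
      L * (ms.length * (b * 140 + 400) + 300) := Nat.mul_le_mul_right _ hs
  have h4 : 2 * s.2.length * (2 * s.2.length * 80 + 150) ≤ 2 * L * (2 * L * 80 + 150) := by
    gcongr
  have h5 : 2 * L * (2 * L * 80 + 150) = L * (L * 320 + 300) := by ring
  have h6 : L * (ms.length * (b * 140 + 400) + L * 320 + 600) =
      L * (ms.length * (b * 140 + 400) + 300) + L * (L * 320 + 300) := by ring
  rw [h6]
  simp only [stage, encState, seq_cost, pair_cost, fst_cost, snd_cost, const_cost, id_cost,
    sub_cost, seq_fn, pair_fn, fst_fn, snd_fn, id_fn, const_fn, sub_fn, Val.fst_pair, Val.snd_pair,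
    Val.arith_pair_num, expand_fn]
  omega

/-- One round of `best`, on `(e, (c, s))`. -/
def bestStep : Comb :=
  cond (((((snd.seq (fst.seq snd)).pair (const 1)).seq add).pair (snd.seq (snd.seq snd))).seq sub)
    ((snd.seq (fst.seq fst)).pair (((snd.seq (fst.seq snd)).pair (const 1)).seq add)) (snd.seq snd)

/-- The function `best`. -/
def best : Comb := ((const 0).pair (id.pair ((const 0).pair (const 0)))).seq (fold bestStep)

theorem best_fn (cs : List (ℕ × ℕ)) : best.fn (encCands cs) = encCand (UserDP.best cs) := by
  have h := fold_fn_ofList bestStep (.num 0) cs encCand encCand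
    (fun s c => if s.2 < c.2 + 1 then (c.1, c.2 + 1) else s) (fun c _ s => by
      simp only [bestStep, encCand, cond_fn, seq_fn, pair_fn, fst_fn, snd_fn, Val.fst_pair,
        Val.snd_pair, Val.isTrue_num, const_fn, sub_fn, add_fn, decide_eq_true_eq,
        Val.arith_pair_num]
      split_ifs <;> first | rfl | omega) (0, 0)
  exact h

theorem best_cost_le (cs : List (ℕ × ℕ)) : best.cost (encCands cs) ≤ cs.length * 100 + 50 := by
  have h := fold_cost_le' bestStep (.num 0) (cs.map encCand) (.pair (.num 0) (.num 0)) 60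
    fun x hx s => by
      refine (cond_cost_le _ _ _ _).trans ?_
      simp
  rw [List.length_map] at h
  simp only [best, seq_cost, pair_cost, id_cost, const_cost, pair_fn, id_fn, const_fn, encCands]
  omega

theorem best_size_le : best.size ≤ 100 := by
  simp [best, bestStep]

/-- The analyzer: the function `decode`, on input `(r, ms)`. -/
def analyzer (b L : ℕ) : Comb :=
  (snd.pair ((const b).pair ((const b).pair (((const 0).pair (const 0)).pair (const 0))))).seq
    ((iter (stage L)).seq (snd.seq (best.seq fst)))

theorem analyzer_fn (b L : ℕ) (r : Val) (ms : List Msg) :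
    (analyzer b L).fn (.pair r (encMsgs ms)) = .num (decode b L ms) := by
  have h := iter_fn_typed (stage L) (encMsgs ms) b encState (UserDP.stage ms L)
    (fun s => stage_fn ms L s) (b, [(0, 0)])
  have h0 : encState (b, [(0, 0)]) =
    .pair (.num b) (.pair (.pair (.num 0) (.num 0)) (.num 0)) := rfl
  rw [h0] at h
  simp only [analyzer, seq_fn, pair_fn, fst_fn, snd_fn, const_fn, Val.snd_pair, h]
  simp only [encState, Val.snd_pair, best_fn, encCand, Val.fst_pair, decode]

theorem analyzer_cost_le {ms : List Msg} {b L : ℕ} (hms : ∀ m ∈ ms, m.seed.length = b)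
    (hL : 0 < L) (r : Val) : (analyzer b L).cost (.pair r (encMsgs ms)) ≤
      b * (L * (ms.length * (b * 140 + 400) + L * 320 + 600) + 240) + L * 100 + 200 := by
  have h0 : encState (b, [(0, 0)]) =
    .pair (.num b) (.pair (.pair (.num 0) (.num 0)) (.num 0)) := rfl
  have h1 := iter_cost_le (stage L) (encMsgs ms) b (encState (b, [(0, 0)]))
    (fun v => ∃ s : ℕ × List (ℕ × ℕ), v = encState s ∧ s.2.length ≤ L)
    (L * (ms.length * (b * 140 + 400) + L * 320 + 600) + 200) ⟨_, rfl, hL⟩ (by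
      rintro _ ⟨s, rfl, hs⟩
      refine ⟨stage_cost_le hms hs, _, stage_fn ms L s, ?_⟩
      exact length_prune_le _ _)
  have h2 := iter_fn_typed (stage L) (encMsgs ms) b encState (UserDP.stage ms L)
    (fun s => stage_fn ms L s) (b, [(0, 0)])
  have h3 : ∀ t, ((UserDP.stage ms L)^[t] (b, [(0, 0)])).2.length ≤ L := by
    intro t
    cases t with
    | zero => exact hL
    | succ t =>
      rw [Function.iterate_succ_apply']
      exact length_prune_le _ _
  have h4 := best_cost_le ((UserDP.stage ms L)^[b] (b, [(0, 0)])).2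
  have h5 := h3 b
  rw [h0] at h1 h2
  rw [show L * (ms.length * (b * 140 + 400) + L * 320 + 600) + 200 + 40 =
    L * (ms.length * (b * 140 + 400) + L * 320 + 600) + 240 by omega] at h1
  simp only [analyzer, seq_cost, pair_cost, fst_cost, snd_cost, const_cost, pair_fn,
    snd_fn, const_fn, Val.snd_pair, h2]
  simp only [encState, Val.snd_pair]
  omega

theorem analyzer_size_le (b L : ℕ) : (analyzer b L).size ≤ 2 * b + L + 1500 := by
  have h1 := size_le_self b
  have h2 := size_le_self L
  have h3 := size_le_self 0
  have h4 := size_le_self 1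
  have h5 := expand_size_le
  have h6 := prune_size_le L
  have h7 := best_size_le
  simp only [analyzer, stage, seq_size, pair_size, fst_size, snd_size, const_size, sub_size,
    id_size, iter_size]
  omega

end Comb

end LocalPrograms


/-! ### The local learner -/

section Local

variable {X : Type*}

theorem messages_map_encMsg {U : Type*} (P : LocalParams) (h : U → ℕ) (S : List U) :
    messages (fun u => (P.msgLaw (h u)).map encMsg) S =
      (P.msgs (S.map h)).map (List.map encMsg) := by
  induction S with
  | nil => simp [messages, LocalParams.msgs, PMF.pure_map]
  | cons u S ih =>
    refine PMF.ext_of_ex fun f => ?_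
    simp only [messages, List.map_cons, LocalParams.msgs, ex_bind, ex_map, ih]

theorem LocalParams.length_of_mem_support_msgs (P : LocalParams) {hs : List ℕ} {ms : List Msg}
    (h : ms ∈ (P.msgs hs).support) : ms.length = hs.length := by
  induction hs generalizing ms with
  | nil =>
    simp only [msgs, PMF.mem_support_pure_iff] at h
    simp [h]
  | cons x hs ih =>
    simp only [msgs, PMF.mem_support_bind_iff, PMF.support_map, Set.mem_image] at h
    obtain ⟨m, hm, ms', hms, rfl⟩ := h
    simp [ih hms]

/-- The program of a user: draw, then apply the deterministic part of the randomizer. -/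
def rndProg (c : Comb) (P : LocalParams) : Prog RandOp :=
  .seq (.pair (.pair (drawNum P.l) (.pair (drawTape 1 P.b) (.pair (drawNum P.g) (drawNum 1))))
    .skip) (Comb.randomizer c P.b).prog

theorem randSize_rndProg_le (c : Comb) (P : LocalParams) :
    randSize (rndProg c P) ≤ c.size + 30 * P.b + 20 * P.l + 20 * P.g + 450 := by
  have h1 := randSize_drawNum P.l
  have h2 := randSize_drawTape 1 P.b
  have h3 := randSize_drawNum P.g
  have h4 := randSize_drawNum 1
  have h5 := Comb.randomizer_size_le c P.b
  rw [rndProg, randSize_draw_comb]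
  simp only [randSize, Prog.size] at h1 h2 h3 h4 ⊢
  omega

theorem law_rndProg (c : Comb) (P : LocalParams) {v : Val} {h Tc : ℕ} (hc : c.fn v = .num h)
    (hT : c.cost v ≤ Tc) : ((rndProg c P).run v).Law ((P.msgLaw h).map encMsg)
      (Tc + 150 * P.b + 20 * P.l + 20 * P.g + 250) := by
  have hlaw := law_draw_comb (v := v) (Comb.randomizer c P.b)
    (Prog.law_pair (law_drawNum P.l v) (Prog.law_pair (law_drawTape 1 P.b v)
      (Prog.law_pair (law_drawNum P.g v) (law_drawNum 1 v))))
    (T' := Tc + P.b * 120 + 200) (fun d hd => by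
      rw [PMF.mem_support_bind_iff] at hd
      obtain ⟨j, hj, hd⟩ := hd
      rw [PMF.support_map] at hj hd
      obtain ⟨j, -, rfl⟩ := hj
      obtain ⟨x, hx, rfl⟩ := hd
      rw [PMF.mem_support_bind_iff] at hx
      obtain ⟨a, ha, hx⟩ := hx
      rw [PMF.support_map] at ha hx
      obtain ⟨a, ha, rfl⟩ := ha
      obtain ⟨y, hy, rfl⟩ := hx
      rw [PMF.mem_support_bind_iff] at hy
      obtain ⟨z, hz, hy⟩ := hy
      rw [PMF.support_map] at hz hy
      obtain ⟨z, -, rfl⟩ := hz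
      obtain ⟨t, ht, rfl⟩ := hy
      rw [PMF.support_map] at ht
      obtain ⟨t, -, rfl⟩ := ht
      refine (Comb.randomizer_cost_le c P.b v h j a z t hc (mem_support_tapes ha).1).trans ?_
      omega)
  refine ((congrArg (fun μ => Timed.Law _ μ _) ?_).mp hlaw).mono (by omega)
  refine PMF.ext_of_ex fun f => ?_
  simp only [ex_map, ex_bind, LocalParams.msgLaw, Comb.randomizer_fn c P v h _ _ _ _ hc]

variable [Fintype X]

/-- A stable learner yields a local learner: every user reports a noisy bit about the hypothesis that
she computes with the public tape, and the analyzer decodes the hypothesis that most users hold. -/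
theorem localLearner_of_stable (enc : X → Val) (C : Set (X → Bool)) (P : LocalParams)
    (hyp : Fin (2 ^ P.b) → X → Bool) {α β ε : ℝ} (hβ : 0 < β) {m w T Tc L : ℕ}
    (c : Comb) (out : List ℕ → (Fin m → X × Bool) → ℕ)
    (hcost : ∀ r (u : Fin m → X × Bool), c.cost (.pair (encTape r) (encUser enc u)) ≤ Tc)
    (hfn : ∀ r (u : Fin m → X × Bool), c.fn (.pair (encTape r) (encUser enc u)) = .num (out r u))
    (hstable : ∀ D, Realizable C D → ∃ ref : List ℕ → ℕ,
      (∀ r ∈ (tapes w T).support, Good hyp D α (.num (ref r))) ∧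
      ex (iid m D) (fun u => ex (tapes w T) fun r => ind (out r u ≠ ref r)) ≤
        ENNReal.ofReal (β / 20))
    (hb : 0 < P.b) (hl : P.b ≤ 2 ^ P.l) (hL : 0 < L)
    (hg : (2 ^ P.g + 1 : ℕ) ≤ ENNReal.ofReal (Real.exp ε) * (2 ^ P.g - 1 : ℕ))
    (hLβ : P.b * (L : ℝ≥0∞)⁻¹ + 4⁻¹ ^ (2 ^ P.l - P.b) ≤ ENNReal.ofReal (β / 2)) :
    LocalLearner enc C hyp α β ε (40 * 2 ^ P.l * (2 ^ P.g) ^ 2) m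
      (c.size + 32 * P.b + 20 * P.l + 20 * P.g + L + (20 * w + 3) * T + 2000 : ℕ)
      (fun N => ((20 * w + 2) * T + Tc + 150 * P.b + 20 * P.l + 20 * P.g + 451 +
        P.b * (L * (N * (P.b * 140 + 400) + L * 320 + 600) + 240) + L * 100 : ℕ)) := by
  set R : Val → (Fin m → X × Bool) → PMF Val := fun r u =>
    (P.msgLaw (c.fn (.pair r (encUser enc u))).toNum).map encMsg with hR
  have hmsg : ∀ r S, messages (R (encTape r)) S =
      (P.msgs (S.map (out r))).map (List.map encMsg) := by
    intro r S
    simp only [hR, hfn, Val.toNum_num]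
    exact messages_map_encMsg P (out r) S
  refine ⟨drawTape w T, rndProg c P, (Comb.analyzer P.b L).prog, (tapes w T).map encTape, R,
    fun x => PMF.pure ((Comb.analyzer P.b L).fn (.pair x.1 (.ofList x.2))), ?_, ?_, ?_, ?_, ?_, ?_⟩
  · have h1 := randSize_drawTape w T
    have h2 := randSize_rndProg_le c P
    have h3 := Comb.analyzer_size_le P.b L
    rw [Comb.size] at h3
    rw [← Nat.cast_add, ← Nat.cast_add]
    exact Nat.cast_le.2 (by omega)
  · exact (law_drawTape w T _).computes (Nat.cast_le.2 (by omega))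
  · intro r hr u
    rw [PMF.support_map] at hr
    obtain ⟨r, -, rfl⟩ := hr
    simp only [hR, hfn, Val.toNum_num]
    exact (law_rndProg c P (hfn r u) (hcost r u)).computes (Nat.cast_le.2 (by omega))
  · intro S x hx
    rw [transcript, PMF.mem_support_bind_iff] at hx
    obtain ⟨r, hr, hx⟩ := hx
    rw [PMF.support_map] at hr
    obtain ⟨r, -, rfl⟩ := hr
    rw [hmsg, PMF.support_map, PMF.support_map] at hx
    obtain ⟨_, ⟨ms, hms, rfl⟩, rfl⟩ := hx
    have h1 := P.length_of_mem_support_msgs hms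
    rw [List.length_map] at h1
    have h2 := Comb.analyzer_cost_le (fun m hm => (P.mem_support_msgs hms m hm).2) hL (encTape r)
    rw [h1] at h2
    exact (((Comb.analyzer P.b L).ok _).mono h2).law.computes (Nat.cast_le.2 (by omega))
  · exact isLocalDP_of_dom fun r u u' => (P.dom_msgLaw hg _ _).map _
  · refine isAccurate_of_ex_le hβ.le fun D hD => ?_
    obtain ⟨ref, hgood, href⟩ := hstable D hD
    simp only [transcript, ex_bind, ex_map, ex_pure, hmsg]
    refine (ex_ex_le_of_numWrong (by positivity) (iid m D) (tapes w T) out ref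
      (θ := ENNReal.ofReal (β / 2)) href
      (fun r S => ex (P.msgs ((List.ofFn S).map (out r))) fun ms => ind (¬Good hyp D α
        ((Comb.analyzer P.b L).fn (.pair (encTape r) (.ofList (ms.map encMsg))))))
      (fun r S => ?_) fun r hr S hS => ?_).trans ?_
    · exact (ex_mono fun v _ => ind_le_one _).trans (ex_const _ _).le
    · obtain ⟨code, hcode, -⟩ := hgood r hr
      have hlt : ref r < 2 ^ P.b := by
        rw [Val.num.injEq] at hcode
        rw [hcode]
        exact code.2
      have hcount := count_ofFn (fun i => out r (S i)) (ref r)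
      have hmap : (List.ofFn S).map (out r) = List.ofFn fun i => out r (S i) := by
        rw [List.map_ofFn]
        rfl
      refine le_trans (ex_mono fun ms _ => ind_mono fun hbad => ?_)
        ((P.ex_decode_ne_le hl hb hlt (hs := (List.ofFn S).map (out r)) (by simp) ?_ hL).trans hLβ)
      · intro h
        refine hbad ?_
        have h1 := Comb.analyzer_fn P.b L (encTape r) ms
        rw [encMsgs] at h1
        rw [h1, h]
        exact hgood r hr
      · rw [hmap, List.length_ofFn]
        omega
    · rw [← ENNReal.ofReal_ofNat 10, ← ENNReal.ofReal_mul (by norm_num),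
        ← ENNReal.ofReal_add (by positivity) (by positivity)]
      exact ENNReal.ofReal_le_ofReal (by linarith)

theorem localLearner_const (enc : X → Val) (C : Set (X → Bool))
    (hyp : Fin (2 ^ 0) → X → Bool) {α β ε : ℝ} (hβ : 0 ≤ β) (hε : 0 ≤ ε)
    (h : ∀ D, Realizable C D → Good hyp D α (.num 0)) {L : ℝ} {B : ℕ → ℝ} (hL : 6 ≤ L)
    (hB : ∀ N, 1 ≤ B N) : LocalLearner enc C hyp α β ε 0 0 L B := by
  have hc : ∀ v N, Computes (.const 0) v (PMF.pure (.num 0)) (B N) := fun v N =>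
    Prog.Runs.const.law.computes (by simpa using hB N)
  have hs : randSize (.const 0) = 1 := by simp [randSize, Prog.size]
  refine ⟨.const 0, .const 0, .const 0, PMF.pure (.num 0), fun _ _ => PMF.pure (.num 0),
    fun _ => PMF.pure (.num 0), ?_, hc _ _, fun _ _ _ => hc _ _, fun _ _ _ => hc _ _, ?_,
    isAccurate_of_ex_le hβ fun D hD => ?_⟩
  · rw [hs]
    norm_num
    linarith
  · refine isLocalDP_of_dom fun r u u' f => le_mul_of_one_le_left zero_le ?_
    rw [← ENNReal.ofReal_one]
    exact ENNReal.ofReal_le_ofReal (Real.one_le_exp hε)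
  · simp [transcript, messages, ind_of_false (not_not.2 (h D hD))]

end Local


/-! ### The parameters of the local learner -/

section LocalParameters

variable {X : Type*} [Fintype X]

theorem LocalLearner.mono {enc : X → Val} {C : Set (X → Bool)} {b : ℕ}
    {hyp : Fin (2 ^ b) → X → Bool} {α β ε : ℝ} {n m : ℕ} {L L' : ℝ} {B B' : ℕ → ℝ}
    (h : LocalLearner enc C hyp α β ε n m L B) (hL : L ≤ L') (hB : ∀ N, B N ≤ B' N) :
    LocalLearner enc C hyp α β ε n m L' B' := by
  obtain ⟨gen, rnd, ana, G, R, M, h1, ⟨t, ht, h2⟩, h3, h4, h5⟩ := h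
  refine ⟨gen, rnd, ana, G, R, M, h1.trans hL, ⟨t, ht.trans (hB _), h2⟩, fun r hr u => ?_,
    fun S x hx => ?_, h5⟩
  · obtain ⟨t, ht, h⟩ := h3 r hr u
    exact ⟨t, ht.trans (hB _), h⟩
  · obtain ⟨t, ht, h⟩ := h4 S x hx
    exact ⟨t, ht.trans (hB _), h⟩

/-- The length of the local learner, if `V` bounds all parameters. -/
theorem local_length_le {V Y s w T L b l g : ℕ} (hw : w ≤ 16 * Y ^ 2) (hT : T ≤ Y) (hY : Y ≤ V)
    (hV : 1 ≤ V) (hs : s ≤ 500000 * Y ^ 6 * V) (hL : L ≤ 4 * V ^ 2) (hb : b ≤ V) (hl : l ≤ V)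
    (hg : g ≤ V) :
    s + 32 * b + 20 * l + 20 * g + L + (20 * w + 3) * T + 2000 ≤ 600000 * V ^ 7 := by
  have h1 : s ≤ 500000 * V ^ 7 := hs.trans (by
    calc 500000 * Y ^ 6 * V ≤ 500000 * V ^ 6 * V := by gcongr
      _ = _ := by ring)
  have h2 : (20 * w + 3) * T ≤ 323 * V ^ 7 := by
    calc (20 * w + 3) * T ≤ (20 * (16 * V ^ 2) + 3 * V ^ 2) * V := by
          gcongr
          · exact hw.trans (by gcongr)
          · have := Nat.one_le_pow 2 V hV; omega
          · exact hT.trans hY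
      _ = 323 * V ^ 3 := by ring
      _ ≤ 323 * V ^ 7 := by gcongr; omega
  have h3 : V ≤ V ^ 7 := Nat.le_self_pow (by norm_num) _
  have h4 : V ^ 2 ≤ V ^ 7 := Nat.pow_le_pow_right hV (by norm_num)
  omega

/-- The running time of the local learner, if `V` bounds all parameters. -/
theorem local_time_le {V Y w T L b l g N : ℕ} (hw : w ≤ 16 * Y ^ 2) (hT : T ≤ Y) (hY : Y ≤ V)
    (hV : 1 ≤ V) (hL : L ≤ 4 * V ^ 2) (hb : b ≤ V) (hl : l ≤ V) (hg : g ≤ V) (hN : N ≤ V) :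
    (20 * w + 2) * T + 1000000 * Y ^ 10 + 150 * b + 20 * l + 20 * g + 451 +
      b * (L * (N * (b * 140 + 400) + L * 320 + 600) + 240) + L * 100 ≤ 2000000 * V ^ 11 := by
  have h1 : b * (L * (N * (b * 140 + 400) + L * 320 + 600) + 240) ≤ 9920 * V ^ 11 := by
    have h2 : V ≤ V ^ 2 := Nat.le_self_pow (by norm_num) _
    have h3 : 1 ≤ V ^ 2 := Nat.one_le_pow _ _ hV
    have h4 : 1 ≤ V ^ 4 := Nat.one_le_pow _ _ hV
    calc b * (L * (N * (b * 140 + 400) + L * 320 + 600) + 240)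
        ≤ V * (4 * V ^ 2 * (V * (V * 140 + 400 * V) + 4 * V ^ 2 * 320 + 600 * V ^ 2) +
            240 * V ^ 4) := by
          gcongr
          · omega
          · omega
          · omega
      _ = 9920 * V ^ 5 := by ring
      _ ≤ _ := by gcongr; omega
  have h2 : (20 * w + 2) * T ≤ 322 * V ^ 11 := by
    calc (20 * w + 2) * T ≤ (20 * (16 * V ^ 2) + 2 * V ^ 2) * V := by
          gcongr
          · exact hw.trans (by gcongr)
          · have := Nat.one_le_pow 2 V hV; omega
          · exact hT.trans hY
      _ = 322 * V ^ 3 := by ring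
      _ ≤ 322 * V ^ 11 := by gcongr; omega
  have h3 : V ≤ V ^ 11 := Nat.le_self_pow (by norm_num) _
  have h4 : V ^ 2 ≤ V ^ 11 := Nat.pow_le_pow_right hV (by norm_num)
  have h5 : Y ^ 10 ≤ V ^ 11 :=
    (Nat.pow_le_pow_left hY 10).trans (Nat.pow_le_pow_right hV (by norm_num))
  generalize V ^ 11 = Z at *
  generalize V ^ 2 = Z₂ at *
  generalize b * (L * (N * (b * 140 + 400) + L * 320 + 600) + 240) = a at *
  generalize Y ^ 10 = y at *
  omega

/-- The bounds on length and time of `localLearner_of_stable` in terms of the quantities of the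
theorem. -/
theorem LocalLearner.of_bounds {enc : X → Val} {C : Set (X → Bool)} {b : ℕ}
    {hyp : Fin (2 ^ b) → X → Bool} {α τ β ε : ℝ} (hτ : 0 < τ) (hβ : 0 < β)
    {m w T n Y cs s l g L K k : ℕ} (hK : (10 : ℝ) ^ 40 ≤ K) (hk : 11 ≤ k) (hTY : T ≤ Y) (hY1 : 1 ≤ Y)
    (hY : (Y : ℝ) ≤ 20 * (1 + T + 1 / τ + 1 / β)) (hw : w ≤ 16 * Y ^ 2)
    (hcs : cs ≤ 500000 * Y ^ 6 * (s + b + 1)) (hL : L ≤ 4 * b * Y) (hb : b ≤ n) (hl : l ≤ n)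
    (hg : g ≤ n)
    (h : LocalLearner enc C hyp α β ε n m
      (cs + 32 * b + 20 * l + 20 * g + L + (20 * w + 3) * T + 2000 : ℕ)
      (fun N => ((20 * w + 2) * T + 1000000 * Y ^ 10 + 150 * b + 20 * l + 20 * g + 451 +
        b * (L * (N * (b * 140 + 400) + L * 320 + 600) + 240) + L * 100 : ℕ))) :
    LocalLearner enc C hyp α β ε n m (K * (1 + s + b + T + 1 / τ + 1 / β + n) ^ k)
      (fun N => K * (1 + T + 1 / τ + 1 / β + n + N) ^ k) := by
  have hτi : 0 < 1 / τ := by positivity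
  have hβi : 0 < 1 / β := by positivity
  have hT0 : (0 : ℝ) ≤ T := Nat.cast_nonneg _
  have hs0 : (0 : ℝ) ≤ s := Nat.cast_nonneg _
  have hb0 : (0 : ℝ) ≤ b := Nat.cast_nonneg _
  have hn0 : (0 : ℝ) ≤ n := Nat.cast_nonneg _
  have hLV : ∀ {V}, b ≤ V → Y ≤ V → L ≤ 4 * V ^ 2 := fun {V} h1 h2 => hL.trans (by
    calc 4 * b * Y ≤ 4 * V * V := by gcongr
      _ = _ := by ring)
  refine h.mono ?_ fun N => ?_
  · obtain ⟨V, hV⟩ : ∃ V, V = Y + n + s + b := ⟨_, rfl⟩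
    have h1 := local_length_le (V := V) (b := b) (l := l) (g := g) hw hTY (by omega) (by omega)
      (hcs.trans (Nat.mul_le_mul_left _ (by omega))) (hLV (by omega) (by omega)) (by omega)
      (by omega) (by omega)
    obtain ⟨Z, hZ⟩ : ∃ Z, Z = 1 + (s : ℝ) + b + T + 1 / τ + 1 / β + n := ⟨_, rfl⟩
    rw [← hZ]
    have h2 : (V : ℝ) ≤ 20 * Z := by rw [hV]; push_cast; linarith
    refine (Nat.cast_le.2 h1).trans ?_
    calc ((600000 * V ^ 7 : ℕ) : ℝ) = 600000 * (V : ℝ) ^ 7 := by push_cast; rfl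
      _ ≤ 600000 * (20 * Z) ^ 7 := by gcongr
      _ = 600000 * 20 ^ 7 * Z ^ 7 := by ring
      _ ≤ _ := bound_mono (by linarith) (le_trans (by norm_num) hK) (by omega)
  · obtain ⟨V, hV⟩ : ∃ V, V = Y + n + N := ⟨_, rfl⟩
    have h1 := local_time_le (V := V) (b := b) (l := l) (g := g) (N := N) hw hTY (by omega)
      (by omega) (hLV (by omega) (by omega)) (by omega) (by omega) (by omega) (by omega)
    have hN0 : (0 : ℝ) ≤ N := Nat.cast_nonneg _
    obtain ⟨Z, hZ⟩ : ∃ Z, Z = 1 + (T : ℝ) + 1 / τ + 1 / β + n + N := ⟨_, rfl⟩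
    rw [← hZ]
    have h2 : (V : ℝ) ≤ 20 * Z := by rw [hV]; push_cast; linarith
    refine (Nat.cast_le.2 h1).trans ?_
    calc ((2000000 * V ^ 11 : ℕ) : ℝ) = 2000000 * (V : ℝ) ^ 11 := by push_cast; rfl
      _ ≤ 2000000 * (20 * Z) ^ 11 := by gcongr
      _ = 2000000 * 20 ^ 11 * Z ^ 11 := by ring
      _ ≤ _ := bound_mono (by linarith) (le_trans (by norm_num) hK) (by omega)

theorem two_pow_clog_le {n : ℕ} (hn : 1 < n) : 2 ^ Nat.clog 2 n ≤ 2 * n := by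
  have h1 := Nat.pow_pred_clog_lt_self (b := 2) (by norm_num) hn
  have h2 : 0 < Nat.clog 2 n := Nat.clog_pos (by norm_num) hn
  obtain ⟨j, hj⟩ : ∃ j, Nat.clog 2 n = j + 1 := ⟨Nat.clog 2 n - 1, by omega⟩
  rw [hj] at h1 ⊢
  rw [pow_succ]
  simp only [Nat.pred_eq_sub_one, Nat.add_sub_cancel] at h1
  omega

/-- Randomized response is `ε`-private if the noise rate is at least `1 - ε / 4`. -/
theorem noise_bound {ε : ℝ} (hε : 0 < ε) (hε1 : ε < 1) {g : ℕ} (hg : 4 / ε ≤ 2 ^ g) :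
    (2 ^ g + 1 : ℕ) ≤ ENNReal.ofReal (Real.exp ε) * (2 ^ g - 1 : ℕ) := by
  have h1 := Nat.one_le_two_pow (n := g)
  rw [← ENNReal.ofReal_natCast, ← ENNReal.ofReal_natCast, ← ENNReal.ofReal_mul (by positivity)]
  refine ENNReal.ofReal_le_ofReal ?_
  rw [Nat.cast_sub h1]
  push_cast
  rw [div_le_iff₀ hε] at hg
  have h2 := Real.add_one_le_exp ε
  have h3 : (1 : ℝ) ≤ 2 ^ g := by exact_mod_cast h1
  calc (2 : ℝ) ^ g + 1 ≤ (ε + 1) * (2 ^ g - 1) := by linarith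
    _ ≤ _ := by gcongr

/-- The two ways in which the decoder may fail have probability at most `β / 4` each. -/
theorem failure_bound {β : ℝ} (hβ : 0 < β) {b L k₂ e : ℕ} (hL : 4 * b / β ≤ L) (hL0 : 0 < L)
    (hk : 4 / β ≤ 2 ^ k₂) (he : k₂ ≤ e) :
    b * (L : ℝ≥0∞)⁻¹ + 4⁻¹ ^ e ≤ ENNReal.ofReal (β / 2) := by
  have hL0' : (0 : ℝ) < L := by exact_mod_cast hL0
  have h1 : (b : ℝ≥0∞) * (L : ℝ≥0∞)⁻¹ ≤ ENNReal.ofReal (β / 4) := by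
    rw [← ENNReal.ofReal_natCast, ← ENNReal.ofReal_natCast, ← ENNReal.ofReal_inv_of_pos hL0',
      ← ENNReal.ofReal_mul (by positivity)]
    refine ENNReal.ofReal_le_ofReal ?_
    rw [← div_eq_mul_inv, div_le_iff₀ hL0']
    rw [div_le_iff₀ hβ] at hL
    linarith
  have h2 : (4⁻¹ : ℝ≥0∞) ^ e ≤ ENNReal.ofReal (β / 4) := by
    rw [← ENNReal.ofReal_ofNat 4, ← ENNReal.ofReal_inv_of_pos (by norm_num),
      ← ENNReal.ofReal_pow (by norm_num)]
    refine ENNReal.ofReal_le_ofReal ?_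
    rw [inv_pow, inv_le_comm₀ (by positivity) (by positivity), inv_div]
    calc 4 / β ≤ 2 ^ k₂ := hk
      _ ≤ 4 ^ k₂ := by gcongr; norm_num
      _ ≤ 4 ^ e := by gcongr; norm_num
  calc _ ≤ ENNReal.ofReal (β / 4) + ENNReal.ofReal (β / 4) := add_le_add h1 h2
    _ = _ := by
        rw [← ENNReal.ofReal_add (by positivity) (by positivity)]
        congr 1
        ring

/-- The local learner: there are `O(b + log (1 / β))` levels, and `O(1 / ε ^ 2)` users per level
outweigh the noise. -/
theorem exists_local (enc : X ↪ Val) (C : Set (X → Bool)) {b : ℕ} (hb : 0 < b)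
    (hyp : Fin (2 ^ b) → X → Bool) {α τ β ε : ℝ} (hτ : 0 < τ) (hβ : 0 < β) (hβ1 : β < 1)
    (hε : 0 < ε) (hε1 : ε < 1) {q T : ℕ}
    {A : Prog SQOp} (hA : SQLearns enc C hyp α τ q T A) {K k : ℕ} (hK : (10 : ℝ) ^ 40 ≤ K)
    (hk : 11 ≤ k) : ∃ n m : ℕ,
      (n : ℝ) ≤ K * ((b + Real.log (1 / β)) / ε ^ 2) ∧ (m : ℝ) ≤ K * (1 + q / (β * τ)) ^ k ∧
      LocalLearner enc C hyp α β ε n m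
        (K * (1 + sqSize A + b + T + 1 / τ + 1 / β + n) ^ k)
        (fun N => K * (1 + T + 1 / τ + 1 / β + n + N) ^ k) := by
  obtain ⟨m, w, Y, c, out, hm, hTY, hβY, hY20, hY, hw, hsize, hcost, hfn, -, hstable⟩ :=
    exists_stable enc C hyp hτ hβ hβ1 hA
  have h4β : 1 < 4 / β := by rw [lt_div_iff₀ hβ]; linarith
  have h4ε : 4 < 4 / ε := by rw [lt_div_iff₀ hε]; linarith
  obtain ⟨hk1, hk2⟩ := clog_ceil_le h4β
  obtain ⟨hg1, -⟩ := clog_ceil_le (show 1 < 4 / ε by linarith)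
  have hg2 := two_pow_clog_le (n := ⌈4 / ε⌉₊) (Nat.lt_ceil.2 (by push_cast; linarith))
  have hg3 := Nat.ceil_lt_add_one (show 0 ≤ 4 / ε by positivity)
  have hk0 : 0 < Nat.clog 2 ⌈4 / β⌉₊ :=
    Nat.clog_pos (by norm_num) (Nat.lt_ceil.2 (by push_cast; linarith))
  generalize Nat.clog 2 ⌈4 / β⌉₊ = k₂ at *
  generalize Nat.clog 2 ⌈4 / ε⌉₊ = g at *
  have hl1 : b + k₂ ≤ 2 ^ Nat.clog 2 (b + k₂) := Nat.le_pow_clog (by norm_num) _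
  have hl2 := two_pow_clog_le (n := b + k₂) (by omega)
  generalize Nat.clog 2 (b + k₂) = l at *
  have hL1 := Nat.le_ceil (4 * b / β)
  have hL2 : ⌈4 * b / β⌉₊ ≤ 4 * b * Y := by
    refine Nat.ceil_le.2 ?_
    push_cast
    calc 4 * (b : ℝ) / β = 4 * b * (1 / β) := by ring
      _ ≤ _ := by gcongr
  have hb1 : (1 : ℝ) ≤ b := by exact_mod_cast hb
  have hL0 : 0 < ⌈4 * b / β⌉₊ := Nat.ceil_pos.2 (by positivity)
  generalize ⌈4 * b / β⌉₊ = L at *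
  have h := localLearner_of_stable enc C ⟨b, l, g⟩ hyp hβ c out hcost hfn hstable hb
    (by simp only; omega) hL0 (noise_bound hε hε1 hg1)
    (failure_bound (e := 2 ^ l - b) hβ hL1 hL0 hk1 (by omega))
  simp only at h
  have hg0 : g ≤ 2 ^ g := Nat.lt_two_pow_self.le
  have hl0 : l ≤ 2 ^ l := Nat.lt_two_pow_self.le
  have hn1 : 2 ^ l ≤ 40 * 2 ^ l * (2 ^ g) ^ 2 := by
    have : 0 < (2 ^ g) ^ 2 := by positivity
    nlinarith [Nat.zero_le (2 ^ l)]
  have hn2 : 2 ^ g ≤ 40 * 2 ^ l * (2 ^ g) ^ 2 := by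
    have h1 : 0 < 2 ^ l := by positivity
    have h2 : 2 ^ g ≤ (2 ^ g) ^ 2 := Nat.le_self_pow (by norm_num) _
    have h3 : (2 ^ g) ^ 2 ≤ 40 * 2 ^ l * (2 ^ g) ^ 2 := Nat.le_mul_of_pos_left _ (by positivity)
    exact h2.trans h3
  refine ⟨40 * 2 ^ l * (2 ^ g) ^ 2, m, ?_, samples_le hβ hτ hK hk hm, ?_⟩
  · have h6 := Real.log_two_lt_d9
    have h7 : Real.log (4 / β) = 2 * Real.log 2 + Real.log (1 / β) := by
      rw [show 4 / β = 2 ^ 2 * (1 / β) by ring, Real.log_mul (by norm_num) (by positivity),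
        Real.log_pow]
      norm_num
    have h8 : 0 ≤ Real.log (1 / β) := Real.log_nonneg (by rw [le_div_iff₀ hβ]; linarith)
    have h9 : (2 : ℝ) ^ l ≤ 12 * (b + Real.log (1 / β)) := by
      have h10 : ((2 ^ l : ℕ) : ℝ) ≤ ((2 * (b + k₂) : ℕ) : ℝ) := Nat.cast_le.2 hl2
      rw [h7] at hk2
      push_cast at h10
      linarith
    have h11 : (2 : ℝ) ^ g ≤ 10 / ε := by
      have h10 : ((2 ^ g : ℕ) : ℝ) ≤ ((2 * ⌈4 / ε⌉₊ : ℕ) : ℝ) := Nat.cast_le.2 hg2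
      push_cast at h10
      have : 10 / ε = 8 / ε + 2 / ε := by ring
      have : 8 / ε = 2 * (4 / ε) := by ring
      have : 2 / ε = (4 / ε) / 2 := by ring
      linarith
    push_cast
    calc 40 * (2 : ℝ) ^ l * (2 ^ g) ^ 2
        ≤ 40 * (12 * (b + Real.log (1 / β))) * (10 / ε) ^ 2 := by gcongr
      _ = 48000 * ((b + Real.log (1 / β)) / ε ^ 2) := by ring
      _ ≤ _ := by
        have : 0 ≤ (b + Real.log (1 / β)) / ε ^ 2 := by positivity
        gcongr
        exact le_trans (by norm_num) hK
  · exact LocalLearner.of_bounds hτ hβ hK hk hTY (by omega) hY hw hsize hL2 (by omega) (by omega)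
      (by omega) h

/-- The bounds of the theorem leave room for constant learners. -/
theorem const_bounds {τ β : ℝ} (s T : ℕ) (hτ : 0 < τ) (hβ : 0 < β) {K : ℕ}
    (hK : (10 : ℝ) ^ 40 ≤ K) (k : ℕ) :
    6 ≤ K * (1 + s + (0 : ℕ) + T + 1 / τ + 1 / β + (0 : ℕ)) ^ k ∧
      ∀ N : ℕ, 6 ≤ K * (1 + T + 1 / τ + 1 / β + (0 : ℕ) + N) ^ k := by
  have h : ∀ x : ℝ, 0 ≤ x → 6 ≤ K * (1 + x) ^ k := fun x hx =>
    calc (6 : ℝ) = 6 * (1 + x) ^ 0 := by simp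
      _ ≤ _ := bound_mono (by linarith) (le_trans (by norm_num) hK) (by omega)
  constructor
  · have := h (s + (0 : ℕ) + T + 1 / τ + 1 / β + (0 : ℕ)) (by positivity)
    simpa only [← add_assoc] using this
  · intro N
    have := h (T + 1 / τ + 1 / β + (0 : ℕ) + N) (by positivity)
    simpa only [← add_assoc] using this

end LocalParameters

end UserDP

theorem mainTheorem5 :
    ∃ K k : ℕ, ∀ (X : Type*) [Fintype X] (enc : X ↪ Val) (C : Set (X → Bool))
      (b : ℕ) (hyp : Fin (2 ^ b) → X → Bool) (α τ : ℝ) (q T : ℕ) (A : Prog SQOp),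
      0 < α → α < 1 → 0 < τ → SQLearns enc C hyp α τ q T A →
      ∀ β ε : ℝ, 0 < β → β < 1 → 0 < ε → ε < 1 →
        (∀ δ : ℝ, 0 < δ → δ < 1 → ∃ n m : ℕ,
          (n : ℝ) ≤ K * (Real.log (2 / δ) / ε) ∧
          (m : ℝ) ≤ K * (1 + q / (β * τ)) ^ k ∧
          CentralLearner enc C hyp α β ε δ n m
            (K * (1 + sqSize A + b + T + 1 / τ + 1 / β + n) ^ k)
            (fun N => K * (1 + T + 1 / τ + 1 / β + n + N) ^ k)) ∧
        (∃ n m : ℕ,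
          (n : ℝ) ≤ K * ((b + Real.log (1 / β)) / ε) ∧
          (m : ℝ) ≤ K * (1 + q / (β * τ)) ^ k ∧
          CentralLearner enc C hyp α β ε 0 n m
            (K * (1 + sqSize A + b + T + 1 / τ + 1 / β + n) ^ k)
            (fun N => K * (1 + T + 1 / τ + 1 / β + n + N) ^ k)) ∧
        (∃ n m : ℕ,
          (n : ℝ) ≤ K * ((b + Real.log (1 / β)) / ε ^ 2) ∧
          (m : ℝ) ≤ K * (1 + q / (β * τ)) ^ k ∧
          LocalLearner enc C hyp α β ε n m
            (K * (1 + sqSize A + b + T + 1 / τ + 1 / β + n) ^ k)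
            (fun N => K * (1 + T + 1 / τ + 1 / β + n + N) ^ k)) := by
  obtain ⟨K, hK⟩ : ∃ K : ℕ, (10 : ℝ) ^ 40 ≤ K := exists_nat_ge _
  refine ⟨K, 11, fun X _ enc C b hyp α τ q T A _ _ hτ hA β ε hβ hβ1 hε hε1 => ?_⟩
  have hlog : 0 ≤ Real.log (1 / β) := Real.log_nonneg (by rw [le_div_iff₀ hβ]; linarith)
  refine ⟨fun δ hδ hδ1 => exists_approx_central enc C hyp hτ hβ hβ1 hε hε1 hδ hδ1 hA hK le_rfl,
    ?_, ?_⟩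
  · obtain rfl | hb := Nat.eq_zero_or_pos b
    · obtain ⟨h1, h2⟩ := const_bounds (sqSize A) T hτ hβ hK 11
      exact ⟨0, 0, by simp only [Nat.cast_zero, zero_add]; positivity,
        by simp only [Nat.cast_zero]; positivity, centralLearner_const enc C hyp hβ.le hε.le
        (fun D hD => good_zero enc C hyp hτ hA hD) (le_trans (by norm_num) h1)
        fun N => le_trans (by norm_num) (h2 N)⟩
    · exact exists_pure_central enc C hb hyp hτ hβ hβ1 hε hε1 hA hK le_rfl
  · obtain rfl | hb := Nat.eq_zero_or_pos b
    · obtain ⟨h1, h2⟩ := const_bounds (sqSize A) T hτ hβ hK 11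
      exact ⟨0, 0, by simp only [Nat.cast_zero, zero_add]; positivity,
        by simp only [Nat.cast_zero]; positivity, localLearner_const enc C hyp hβ.le hε.le
        (fun D hD => good_zero enc C hyp hτ hA hD) h1 fun N => le_trans (by norm_num) (h2 N)⟩
    · exact exists_local enc C hb hyp hτ hβ hβ1 hε hε1 hA hK le_rfl
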